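/- **Setting.** Let $d\in\{2,3\}$. Let $\mathcal T$ be a finite conforming triangulation of an open set $\Omega\subset\mathbb R^d$ into non-degenerate closed simplices: any two simplices meet in the convex hull of their common vertices, and $\Omega$ is the interior of $\bigcup_{T\in\mathcal T}T$ (this covers every triangulated bounded Lipschitz domain). Let $\mathcal F$ be the set of faces, $h=\max_T\operatorname{diam}T$, $n$ the outward unit normal on $\partial T$, and $v_t=v-(v\cdot n)n$. The mesh is called quasi-uniform with constant $\sigma>0$ if every $T\in\mathcal T$ contains a closed ball of radius $h/\sigma$. For $k\ge 1$ let $$V_h=P_k(\mathcal T)^d\cap H_0(\mathrm{div},\Omega),\qquad Q_h=P_{k-1}(\mathcal T),$$ $$\widehat V_h=\{\hat v:\ \hat v|_F\in P_k(F)^d,\ \hat v\cdot n_F=0\ \ \forall F\in\mathcal F,\ \hat v=0\text{ on faces in }\partial\Omega\},$$ where $n_F$ is a unit normal of $F$. With a penalty parameter $\alpha$ set $$a_h((u,\hat u),(v,\hat v))=\sum_{T}\Big[(\nabla u,\nabla v)_T+(\nabla u\,n,(\hat v-v)_t)_{\partial T}+(\nabla v\,n,(\hat u-u)_t)_{\partial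 T}+\tfrac{\alpha k^2}{h}((\hat u-u)_t,(\hat v-v)_t)_{\partial T}\Big],$$ $$c_h(\varrho,u,\lambda)=-\sum_T(\varrho u,\nabla\lambda)_T+\sum_T(u\cdot n\,\varrho^{up},\lambda)_{\partial T},$$ where $\varrho^{up}$ is the upwind value of $\varrho$ with respect to $u$, i.e. the value from the cell out of which $u$ flows. The flow direction may be determined either pointwise, by the sign of $u\cdot n$, or facewise, by the sign of $\int_F u\cdot n$ (in the case of sign zero the mean of both values is taken). The results below hold for both conventions. Let $\nu>0$, $\tau>0$, $c_M\in\mathbb R$, $f\in L^2(\Omega)^d$, $g\in L^\infty(\Omega)^d$. Given $\varrho_h^n\in Q_h$, the *velocity update* seeks $(u_h^{n+1},\hat u_h^{n+1})\in V_h\times\widehat V_h$ with $$\nu\,a_h((u_h^{n+1},\hat u_h^{n+1}),(v_h,\hat v_h))=(f,v_h)+(g,\varrho_h^n v_h)+(c_M\varrho_h^n,\operatorname{div}v_h)\qquad\forall (v_h,\hat v_h)\in V_h\times\widehat V_h,$$ and, given $u_h^{n+1}\in V_h$, the *density update* seeks $\varrho_h^{n+1}\in Q_h$ with $$\tau^{-1}(\varrho_h^{n+1},\lambda_h)+c_h(\varrho_h^{n+1},u_h^{n+1},\lambda_h)=\tau^{-1}(\varrho_h^n,\lambda_h)\qquad\forall\lambda_h\in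 Q_h .$$ **Lemma (Solvability of the sub-systems).** 1. For every $k\ge1$ and $\sigma>0$ there is $\alpha_0>0$, depending only on $d,k,\sigma$, such that on every mesh that is quasi-uniform with constant $\sigma$ and for every $\alpha\ge\alpha_0$, the velocity update has exactly one solution, for all data $\nu,c_M,f,g,\varrho_h^n$ as above. 2. Let $k=1$. For every mesh, every $\tau>0$ and every $u_h^{n+1}\in V_h$, the system matrix of the density update in the basis $(\chi_T)_{T\in\mathcal T}$ of cell indicator functions is an M-matrix (its off-diagonal entries are non-positive, and it is invertible with an entrywise non-negative inverse). For every $\varrho_h^n\in Q_h$ the density update has exactly one solution $\varrho_h^{n+1}$. If $\varrho_h^n>0$, then $\varrho_h^{n+1}>0$, and if $(\varrho_h^n,1)=M$, then $(\varrho_h^{n+1},1)=M$. -/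

import Mathlib

open MeasureTheory
open scoped ContDiff

noncomputable section

namespace HDG

/-- `ℝ^d` with the Euclidean norm. -/
abbrev Eu (d : ℕ) : Type := EuclideanSpace ℝ (Fin d)

/-- A regular (conforming) simplicial triangulation of `Ω ⊆ ℝ^d`. A simplex is given by the finite
set of its vertices. Two simplices meet in the convex hull of their common vertices, and `Ω` is
the interior of the union of all simplices. -/
structure Mesh (d : ℕ) (Ω : Set (Eu d)) where
  cells : Finset (Finset (Eu d))
  card_cell : ∀ T ∈ cells, T.card = d + 1
  indep : ∀ T ∈ cells, AffineIndependent ℝ ((↑) : T → Eu d)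
  conforming : ∀ S ∈ cells, ∀ T ∈ cells,
    convexHull ℝ (S : Set (Eu d)) ∩ convexHull ℝ (T : Set (Eu d)) ⊆
      convexHull ℝ ((S : Set (Eu d)) ∩ (T : Set (Eu d)))
  domain_eq : Ω = interior (⋃ T ∈ cells, convexHull ℝ (T : Set (Eu d)))

/-- The closed simplex with vertex set `S`. -/
def hull {d : ℕ} (S : Finset (Eu d)) : Set (Eu d) := convexHull ℝ (S : Set (Eu d))

/-- The barycentre of the points of `S`. -/
def barycentre {d : ℕ} (S : Finset (Eu d)) : Eu d := (S.card : ℝ)⁻¹ • ∑ x ∈ S, x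

/-- The unit normal vector on the face `F` of the simplex `T` pointing out of `T`: the normalized
component, orthogonal to `F`, of the vector from the barycentre of `T` to the barycentre of `F`. -/
def outwardNormal {d : ℕ} (T F : Finset (Eu d)) : Eu d :=
  let w := (vectorSpan ℝ (F : Set (Eu d)))ᗮ.starProjection (barycentre F - barycentre T)
  ‖w‖⁻¹ • w

/-- The tangential part `v - (v · n) n`. -/
def tang {d : ℕ} (n v : Eu d) : Eu d := v - (inner ℝ v n) • n

/-- `P^k`: real polynomial functions on `ℝ^d` of total degree at most `k`. -/
def polySpace (d k : ℕ) : Submodule ℝ (Eu d → ℝ) where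
  carrier := {f | ∃ p : MvPolynomial (Fin d) ℝ, p.totalDegree ≤ k ∧
    ∀ x : Eu d, f x = MvPolynomial.eval (fun i => x i) p}
  add_mem' := by
    rintro f g ⟨p, hp, hf⟩ ⟨q, hq, hg⟩
    exact ⟨p + q, (MvPolynomial.totalDegree_add p q).trans (max_le hp hq),
      fun x => by simp [hf, hg]⟩
  zero_mem' := ⟨0, by simp, fun x => by simp⟩
  smul_mem' := by
    rintro c f ⟨p, hp, hf⟩
    exact ⟨c • p, (MvPolynomial.totalDegree_smul_le c p).trans hp,
      fun x => by simp [hf, MvPolynomial.smul_eval]⟩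

/-- Vector fields on `ℝ^d` all of whose components lie in `P^k`. -/
def vecPoly (d k : ℕ) : Set (Eu d → Eu d) :=
  {p | ∀ i : Fin d, (fun x => p x i) ∈ polySpace d k}

/-- The divergence of a differentiable vector field. -/
def divergence {d : ℕ} (v : Eu d → Eu d) (x : Eu d) : ℝ :=
  ∑ i : Fin d, (fderiv ℝ v x (EuclideanSpace.single i 1)) i

/-- The Frobenius product of the Jacobian matrices of `u` and `v` at `x`. -/
def gradProd {d : ℕ} (u v : Eu d → Eu d) (x : Eu d) : ℝ :=
  ∑ i : Fin d, inner ℝ (fderiv ℝ u x (EuclideanSpace.single i 1))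
    (fderiv ℝ v x (EuclideanSpace.single i 1))

/-- `H_0(div, Ω)`: square-integrable fields with a weak divergence `q ∈ L²(Ω)` and zero normal trace
on the boundary. Since the test functions `φ` are smooth up to (and beyond) the boundary of `Ω`,
the integration-by-parts formula without boundary term expresses both properties. -/
def HdivZero {d : ℕ} (Ω : Set (Eu d)) : Set (Eu d → Eu d) :=
  {w | MemLp w 2 (volume.restrict Ω) ∧ ∃ q : Eu d → ℝ, MemLp q 2 (volume.restrict Ω) ∧
    ∀ φ : Eu d → ℝ, ContDiff ℝ ∞ φ → HasCompactSupport φ →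
      ∫ x in Ω, inner ℝ (w x) (gradient φ x) = -∫ x in Ω, q x * φ x}

/-- Which of the two usual upwind rules on a face is used: the upwind side is determined by the sign
of the normal velocity at each point of the face, or by the sign of its integral over the face. -/
inductive UpwindRule
  | pointwise
  | facewise

open Classical in
/-- (Nonsingular) M-matrix: non-positive off-diagonal entries, and invertible with an entrywise
non-negative inverse. -/
def IsMMatrix {ι : Type*} [Fintype ι] (A : Matrix ι ι ℝ) : Prop :=
  (∀ i j, i ≠ j → A i j ≤ 0) ∧
    ∃ B : Matrix ι ι ℝ, A * B = 1 ∧ B * A = 1 ∧ ∀ i j, 0 ≤ B i j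

namespace Mesh

variable {d : ℕ} {Ω : Set (Eu d)} (M : Mesh d Ω)

open Classical in
/-- The set `𝓕` of all faces (`(d-1)`-dimensional sub-simplices, given by their vertices). -/
def faces : Finset (Finset (Eu d)) := M.cells.biUnion fun T => T.powersetCard d

open Classical in
/-- The faces that make up the boundary of the cell `T`. -/
def facesOf (T : M.cells) : Finset M.faces :=
  Finset.univ.filter fun F => (F : Finset (Eu d)) ⊆ (T : Finset (Eu d))

/-- The mesh size `h`, the maximum of the cell diameters. -/
def meshSize : ℝ := ⨆ T : M.cells, Metric.diam (hull (T : Finset (Eu d)))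

/-- Shape regularity and quasi-uniformity with constant `σ`: every cell contains a ball of radius
`h / σ`, where `h` is the global mesh size. -/
def IsQuasiUniform (σ : ℝ) : Prop :=
  ∀ T ∈ M.cells, ∃ c : Eu d, Metric.closedBall c (M.meshSize / σ) ⊆ hull T

/-- The `L²`-integrable function on `Ω` represented by a family of functions, one for each cell
(well defined off the faces, which are null sets). -/
def glue (v : M.cells → Eu d → Eu d) (x : Eu d) : Eu d :=
  ∑ T : M.cells, (hull (T : Finset (Eu d))).indicator (v T) x

/-- `V_h = P_k(𝓣)^d ∩ H_0(div, Ω)`. A piecewise polynomial is given by one polynomial per cell. -/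
def Vh (k : ℕ) : Set (M.cells → Eu d → Eu d) :=
  {v | (∀ T, v T ∈ vecPoly d k) ∧ M.glue v ∈ HdivZero Ω}

/-- The space of tangential facet unknowns: one function per face, polynomial of degree `≤ k` on the
face, tangential, and zero on boundary faces. A function on a face `F` is represented by its
extension by zero outside `F`. -/
def Vhat (k : ℕ) : Set (M.faces → Eu d → Eu d) :=
  {v | (∀ F, ∃ p ∈ vecPoly d k, v F = (hull (F : Finset (Eu d))).indicator p) ∧
    (∀ T, ∀ F ∈ M.facesOf T, ∀ x ∈ hull (F : Finset (Eu d)),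
      inner ℝ (v F x) (outwardNormal (T : Finset (Eu d)) F) = 0) ∧
    ∀ F : M.faces, hull (F : Finset (Eu d)) ⊆ frontier Ω → v F = 0}

/-- `Q_h = P_{k-1}(𝓣)`, for `k ≥ 1`. -/
def Qh (k : ℕ) : Set (M.cells → Eu d → ℝ) :=
  {ρ | ∀ T, ρ T ∈ polySpace d (k - 1)}

/-- The `L²(Ω)` inner product of piecewise polynomials. -/
def ip (ρ μ : M.cells → Eu d → ℝ) : ℝ :=
  ∑ T : M.cells, ∫ x in hull (T : Finset (Eu d)), ρ T x * μ T x

/-- The HDG form `a_h`, with interior penalty parameter `α`. -/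
def ah (k : ℕ) (α : ℝ) (u : M.cells → Eu d → Eu d) (uh : M.faces → Eu d → Eu d)
    (v : M.cells → Eu d → Eu d) (vh : M.faces → Eu d → Eu d) : ℝ :=
  ∑ T : M.cells,
    ((∫ x in hull (T : Finset (Eu d)), gradProd (u T) (v T) x) +
      ∑ F ∈ M.facesOf T,
        let n := outwardNormal (T : Finset (Eu d)) F
        ((∫ x in hull (F : Finset (Eu d)),
            inner ℝ (fderiv ℝ (u T) x n) (tang n (vh F x - v T x)) ∂μHE[d - 1]) +
          (∫ x in hull (F : Finset (Eu d)),
            inner ℝ (fderiv ℝ (v T) x n) (tang n (uh F x - u T x)) ∂μHE[d - 1]) +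
          α * (k : ℝ) ^ 2 / M.meshSize *
            ∫ x in hull (F : Finset (Eu d)),
              inner ℝ (tang n (uh F x - u T x)) (tang n (vh F x - v T x)) ∂μHE[d - 1]))

/-- The pressure form `-(p, div v)`. -/
def bform (p : M.cells → Eu d → ℝ) (v : M.cells → Eu d → Eu d) : ℝ :=
  -∑ T : M.cells, ∫ x in hull (T : Finset (Eu d)), p T x * divergence (v T) x

/-- The forcing `F_h(v) = (f, v)`. -/
def Fform (f : Eu d → Eu d) (v : M.cells → Eu d → Eu d) : ℝ :=
  ∑ T : M.cells, ∫ x in hull (T : Finset (Eu d)), inner ℝ (f x) (v T x)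

/-- The gravity term `G_h(ρ, v) = (g, ρ v)`. -/
def Gform (g : Eu d → Eu d) (ρ : M.cells → Eu d → ℝ) (v : M.cells → Eu d → Eu d) : ℝ :=
  ∑ T : M.cells, ∫ x in hull (T : Finset (Eu d)), inner ℝ (g x) (ρ T x • v T x)

open Classical in
/-- The value of `ρ` at `x` from the other side of the face `F` of `T`, i.e. taken from the cell
different from `T` that shares `F`. On boundary faces (where the normal velocity vanishes, so that
the value is irrelevant) it is the value from `T`. -/
def outerValue (ρ : M.cells → Eu d → ℝ) (T : M.cells) (F : M.faces) (x : Eu d) : ℝ :=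
  if h : ∃ S : M.cells, S ≠ T ∧ F ∈ M.facesOf S then ρ h.choose x else ρ T x

/-- The upwind direction indicator on the face `F` of `T`: positive for outflow from `T`. -/
def upwindSign (rule : UpwindRule) (u : M.cells → Eu d → Eu d) (T : M.cells) (F : M.faces)
    (x : Eu d) : ℝ :=
  let n := outwardNormal (T : Finset (Eu d)) F
  match rule with
  | .pointwise => inner ℝ (u T x) n
  | .facewise => ∫ y in hull (F : Finset (Eu d)), inner ℝ (u T y) n ∂μHE[d - 1]

open Classical in
/-- The upwind value of `ρ` on the face `F` of `T`: the value from the side the flow comes from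
(and the mean of both values if there is no flow). -/
def upwind (rule : UpwindRule) (ρ : M.cells → Eu d → ℝ) (u : M.cells → Eu d → Eu d)
    (T : M.cells) (F : M.faces) (x : Eu d) : ℝ :=
  if 0 < M.upwindSign rule u T F x then ρ T x
  else if M.upwindSign rule u T F x < 0 then M.outerValue ρ T F x
  else (ρ T x + M.outerValue ρ T F x) / 2

/-- The upwind transport form `c_h`. -/
def ch (rule : UpwindRule) (ρ : M.cells → Eu d → ℝ) (u : M.cells → Eu d → Eu d)
    (μ : M.cells → Eu d → ℝ) : ℝ :=
  -(∑ T : M.cells, ∫ x in hull (T : Finset (Eu d)), inner ℝ (ρ T x • u T x) (gradient (μ T) x)) +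
    ∑ T : M.cells, ∑ F ∈ M.facesOf T, ∫ x in hull (F : Finset (Eu d)),
      inner ℝ (u T x) (outwardNormal (T : Finset (Eu d)) F) * M.upwind rule ρ u T F x * μ T x
        ∂μHE[d - 1]

/-- `(u, uh)` solves the velocity update for the previous density `ρ`, with the equation of state
`p(ρ) = cM ρ`. -/
def IsVelocityUpdate (k : ℕ) (α ν cM : ℝ) (f g : Eu d → Eu d) (ρ : M.cells → Eu d → ℝ)
    (u : M.cells → Eu d → Eu d) (uh : M.faces → Eu d → Eu d) : Prop :=
  u ∈ M.Vh k ∧ uh ∈ M.Vhat k ∧ ∀ v ∈ M.Vh k, ∀ vh ∈ M.Vhat k,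
    ν * M.ah k α u uh v vh = M.Fform f v + M.Gform g ρ v - M.bform (fun T x => cM * ρ T x) v

/-- `ρ'` solves the implicit upwind density update for the velocity `u` and previous density
`ρ`. -/
def IsDensityUpdate (k : ℕ) (rule : UpwindRule) (τ : ℝ) (u : M.cells → Eu d → Eu d)
    (ρ ρ' : M.cells → Eu d → ℝ) : Prop :=
  ρ' ∈ M.Qh k ∧ ∀ μ ∈ M.Qh k, τ⁻¹ * M.ip ρ' μ + M.ch rule ρ' u μ = τ⁻¹ * M.ip ρ μ

/-- The total mass `(ρ, 1)`. -/
def mass (ρ : M.cells → Eu d → ℝ) : ℝ := M.ip ρ fun _ _ => 1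

/-- `ρ > 0` on every (closed) cell. -/
def IsPositive (ρ : M.cells → Eu d → ℝ) : Prop :=
  ∀ T : M.cells, ∀ x ∈ hull (T : Finset (Eu d)), 0 < ρ T x

open Classical in
/-- The indicator function of the cell `T`, an element of `Q_h`. -/
def chi (T : M.cells) : M.cells → Eu d → ℝ := fun S _ => if S = T then 1 else 0

/-- The system matrix of the density update for `k = 1`, in the basis of cell indicators. -/
def densityMatrix (rule : UpwindRule) (τ : ℝ) (u : M.cells → Eu d → Eu d) :
    Matrix M.cells M.cells ℝ :=
  Matrix.of fun T S => τ⁻¹ * M.ip (M.chi S) (M.chi T) + M.ch rule (M.chi S) u (M.chi T)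

end Mesh

end HDG

end

open MeasureTheory
open scoped ContDiff

noncomputable section

namespace HDG

/-! Velocity update. The discrete spaces are finite-dimensional and the problem is a square linear
system, so it is enough that `a_h(w, w) = 0` forces `w = 0`; no Poincaré or Korn inequality is
needed. The consistency terms are controlled by the trace inequality `exists_trace_le`: on a face
`F` of `T` the squared `L²` norm of `∇u n` is at most `C / h` times that of `∇u` on `T`. It comes
from norm equivalence on a finite-dimensional space of polynomials at unit scale
(`exists_sq_le_integral_sq`) and from dilation (`exists_gradProd_le`). A cell contains a ball of
radius `h / σ` and lies in the concentric ball of radius `h`, so `C` depends only on `d`, `k`, `σ`.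
Young's inequality then gives coercivity cell by cell (`cellForm_ge`).

If `a_h(w, w) = 0`, the velocity is constant on each cell and has no tangential jump against the
facet unknown. The tangential parts from both sides of a face therefore agree, and the normal parts
agree because `u ∈ H_0(div)`. Hence a constant passes to every neighbouring cell, and it is zero on
a cell with a boundary face. A nonzero constant would produce a nonempty family of cells with a
neighbour in the family across every face. This is impossible (`not_forall_exists_neighbour`): a
generic ray leaves the finite union of these cells through the relative interior of some face.

Normal traces. `H_0(div)` is given only by testing with smooth functions. Testing inside single
cells identifies the weak divergence with the piecewise one, so the integrals of `div(φ u_T)` over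
the cells sum to zero (`sum_integral_divMul`). Near a relative interior point of a face only the
cells sharing it matter, and they look like half-spaces. It remains to see that a smooth field `w`
with `∫ div(φ w) = 0` over a half-space, for all local `φ`, is tangential at the given boundary
point. Blowing up reduces this to constant `w` (`inner_eq_zero_of_halfSpace`). For constant `w` the
mass of a bump in the half-space would not change under translation along `w`, which is false unless
`w` is parallel to the boundary. No divergence theorem with surface integrals is used.

Density update. For `k = 1` densities and test functions are constant on cells, and only face fluxes
remain. Off-diagonal entries are inflow fluxes, hence non-positive. Normal continuity makes the
outflow of a cell the inflow of its neighbour, and boundary faces carry no flux, so the flux part of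
each column sums to zero and the column sums are `|T| / τ > 0`. These two sign conditions give
inverse positivity (`nonneg_of_mulVec_nonneg`), hence the M-matrix property, solvability and
positivity. The same flux cancellation gives mass conservation. Row sums have no definite sign,
since `div u` need not vanish, so the argument works with columns. -/

/-! ### Polynomial functions -/

/-- Evaluation of polynomials on `ℝ^d`, as a linear map. -/
def polyEval (d : ℕ) : MvPolynomial (Fin d) ℝ →ₗ[ℝ] (Eu d → ℝ) where
  toFun p x := MvPolynomial.eval (fun i => x i) p
  map_add' p q := by ext x; simp
  map_smul' c p := by ext x; simp [MvPolynomial.smul_eval]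

lemma polySpace_eq_map (d k : ℕ) :
    polySpace d k = (MvPolynomial.restrictTotalDegree (Fin d) ℝ k).map (polyEval d) := by
  ext f
  constructor
  · rintro ⟨p, hp, h⟩
    exact ⟨p, (MvPolynomial.mem_restrictTotalDegree _ _ _).2 hp, (funext h).symm⟩
  · rintro ⟨p, hp, rfl⟩
    exact ⟨p, (MvPolynomial.mem_restrictTotalDegree _ _ _).1 hp, fun x => rfl⟩

instance finiteDimensional_polySpace (d k : ℕ) : FiniteDimensional ℝ (polySpace d k) := by
  rw [polySpace_eq_map]
  infer_instance

lemma analyticOnNhd_of_mem_polySpace {d k : ℕ} {f : Eu d → ℝ} (hf : f ∈ polySpace d k) :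
    AnalyticOnNhd ℝ f Set.univ := by
  obtain ⟨p, -, h⟩ := hf
  rw [funext h]
  have := AnalyticOnNhd.aeval_mvPolynomial (𝕜 := ℝ) (A := ℝ) (s := Set.univ)
    (f := fun (x : Eu d) (i : Fin d) => x i)
    (fun i x _ => (EuclideanSpace.proj (𝕜 := ℝ) i).analyticAt x) p
  exact this

lemma contDiff_of_mem_polySpace {d k : ℕ} {f : Eu d → ℝ} (hf : f ∈ polySpace d k) :
    ContDiff ℝ ∞ f :=
  (analyticOnNhd_of_mem_polySpace hf).contDiff

lemma contDiff_of_mem_vecPoly {d k : ℕ} {u : Eu d → Eu d} (hu : u ∈ vecPoly d k) :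
    ContDiff ℝ ∞ u :=
  contDiff_euclidean.2 fun i => contDiff_of_mem_polySpace (hu i)

lemma continuous_of_mem_vecPoly {d k : ℕ} {u : Eu d → Eu d} (hu : u ∈ vecPoly d k) :
    Continuous u :=
  (contDiff_of_mem_vecPoly hu).continuous

lemma differentiable_of_mem_vecPoly {d k : ℕ} {u : Eu d → Eu d} (hu : u ∈ vecPoly d k) :
    Differentiable ℝ u :=
  (contDiff_of_mem_vecPoly hu).differentiable (by simp)

lemma continuous_fderiv_of_mem_vecPoly {d k : ℕ} {u : Eu d → Eu d} (hu : u ∈ vecPoly d k) :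
    Continuous (fderiv ℝ u) :=
  (contDiff_of_mem_vecPoly hu).continuous_fderiv (by simp)

/-- Vector-valued polynomials, as a submodule. -/
def vecPolySubmodule (d k : ℕ) : Submodule ℝ (Eu d → Eu d) where
  carrier := vecPoly d k
  add_mem' := fun {_ _} ha hb i => (polySpace d k).add_mem (ha i) (hb i)
  zero_mem' := fun _ => (polySpace d k).zero_mem
  smul_mem' := fun c _ ha i => (polySpace d k).smul_mem c (ha i)

instance finiteDimensional_vecPolySubmodule (d k : ℕ) :
    FiniteDimensional ℝ (vecPolySubmodule d k) := by
  let L : vecPolySubmodule d k →ₗ[ℝ] (Fin d → polySpace d k) :=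
    { toFun := fun u i => ⟨fun x => u.1 x i, u.2 i⟩
      map_add' := fun u v => by ext; simp
      map_smul' := fun c v => by ext; simp }
  refine FiniteDimensional.of_injective L fun u v h => ?_
  ext x i
  exact congrFun (congrArg Subtype.val (congrFun h i)) x

lemma const_mem_vecPoly {d k : ℕ} (c : Eu d) : (fun _ => c) ∈ vecPoly d k :=
  fun i => ⟨MvPolynomial.C (c i), by simp, by simp⟩

lemma eq_const_of_mem_polySpace_zero {d : ℕ} {f : Eu d → ℝ} (hf : f ∈ polySpace d 0) :
    ∃ c : ℝ, f = fun _ => c := by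
  obtain ⟨p, hp, h⟩ := hf
  rw [Nat.le_zero, MvPolynomial.totalDegree_eq_zero_iff_eq_C] at hp
  refine ⟨p.coeff 0, funext fun x => ?_⟩
  rw [h, hp]
  simp

lemma const_mem_polySpace {d k : ℕ} (c : ℝ) : (fun _ : Eu d => c) ∈ polySpace d k :=
  ⟨MvPolynomial.C c, by simp, by simp⟩

/-- A vector polynomial that agrees near a point with another one is equal to it. -/
lemma eq_of_eventuallyEq_of_mem_vecPoly {d k : ℕ} {u v : Eu d → Eu d} (hu : u ∈ vecPoly d k)
    (hv : v ∈ vecPoly d k) {x : Eu d} (h : u =ᶠ[nhds x] v) : u = v := by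
  funext y
  ext i
  have := (analyticOnNhd_of_mem_polySpace (hu i)).eq_of_eventuallyEq
    (analyticOnNhd_of_mem_polySpace (hv i)) (z₀ := x) (h.mono fun z hz => by simp [hz])
  exact congrFun this y

/-- `P^k` is invariant under dilations and translations. -/
lemma comp_affine_mem_polySpace {d k : ℕ} {f : Eu d → ℝ} (hf : f ∈ polySpace d k)
    (c : Eu d) (h : ℝ) : (fun y => f (c + h • y)) ∈ polySpace d k := by
  obtain ⟨p, hp, hpf⟩ := hf
  -- Substituting polynomials of degree at most one into `p` does not raise the total degree.
  let l : Fin d → MvPolynomial (Fin d) ℝ :=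
    fun i => MvPolynomial.C (c i) + MvPolynomial.C h * MvPolynomial.X i
  have hl : ∀ i, (l i).totalDegree ≤ 1 := fun i =>
    (MvPolynomial.totalDegree_add _ _).trans (max_le (by simp)
      ((MvPolynomial.totalDegree_mul _ _).trans (by simp)))
  refine ⟨MvPolynomial.aeval l p, ?_, fun y => ?_⟩
  · rw [MvPolynomial.aeval_def, MvPolynomial.eval₂_eq]
    refine MvPolynomial.totalDegree_finsetSum_le fun s hs => ?_
    refine (MvPolynomial.totalDegree_mul _ _).trans ?_
    rw [MvPolynomial.algebraMap_eq, MvPolynomial.totalDegree_C, zero_add]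
    refine (MvPolynomial.totalDegree_finsetProd _ _).trans ?_
    refine le_trans ?_ ((MvPolynomial.le_totalDegree hs).trans hp)
    rw [Finsupp.sum]
    refine Finset.sum_le_sum fun i _ => (MvPolynomial.totalDegree_pow _ _).trans ?_
    simpa using Nat.mul_le_mul_left (s i) (hl i)
  · change f (c + h • y) = _
    rw [hpf, MvPolynomial.aeval_def, MvPolynomial.eval₂_eq, MvPolynomial.eval_eq]
    simp [l]

/-! ### An inverse estimate -/

/-- On a finite-dimensional space of analytic functions, the maximum over a large ball is controlled
by the `L²` norm on a small one. -/
lemma exists_sq_le_integral_sq {d : ℕ} (P : Submodule ℝ (Eu d → ℝ)) [FiniteDimensional ℝ P]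
    (hP : ∀ f ∈ P, AnalyticOnNhd ℝ f Set.univ) (R : ℝ) {r : ℝ} (hr : 0 < r) :
    ∃ C : ℝ, 0 ≤ C ∧ ∀ f ∈ P, ∀ x ∈ Metric.closedBall (0 : Eu d) R,
      f x ^ 2 ≤ C * ∫ y in Metric.closedBall (0 : Eu d) r, f y ^ 2 := by
  have hcont : ∀ f ∈ P, Continuous f := fun f hf =>
    continuousOn_univ.1 (hP f hf).continuousOn
  set μ : Measure (Eu d) := volume.restrict (Metric.closedBall (0 : Eu d) r) with hμ
  have hmem : ∀ f ∈ P, MemLp f 2 μ := fun f hf =>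
    (memLp_two_iff_integrable_sq (hcont f hf).aestronglyMeasurable).2
      (((hcont f hf).pow 2).continuousOn.integrableOn_compact (isCompact_closedBall _ _))
  let L : P →ₗ[ℝ] Lp ℝ 2 μ :=
    { toFun := fun f => (hmem f.1 f.2).toLp
      map_add' := fun f g => MemLp.toLp_add _ _
      map_smul' := fun c f => MemLp.toLp_const_smul c (hmem f.1 f.2) }
  -- A function vanishing a.e. on the small ball vanishes on the open ball by continuity, and then
  -- everywhere by the identity theorem.
  have hL : Function.Injective L := by
    rw [injective_iff_map_eq_zero]
    intro f hf
    have h0 : (f : Eu d → ℝ) =ᵐ[μ] 0 := by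
      have := (MemLp.toLp_eq_toLp_iff (hmem f.1 f.2) (MemLp.zero (p := 2) (μ := μ) (ε := ℝ))).1
        (by rw [show (hmem f.1 f.2).toLp = L f from rfl, hf]; simp)
      simpa using this
    have h1 : (f : Eu d → ℝ) =ᵐ[volume.restrict (Metric.ball (0 : Eu d) r)] fun _ => 0 :=
      ae_restrict_of_ae_restrict_of_subset Metric.ball_subset_closedBall h0
    have h2 : Set.EqOn (f : Eu d → ℝ) (fun _ => 0) (Metric.ball (0 : Eu d) r) :=
      Measure.eqOn_open_of_ae_eq h1 Metric.isOpen_ball (hcont f.1 f.2).continuousOn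
        continuousOn_const
    have h3 := (hP f.1 f.2).eq_of_eventuallyEq (g := fun _ => (0 : ℝ)) analyticOnNhd_const
      (z₀ := 0) (Filter.eventually_of_mem (Metric.ball_mem_nhds _ hr) h2)
    exact Subtype.ext h3
  let K := Metric.closedBall (0 : Eu d) R
  let E : P →ₗ[ℝ] C(K, ℝ) :=
    { toFun := fun f => ⟨fun x => f.1 x, (hcont f.1 f.2).comp continuous_subtype_val⟩
      map_add' := fun f g => by ext; simp
      map_smul' := fun c f => by ext; simp }
  -- Restriction to the large ball is read as a linear map on the `L²` image of `P`. That image has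
  -- finite dimension, so the map is bounded, and its squared operator norm is the constant.
  let e := LinearEquiv.ofInjective L hL
  have : FiniteDimensional ℝ (LinearMap.range L) := inferInstance
  let G : LinearMap.range L →L[ℝ] C(K, ℝ) := LinearMap.toContinuousLinearMap (E ∘ₗ e.symm.toLinearMap)
  have : CompactSpace K := isCompact_iff_compactSpace.1 (isCompact_closedBall _ _)
  refine ⟨‖G‖ ^ 2, by positivity, fun f hf x hx => ?_⟩
  have h1 : ‖E ⟨f, hf⟩‖ ≤ ‖G‖ * ‖L ⟨f, hf⟩‖ := by
    have := G.le_opNorm (e ⟨f, hf⟩)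
    have h2 : G (e ⟨f, hf⟩) = E ⟨f, hf⟩ := by simp [G]
    rw [h2] at this
    exact this
  have h2 : |f x| ≤ ‖E ⟨f, hf⟩‖ := (E ⟨f, hf⟩).norm_coe_le_norm ⟨x, hx⟩
  have h3 : ‖L ⟨f, hf⟩‖ ^ 2 = ∫ y in Metric.closedBall (0 : Eu d) r, f y ^ 2 := by
    rw [← real_inner_self_eq_norm_sq, L2.inner_def]
    refine integral_congr_ae ?_
    filter_upwards [(hmem f hf).coeFn_toLp] with y hy
    have : (L ⟨f, hf⟩) y = f y := hy
    rw [this, real_inner_self_eq_norm_sq, Real.norm_eq_abs, sq_abs]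
  rw [← h3, ← mul_pow, ← sq_abs]
  exact pow_le_pow_left₀ (abs_nonneg _) (h2.trans h1) 2

lemma gradProd_self_nonneg {d : ℕ} (u : Eu d → Eu d) (x : Eu d) : 0 ≤ gradProd u u x :=
  Finset.sum_nonneg fun _ _ => real_inner_self_nonneg

/-- Reduces estimates for the Jacobian to scalar ones, for one partial derivative of one component
at a time. -/
lemma gradProd_self_eq {d : ℕ} {u : Eu d → Eu d} (hu : Differentiable ℝ u) (x : Eu d) :
    gradProd u u x = ∑ i, ∑ j, (fderiv ℝ (fun y => u y j) x (EuclideanSpace.single i 1)) ^ 2 := by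
  refine Finset.sum_congr rfl fun i _ => ?_
  rw [real_inner_self_eq_norm_sq, EuclideanSpace.norm_sq_eq]
  refine Finset.sum_congr rfl fun j _ => ?_
  have : (fun y => u y j) = (EuclideanSpace.proj (𝕜 := ℝ) j) ∘ u := rfl
  rw [this, ((EuclideanSpace.proj (𝕜 := ℝ) j).hasFDerivAt.comp x (hu x).hasFDerivAt).fderiv]
  simp

/-- Directional derivatives of polynomials of degree at most `k`. -/
def derivSpace (d k : ℕ) (e : Eu d) : Submodule ℝ (Eu d → ℝ) :=
  LinearMap.range (
    { toFun := fun f x => fderiv ℝ f.1 x e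
      map_add' := fun f g => by
        ext x
        have hf := (contDiff_of_mem_polySpace f.2).differentiable (by simp) x
        have hg := (contDiff_of_mem_polySpace g.2).differentiable (by simp) x
        simp [fderiv_add hf hg]
      map_smul' := fun c f => by
        ext x
        have hf := (contDiff_of_mem_polySpace f.2).differentiable (by simp) x
        simp [fderiv_const_smul hf c] } : polySpace d k →ₗ[ℝ] (Eu d → ℝ))

instance finiteDimensional_derivSpace (d k : ℕ) (e : Eu d) :
    FiniteDimensional ℝ (derivSpace d k e) := by
  unfold derivSpace
  infer_instance

lemma analyticOnNhd_of_mem_derivSpace {d k : ℕ} {e : Eu d} {f : Eu d → ℝ}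
    (hf : f ∈ derivSpace d k e) : AnalyticOnNhd ℝ f Set.univ := by
  obtain ⟨p, rfl⟩ := hf
  exact fun x hx => ((ContinuousLinearMap.apply ℝ ℝ e).analyticAt _).comp
    ((analyticOnNhd_of_mem_polySpace p.2).fderiv x hx)

lemma continuous_gradProd {d k : ℕ} {u v : Eu d → Eu d} (hu : u ∈ vecPoly d k)
    (hv : v ∈ vecPoly d k) : Continuous (gradProd u v) := by
  have h1 := continuous_fderiv_of_mem_vecPoly hu
  have h2 := continuous_fderiv_of_mem_vecPoly hv
  unfold gradProd
  fun_prop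

/-- Each partial derivative of each component lies in a finite-dimensional space of analytic
functions, to which `exists_sq_le_integral_sq` applies. -/
lemma exists_gradProd_le_unit (d k : ℕ) (R : ℝ) {r : ℝ} (hr : 0 < r) :
    ∃ C : ℝ, 0 ≤ C ∧ ∀ u ∈ vecPoly d k, ∀ x ∈ Metric.closedBall (0 : Eu d) R,
      gradProd u u x ≤ C * ∫ y in Metric.closedBall (0 : Eu d) r, gradProd u u y := by
  choose C hC0 hC using fun i : Fin d => exists_sq_le_integral_sq
    (derivSpace d k (EuclideanSpace.single i 1))
    (fun _ hf => analyticOnNhd_of_mem_derivSpace hf) R hr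
  -- The constant `C i` depends on the direction of differentiation only, not on the component.
  refine ⟨∑ i, C i, Finset.sum_nonneg fun i _ => hC0 i, fun u hu x hx => ?_⟩
  have hdu := differentiable_of_mem_vecPoly hu
  have hmem : ∀ i j, (fun y => fderiv ℝ (fun z => u z j) y (EuclideanSpace.single i 1)) ∈
      derivSpace d k (EuclideanSpace.single i 1) := fun i j => ⟨⟨_, hu j⟩, rfl⟩
  have h_integrable : ∀ i j, Integrable (fun y => (fderiv ℝ (fun z => u z j) y
      (EuclideanSpace.single i 1)) ^ 2) (volume.restrict (Metric.closedBall (0 : Eu d) r)) :=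
    fun i j => (((continuousOn_univ.1 (analyticOnNhd_of_mem_derivSpace
      (hmem i j)).continuousOn).pow 2).continuousOn).integrableOn_compact (isCompact_closedBall _ _)
  simp_rw [gradProd_self_eq hdu]
  rw [integral_finsetSum _ fun i _ => integrable_finsetSum _ fun j _ => h_integrable i j]
  simp_rw [integral_finsetSum _ fun j _ => h_integrable _ j]
  rw [Finset.mul_sum]
  refine Finset.sum_le_sum fun i _ => ?_
  rw [Finset.mul_sum]
  refine Finset.sum_le_sum fun j _ => (hC i _ (hmem i j) x hx).trans ?_
  exact mul_le_mul_of_nonneg_right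
    (Finset.single_le_sum (f := C) (fun i _ => hC0 i) (Finset.mem_univ i))
    (integral_nonneg fun y => sq_nonneg _)

/-- Inverse estimate for the gradient of a polynomial, with the correct scaling. -/
lemma exists_gradProd_le (d k : ℕ) {σ : ℝ} (hσ : 0 < σ) :
    ∃ C : ℝ, 0 ≤ C ∧ ∀ u ∈ vecPoly d k, ∀ (c : Eu d) (h : ℝ), 0 < h →
      ∀ x ∈ Metric.closedBall c h,
      gradProd u u x ≤ C / h ^ d * ∫ y in Metric.closedBall c (h / σ), gradProd u u y := by
  obtain ⟨C, hC0, hC⟩ := exists_gradProd_le_unit d k 1 (inv_pos.2 hσ)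
  refine ⟨C, hC0, fun u hu c h hh x hx => ?_⟩
  have hdu := differentiable_of_mem_vecPoly hu
  -- Pull-back to unit scale. The factor `h ^ 2` from the chain rule appears on both sides and
  -- cancels; the change of variables in the integral contributes `h ^ (-d)`.
  set w : Eu d → Eu d := fun y => u (c + h • y) with hw
  have hwm : w ∈ vecPoly d k := fun i => comp_affine_mem_polySpace (hu i) c h
  have hgrad : ∀ y, gradProd w w y = h ^ 2 * gradProd u u (c + h • y) := by
    intro y
    have hf : HasFDerivAt w ((fderiv ℝ u (c + h • y)).comp (h • ContinuousLinearMap.id ℝ (Eu d))) y :=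
      (hdu _).hasFDerivAt.comp y (((hasFDerivAt_id y).const_smul h).const_add c)
    unfold gradProd
    rw [hf.fderiv, Finset.mul_sum]
    refine Finset.sum_congr rfl fun i _ => ?_
    simp [norm_smul, mul_pow]
  have hx' : h⁻¹ • (x - c) ∈ Metric.closedBall (0 : Eu d) 1 := by
    rw [mem_closedBall_zero_iff, norm_smul, Real.norm_of_nonneg (by positivity), inv_mul_le_iff₀ hh,
      mul_one, ← dist_eq_norm]
    exact hx
  have key := hC w hwm _ hx'
  have hpre : (fun y : Eu d => c + h • y) ⁻¹' Metric.closedBall c (h / σ)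
      = Metric.closedBall (0 : Eu d) σ⁻¹ := by
    ext y
    simp only [Set.mem_preimage, Metric.mem_closedBall, dist_self_add_left, dist_zero_right,
      norm_smul, Real.norm_of_nonneg hh.le]
    rw [div_eq_mul_inv, mul_le_mul_iff_right₀ hh]
  have hscale : ∫ y in Metric.closedBall (0 : Eu d) σ⁻¹, gradProd u u (c + h • y)
      = (h ^ d)⁻¹ * ∫ y in Metric.closedBall c (h / σ), gradProd u u y := by
    rw [← hpre, ← integral_indicator (measurableSet_closedBall.preimage (by fun_prop)),
      ← integral_indicator measurableSet_closedBall]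
    set f : Eu d → ℝ := (Metric.closedBall c (h / σ)).indicator fun y => gradProd u u y
    have h1 : ∀ y, ((fun y : Eu d => c + h • y) ⁻¹' Metric.closedBall c (h / σ)).indicator
        (fun y => gradProd u u (c + h • y)) y = (fun z => f (c + z)) (h • y) := fun y => rfl
    simp_rw [h1]
    rw [Measure.integral_comp_smul volume (fun z => f (c + z)) h, integral_add_left_eq_self]
    simp [abs_of_pos (pow_pos hh d)]
  simp_rw [hgrad] at key
  rw [integral_const_mul, hscale, smul_inv_smul₀ hh.ne', add_sub_cancel] at key
  have h2 : 0 < h ^ 2 := by positivity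
  refine le_of_mul_le_mul_left (key.trans_eq ?_) h2
  field_simp

/-! ### Geometry of a single simplex -/

/-- `T` is the vertex set of a non-degenerate `d`-simplex. -/
structure IsCell {d : ℕ} (T : Finset (Eu d)) : Prop where
  card_eq : T.card = d + 1
  indep : AffineIndependent ℝ ((↑) : T → Eu d)

lemma Mesh.isCell {d : ℕ} {Ω : Set (Eu d)} (M : Mesh d Ω) (T : M.cells) :
    IsCell (T : Finset (Eu d)) :=
  ⟨M.card_cell T T.2, M.indep T T.2⟩

namespace IsCell

variable {d : ℕ} {T : Finset (Eu d)} (h : IsCell T)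

include h in
lemma affineSpan_eq_top : affineSpan ℝ (Set.range ((↑) : T → Eu d)) = ⊤ := by
  rw [h.indep.affineSpan_eq_top_iff_card_eq_finrank_add_one]
  simp [h.card_eq]

/-- The vertices of a non-degenerate simplex form an affine basis. -/
def basis : AffineBasis T ℝ (Eu d) := ⟨(↑), h.indep, h.affineSpan_eq_top⟩

open Classical in
/-- The barycentric coordinate of the simplex `T` that belongs to its vertex `v`. -/
def bc (v : Eu d) : Eu d →ᵃ[ℝ] ℝ := if hv : v ∈ T then h.basis.coord ⟨v, hv⟩ else 0

lemma bc_of_mem {v : Eu d} (hv : v ∈ T) : h.bc v = h.basis.coord ⟨v, hv⟩ := dif_pos hv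

lemma bc_coe (v : T) : h.bc v = h.basis.coord v := h.bc_of_mem v.2

lemma continuous_bc (v : Eu d) : Continuous (h.bc v) := (h.bc v).continuous_of_finiteDimensional

lemma bc_self {v : Eu d} (hv : v ∈ T) : h.bc v v = 1 := by
  rw [h.bc_of_mem hv]
  exact h.basis.coord_apply_eq ⟨v, hv⟩

lemma bc_ne {v w : Eu d} (hw : w ∈ T) (hne : v ≠ w) : h.bc v w = 0 := by
  by_cases hv : v ∈ T
  · rw [h.bc_of_mem hv]
    exact h.basis.coord_apply_ne (i := ⟨v, hv⟩) (j := ⟨w, hw⟩) (by simpa using hne)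
  · simp [bc, hv]

lemma sum_bc (x : Eu d) : ∑ v ∈ T, h.bc v x = 1 := by
  rw [← h.basis.sum_coord_apply_eq_one x, ← Finset.sum_coe_sort]
  simp_rw [h.bc_coe]

lemma sum_bc_smul (x : Eu d) : ∑ v ∈ T, h.bc v x • v = x := by
  conv_rhs => rw [← h.basis.linear_combination_coord_eq_self x]
  rw [← Finset.sum_coe_sort]
  simp_rw [h.bc_coe]
  rfl

end IsCell

lemma affineMap_sum_smul {d : ℕ} (f : Eu d →ᵃ[ℝ] ℝ) (F : Finset (Eu d)) (w : Eu d → ℝ)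
    (hw : ∑ u ∈ F, w u = 1) : f (∑ u ∈ F, w u • u) = ∑ u ∈ F, w u * f u := by
  have key : ∀ x, f x = f.linear x + f 0 := fun x => congrFun f.decomp x
  have h1 : ∑ u ∈ F, w u * f u = ∑ u ∈ F, (w u * f.linear u + w u * f 0) :=
    Finset.sum_congr rfl fun u _ => by rw [key u, mul_add]
  rw [key, map_sum, h1, Finset.sum_add_distrib, ← Finset.sum_mul, hw, one_mul]
  simp_rw [map_smul, smul_eq_mul]

lemma affineMap_add_sub {d : ℕ} (f : Eu d →ᵃ[ℝ] ℝ) (x y : Eu d) :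
    f x = f.linear (x - y) + f y := by
  have := f.map_vadd y (x - y)
  simpa using this

/-! ### Hulls, relative interiors and barycentric coordinates -/

/-- The relative interior of the simplex with vertices `F`. -/
def relInt {d : ℕ} (F : Finset (Eu d)) : Set (Eu d) :=
  {x | ∃ w : Eu d → ℝ, (∀ u ∈ F, 0 < w u) ∧ ∑ u ∈ F, w u = 1 ∧ ∑ u ∈ F, w u • u = x}

lemma relInt_subset_hull {d : ℕ} (F : Finset (Eu d)) : relInt F ⊆ hull F := by
  rintro x ⟨w, hw, h1, h2⟩
  exact Finset.mem_convexHull'.2 ⟨w, fun u hu => (hw u hu).le, h1, h2⟩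

lemma isCompact_hull {d : ℕ} (F : Finset (Eu d)) : IsCompact (hull F) :=
  F.finite_toSet.isCompact_convexHull ℝ

lemma isClosed_hull {d : ℕ} (F : Finset (Eu d)) : IsClosed (hull F) := (isCompact_hull F).isClosed

lemma convex_hull {d : ℕ} (F : Finset (Eu d)) : Convex ℝ (hull F) := convex_convexHull ℝ _

lemma hull_mono {d : ℕ} {F T : Finset (Eu d)} (hF : F ⊆ T) : hull F ⊆ hull T :=
  convexHull_mono (by exact_mod_cast hF)

/-- Moving a point slightly towards the barycentre makes all its weights positive. -/
lemma hull_subset_closure_relInt {d : ℕ} {F : Finset (Eu d)} (hF : F.Nonempty) :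
    hull F ⊆ closure (relInt F) := by
  intro x hx
  obtain ⟨w, hw, h1, h2⟩ := Finset.mem_convexHull'.1 hx
  have hc : (0 : ℝ) < F.card := by exact_mod_cast hF.card_pos
  let g : ℝ → Eu d := fun t => (1 - t) • x + t • barycentre F
  have hg : Continuous g := by fun_prop
  have hlim : Filter.Tendsto g (nhdsWithin 0 (Set.Ioo 0 1)) (nhds x) := by
    have := (hg.tendsto 0).mono_left (nhdsWithin_le_nhds (s := Set.Ioo (0 : ℝ) 1))
    simpa [g] using this
  have : (nhdsWithin (0 : ℝ) (Set.Ioo 0 1)).NeBot := by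
    rw [nhdsWithin_Ioo_eq_nhdsGT one_pos]; infer_instance
  refine mem_closure_of_tendsto hlim (eventually_nhdsWithin_of_forall fun t ht => ?_)
  refine ⟨fun u => (1 - t) * w u + t * (F.card : ℝ)⁻¹, fun u hu => ?_, ?_, ?_⟩
  · have := mul_nonneg (sub_nonneg.2 ht.2.le) (hw u hu)
    have := mul_pos ht.1 (inv_pos.2 hc)
    linarith
  · rw [Finset.sum_add_distrib, ← Finset.mul_sum, h1, Finset.sum_const, nsmul_eq_mul]
    field_simp
    ring
  · simp only [g, barycentre, add_smul, mul_smul, Finset.sum_add_distrib, ← Finset.smul_sum, h2]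
    simp only [Finset.smul_sum]

lemma relInt_nonempty {d : ℕ} {F : Finset (Eu d)} (hF : F.Nonempty) : (relInt F).Nonempty := by
  obtain ⟨v, hv⟩ := hF
  exact closure_nonempty_iff.1
    ⟨v, hull_subset_closure_relInt ⟨v, hv⟩ (subset_convexHull ℝ _ (by exact_mod_cast hv))⟩

/-- The frontier of a convex set is a null set. -/
lemma hull_ae_eq_interior {d : ℕ} (T : Finset (Eu d)) :
    hull T =ᵐ[volume] interior (hull T) := by
  have : volume (frontier (hull T)) = 0 := (convex_hull T).addHaar_frontier volume
  exact (interior_ae_eq_of_null_frontier this).symm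

namespace IsCell

variable {d : ℕ} {T : Finset (Eu d)} (h : IsCell T)

/-- Barycentric coordinates of a combination of some of the vertices. -/
lemma bc_sum_smul {F : Finset (Eu d)} (hF : F ⊆ T) {w : Eu d → ℝ} (hw : ∑ u ∈ F, w u = 1)
    (v : Eu d) [Decidable (v ∈ F)] : h.bc v (∑ u ∈ F, w u • u) = if v ∈ F then w v else 0 := by
  rw [affineMap_sum_smul _ _ _ hw]
  split_ifs with hv
  · rw [Finset.sum_eq_single_of_mem v hv, h.bc_self (hF hv), mul_one]
    intro u hu hne
    rw [h.bc_ne (hF hu) hne.symm, mul_zero]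
  · refine Finset.sum_eq_zero fun u hu => ?_
    rw [h.bc_ne (hF hu) (by rintro rfl; exact hv hu), mul_zero]

/-- Barycentric coordinates with respect to `T` are unique, so a convex combination of the vertices
in `F` has zero coordinate at every other vertex. -/
lemma mem_hull_subset_iff {F : Finset (Eu d)} (hF : F ⊆ T) {x : Eu d} :
    x ∈ hull F ↔ (∀ v ∈ F, 0 ≤ h.bc v x) ∧ ∀ v ∈ T, v ∉ F → h.bc v x = 0 := by
  classical
  constructor
  · intro hx
    obtain ⟨w, hw, h1, rfl⟩ := Finset.mem_convexHull'.1 hx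
    refine ⟨fun v hv => ?_, fun v _ hv => ?_⟩
    · rw [h.bc_sum_smul hF h1, if_pos hv]; exact hw v hv
    · rw [h.bc_sum_smul hF h1, if_neg hv]
  · rintro ⟨h1, h2⟩
    refine Finset.mem_convexHull'.2 ⟨fun v => h.bc v x, h1, ?_, ?_⟩
    · rw [← h.sum_bc x]
      exact Finset.sum_subset hF h2
    · conv_rhs => rw [← h.sum_bc_smul x]
      exact Finset.sum_subset hF fun v hv hv' => by simp [h2 v hv hv']

lemma mem_relInt_iff {F : Finset (Eu d)} (hF : F ⊆ T) {x : Eu d} :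
    x ∈ relInt F ↔ (∀ v ∈ F, 0 < h.bc v x) ∧ ∀ v ∈ T, v ∉ F → h.bc v x = 0 := by
  classical
  constructor
  · rintro ⟨w, hw, h1, rfl⟩
    refine ⟨fun v hv => ?_, fun v _ hv => ?_⟩
    · rw [h.bc_sum_smul hF h1, if_pos hv]; exact hw v hv
    · rw [h.bc_sum_smul hF h1, if_neg hv]
  · rintro ⟨h1, h2⟩
    refine ⟨fun v => h.bc v x, h1, ?_, ?_⟩
    · rw [← h.sum_bc x]
      exact Finset.sum_subset hF h2
    · conv_rhs => rw [← h.sum_bc_smul x]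
      exact Finset.sum_subset hF fun v hv hv' => by simp [h2 v hv hv']

lemma mem_hull_iff {x : Eu d} : x ∈ hull T ↔ ∀ v ∈ T, 0 ≤ h.bc v x := by
  rw [h.mem_hull_subset_iff subset_rfl]
  exact ⟨fun hx => hx.1, fun hx => ⟨hx, fun v hv hv' => absurd hv hv'⟩⟩

lemma mem_interior_iff {x : Eu d} : x ∈ interior (hull T) ↔ ∀ v ∈ T, 0 < h.bc v x := by
  have h1 := h.basis.interior_convexHull
  have h2 : Set.range h.basis = (T : Set (Eu d)) := Subtype.range_coe
  rw [h2] at h1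
  rw [hull, h1]
  simp only [Set.mem_ofPred_eq, Subtype.forall]
  exact forall₂_congr fun v hv => by rw [h.bc_of_mem hv]

include h in
lemma interior_nonempty : (interior (hull T)).Nonempty := by
  obtain ⟨x, hx⟩ := relInt_nonempty (F := T) (Finset.card_pos.1 (by rw [h.card_eq]; omega))
  exact ⟨x, h.mem_interior_iff.2 ((h.mem_relInt_iff subset_rfl).1 hx).1⟩

include h in
lemma hull_subset_closure_interior : hull T ⊆ closure (interior (hull T)) := by
  rw [(convex_hull T).closure_interior_eq_closure_of_nonempty_interior h.interior_nonempty]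
  exact subset_closure

include h in
/-- The interior of a simplex does not meet the simplices spanned by fewer vertices. -/
lemma notMem_hull_of_mem_interior {F : Finset (Eu d)} (hF : F ⊆ T) (hne : F ≠ T) {x : Eu d}
    (hx : x ∈ interior (hull T)) : x ∉ hull F := by
  intro hx'
  obtain ⟨v, hv, hv'⟩ := Finset.exists_of_ssubset (hF.ssubset_of_ne hne)
  exact (h.mem_interior_iff.1 hx v hv).ne' (((h.mem_hull_subset_iff hF).1 hx').2 v hv hv')

end IsCell

/-! ### Faces of a simplex and their outward normals -/

/-- `F` is the face of the simplex `T` opposite to its vertex `v`. -/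
structure IsFace {d : ℕ} (T F : Finset (Eu d)) (v : Eu d) : Prop where
  subset : F ⊆ T
  mem : v ∈ T
  notMem : v ∉ F
  eq_or_mem : ∀ u ∈ T, u = v ∨ u ∈ F

lemma IsCell.exists_isFace {d : ℕ} {T F : Finset (Eu d)} (h : IsCell T) (hF : F ⊆ T)
    (hc : F.card = d) : ∃ v, IsFace T F v := by
  classical
  have h1 : (T \ F).card = 1 := by
    rw [Finset.card_sdiff_of_subset hF, h.card_eq, hc]; omega
  obtain ⟨v, hv⟩ := Finset.card_eq_one.1 h1
  have h2 : ∀ u, u ∈ T ∧ u ∉ F ↔ u = v := fun u => by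
    rw [← Finset.mem_sdiff, hv, Finset.mem_singleton]
  exact ⟨v, hF, ((h2 v).2 rfl).1, ((h2 v).2 rfl).2, fun u hu =>
    or_iff_not_imp_right.2 fun hu' => (h2 u).1 ⟨hu, hu'⟩⟩

namespace IsFace

variable {d : ℕ} {T F : Finset (Eu d)} {v : Eu d} (h : IsCell T) (hF : IsFace T F v)

include hF in
lemma mem_relInt_iff {x : Eu d} :
    x ∈ relInt F ↔ (∀ u ∈ F, 0 < h.bc u x) ∧ h.bc v x = 0 := by
  rw [h.mem_relInt_iff hF.subset]
  refine and_congr_right fun _ => ⟨fun hx => hx v hF.mem hF.notMem, fun hx u hu hu' => ?_⟩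
  rcases hF.eq_or_mem u hu with rfl | h'
  · exact hx
  · exact absurd h' hu'

include hF in
-- The coordinate of the opposite vertex vanishes on all of `F`. Together with the converse below,
-- the direction of a face is the kernel of a linear functional, which ties normals to barycentric
-- coordinates.
lemma linear_bc_of_mem_vectorSpan {y : Eu d} (hy : y ∈ vectorSpan ℝ (F : Set (Eu d))) :
    (h.bc v).linear y = 0 := by
  have : vectorSpan ℝ (F : Set (Eu d)) ≤ LinearMap.ker (h.bc v).linear := by
    rw [vectorSpan_def, Submodule.span_le]
    rintro _ ⟨a, ha, b, hb, rfl⟩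
    have e : ∀ c ∈ F, h.bc v c = 0 := fun c hc =>
      h.bc_ne (hF.subset hc) (by rintro rfl; exact hF.notMem hc)
    have := affineMap_add_sub (h.bc v) a b
    rw [e a (by exact_mod_cast ha), e b (by exact_mod_cast hb)] at this
    simpa using this.symm
  exact this hy

include hF in
lemma mem_vectorSpan_of_linear_bc {y : Eu d} (hFn : F.Nonempty)
    (hy : (h.bc v).linear y = 0) : y ∈ vectorSpan ℝ (F : Set (Eu d)) := by
  obtain ⟨p, hp⟩ := hFn
  have hv0 : h.bc v (p + y) = 0 := by
    rw [affineMap_add_sub (h.bc v) (p + y) p, add_sub_cancel_left, hy,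
      h.bc_ne (hF.subset hp) (by rintro rfl; exact hF.notMem hp), zero_add]
  have hz : ∀ u ∈ T, u ∉ F → h.bc u (p + y) = 0 := fun u hu hu' => by
    rcases hF.eq_or_mem u hu with rfl | h'
    · exact hv0
    · exact absurd h' hu'
  have h1 : ∑ u ∈ F, h.bc u (p + y) = 1 := by
    rw [← h.sum_bc (p + y)]
    exact Finset.sum_subset hF.subset hz
  have h2 : ∑ u ∈ F, h.bc u (p + y) • u = p + y := by
    conv_rhs => rw [← h.sum_bc_smul (p + y)]
    exact Finset.sum_subset hF.subset fun u hu hu' => by rw [hz u hu hu', zero_smul]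
  have h3 : y = ∑ u ∈ F, h.bc u (p + y) • (u - p) := by
    simp_rw [smul_sub, Finset.sum_sub_distrib, ← Finset.sum_smul, h1, h2, one_smul]
    simp
  rw [h3]
  exact Submodule.sum_mem _ fun u hu => Submodule.smul_mem _ _
    (vsub_mem_vectorSpan ℝ (by exact_mod_cast hu) (by exact_mod_cast hp))

variable (F) in
lemma bary_sum (hFn : F.Nonempty) : ∑ _u ∈ F, (F.card : ℝ)⁻¹ = 1 := by
  have : (F.card : ℝ) ≠ 0 := by exact_mod_cast hFn.card_pos.ne'
  simp [this]

include hF in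
/-- The functional properties that determine the outward normal. -/
lemma outwardNormal_spec (hFn : F.Nonempty) :
    outwardNormal T F ∈ (vectorSpan ℝ (F : Set (Eu d)))ᗮ ∧ ‖outwardNormal T F‖ = 1 ∧
      (h.bc v).linear (outwardNormal T F) < 0 := by
  classical
  set V := vectorSpan ℝ (F : Set (Eu d))
  set y := barycentre F - barycentre T with hy
  set w := Vᗮ.starProjection y with hw
  have hn : outwardNormal T F = ‖w‖⁻¹ • w := rfl
  have hTn : T.Nonempty := ⟨v, hF.mem⟩
  have hwV : w ∈ Vᗮ := Submodule.starProjection_apply_mem _ _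
  have hyw : y - w ∈ V := by
    have := Submodule.sub_starProjection_mem_orthogonal (K := Vᗮ) y
    rwa [Submodule.orthogonal_orthogonal] at this
  -- The coordinate of `v` drops from `1 / card T` at the barycentre of `T` to zero on `F`.
  -- Projecting `y` changes it only by a vector in the direction of `F`, which this functional does
  -- not see, so `w` has the same value and is nonzero.
  have hly : (h.bc v).linear y = -(T.card : ℝ)⁻¹ := by
    have h1 := affineMap_add_sub (h.bc v) (barycentre F) (barycentre T)
    have h2 : h.bc v (barycentre F) = 0 := by
      rw [barycentre, Finset.smul_sum, h.bc_sum_smul hF.subset (w := fun _ => (F.card : ℝ)⁻¹)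
        (bary_sum F hFn), if_neg hF.notMem]
    have h3 : h.bc v (barycentre T) = (T.card : ℝ)⁻¹ := by
      rw [barycentre, Finset.smul_sum, h.bc_sum_smul subset_rfl (w := fun _ => (T.card : ℝ)⁻¹)
        (bary_sum T hTn), if_pos hF.mem]
    rw [h2, h3] at h1
    linarith
  have hlw : (h.bc v).linear w = -(T.card : ℝ)⁻¹ := by
    have := hF.linear_bc_of_mem_vectorSpan h hyw
    rw [map_sub, hly] at this
    linarith
  have hTpos : (0 : ℝ) < (T.card : ℝ)⁻¹ := inv_pos.2 (by exact_mod_cast hTn.card_pos)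
  have hw0 : w ≠ 0 := by
    rintro h0
    rw [h0, map_zero] at hlw
    linarith
  have hwn : 0 < ‖w‖ := norm_pos_iff.2 hw0
  refine ⟨hn ▸ Vᗮ.smul_mem _ hwV, ?_, ?_⟩
  · rw [hn, norm_smul, norm_inv, norm_norm, inv_mul_cancel₀ hwn.ne']
  · rw [hn, map_smul, hlw, smul_eq_mul]
    exact mul_neg_of_pos_of_neg (inv_pos.2 hwn) (by linarith)

include hF in
/-- The normal component is proportional to the derivative of the barycentric coordinate. -/
lemma linear_bc_eq (hFn : F.Nonempty) (y : Eu d) :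
    (h.bc v).linear y = (h.bc v).linear (outwardNormal T F) * inner ℝ y (outwardNormal T F) := by
  obtain ⟨h1, h2, h3⟩ := hF.outwardNormal_spec h hFn
  set n := outwardNormal T F
  set a := (h.bc v).linear n with ha
  have h4 : y - (a⁻¹ * (h.bc v).linear y) • n ∈ vectorSpan ℝ (F : Set (Eu d)) := by
    refine hF.mem_vectorSpan_of_linear_bc h hFn ?_
    rw [map_sub, map_smul, ← ha, smul_eq_mul]
    field_simp [h3.ne]
    ring
  have h5 := Submodule.inner_right_of_mem_orthogonal h4 h1
  rw [inner_sub_left, inner_smul_left, real_inner_self_eq_norm_sq, h2] at h5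
  have h6 : inner ℝ y n = a⁻¹ * (h.bc v).linear y := by
    simpa [sub_eq_zero] using h5
  rw [h6, mul_inv_cancel_left₀ h3.ne]

include h hF in
/-- Near a relative interior point of a face, a simplex is a half-space. -/
lemma eventually_mem_hull_iff (hFn : F.Nonempty) {x₀ : Eu d} (hx₀ : x₀ ∈ relInt F) :
    ∀ᶠ x in nhds x₀, (x ∈ hull T ↔ inner ℝ (x - x₀) (outwardNormal T F) ≤ 0) ∧
      (x ∈ interior (hull T) ↔ inner ℝ (x - x₀) (outwardNormal T F) < 0) := by
  obtain ⟨h1, h2⟩ := (hF.mem_relInt_iff h).1 hx₀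
  -- The coordinates of the vertices in `F` stay positive near `x₀`, so only the sign of the
  -- coordinate of `v` decides. By `linear_bc_eq` it is a negative multiple of the normal component
  -- of `x - x₀`.
  have h3 : ∀ᶠ x in nhds x₀, ∀ u ∈ F, 0 < h.bc u x := by
    rw [Filter.eventually_all_finset]
    exact fun u hu => (h.continuous_bc u).continuousAt.eventually_const_lt (h1 u hu)
  have ha := (hF.outwardNormal_spec h hFn).2.2
  filter_upwards [h3] with x hx
  have hv : h.bc v x = (h.bc v).linear (outwardNormal T F) *
      inner ℝ (x - x₀) (outwardNormal T F) := by
    rw [← hF.linear_bc_eq h hFn, affineMap_add_sub (h.bc v) x x₀, h2, add_zero]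
  constructor
  · have : x ∈ hull T ↔ 0 ≤ h.bc v x := by
      rw [h.mem_hull_iff]
      refine ⟨fun H => H v hF.mem, fun H u hu => ?_⟩
      rcases hF.eq_or_mem u hu with rfl | h'
      · exact H
      · exact (hx u h').le
    rw [this, hv]
    constructor
    · intro H; by_contra! H'; nlinarith
    · intro H; nlinarith
  · have : x ∈ interior (hull T) ↔ 0 < h.bc v x := by
      rw [h.mem_interior_iff]
      refine ⟨fun H => H v hF.mem, fun H u hu => ?_⟩
      rcases hF.eq_or_mem u hu with rfl | h'
      · exact H
      · exact hx u h'
    rw [this, hv]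
    constructor
    · intro H; by_contra! H'; nlinarith
    · intro H; nlinarith

end IsFace

/-- A unit vector orthogonal to a face of a simplex is its outward normal, up to the sign. -/
lemma IsFace.eq_or_eq_neg_outwardNormal {d : ℕ} {T F : Finset (Eu d)} {v : Eu d} (h : IsCell T)
    (hF : IsFace T F v) (hFn : F.Nonempty) {m : Eu d} (hm : m ∈ (vectorSpan ℝ (F : Set (Eu d)))ᗮ)
    (hm1 : ‖m‖ = 1) : m = outwardNormal T F ∨ m = -outwardNormal T F := by
  obtain ⟨h1, h2, h3⟩ := hF.outwardNormal_spec h hFn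
  set n := outwardNormal T F
  set a := inner ℝ m n with ha
  have h4 : (h.bc v).linear (m - a • n) = 0 := by
    rw [hF.linear_bc_eq h hFn, inner_sub_left, inner_smul_left, real_inner_self_eq_norm_sq, h2]
    simp [ha, n]
  have h5 := hF.mem_vectorSpan_of_linear_bc h hFn h4
  -- The difference lies both in the direction of the face and in its orthogonal complement, hence
  -- it is zero.
  have h6 : m - a • n ∈ (vectorSpan ℝ (F : Set (Eu d)))ᗮ :=
    Submodule.sub_mem _ hm (Submodule.smul_mem _ _ h1)
  have h7 : m - a • n = 0 := inner_self_eq_zero.1 (Submodule.inner_right_of_mem_orthogonal h5 h6)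
  have h8 : m = a • n := sub_eq_zero.1 h7
  have h9 : |a| = 1 := by
    rw [h8, norm_smul, h2, mul_one] at hm1
    exact hm1
  rcases eq_or_eq_neg_of_abs_eq h9 with h' | h'
  · left; rw [h8, h', one_smul]
  · right; rw [h8, h', neg_one_smul]

/-! ### The surface measure of a face -/

section FaceMeasure

variable {d : ℕ} {T F : Finset (Eu d)}

lemma IsCell.finrank_vectorSpan_face (h : IsCell T) (hF : F ⊆ T) (hc : F.card = d) (hd : 1 ≤ d) :
    Module.finrank ℝ (vectorSpan ℝ (F : Set (Eu d))) = d - 1 := by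
  have h1 : AffineIndependent ℝ ((↑) : F → Eu d) :=
    AffineIndependent.mono (k := ℝ) (t := (T : Set (Eu d))) (s := (F : Set (Eu d))) h.indep
      (by exact_mod_cast hF)
  have h2 := h1.finrank_vectorSpan (n := d - 1) (by simp [hc]; omega)
  have h3 : Set.range ((↑) : F → Eu d) = (F : Set (Eu d)) := Subtype.range_coe
  rwa [h3] at h2

/-- The isometric parametrization of the hyperplane of a face. -/
def faceParam (F : Finset (Eu d)) (p : Eu d) (y : vectorSpan ℝ (F : Set (Eu d))) : Eu d := p + y

lemma isometry_faceParam (F : Finset (Eu d)) (p : Eu d) : Isometry (faceParam F p) :=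
  (isometry_vadd (Eu d) p).comp isometry_subtype_coe

lemma hull_subset_range_faceParam {p : Eu d} (hp : p ∈ F) :
    hull F ⊆ Set.range (faceParam F p) := by
  have h1 : hull F ⊆ affineSpan ℝ (F : Set (Eu d)) := convexHull_subset_affineSpan _
  intro x hx
  have hpF : p ∈ affineSpan ℝ (F : Set (Eu d)) := subset_affineSpan ℝ _ (by exact_mod_cast hp)
  have := AffineSubspace.vsub_mem_direction (h1 hx) hpF
  rw [direction_affineSpan] at this
  exact ⟨⟨x - p, this⟩, by simp [faceParam]⟩

lemma IsCell.volume_eq_euclideanHausdorffMeasure (h : IsCell T) (hF : F ⊆ T) (hc : F.card = d)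
    (hd : 1 ≤ d) : (μHE[d - 1] : Measure (vectorSpan ℝ (F : Set (Eu d)))) = volume := by
  rw [← h.finrank_vectorSpan_face hF hc hd]
  exact InnerProductSpace.euclideanHausdorffMeasure_eq_volume

/-- Isometries preserve the normalized Hausdorff measure, and on a Euclidean space of dimension `d -
1` it is Lebesgue measure. Statements about surface integrals thus become statements about Lebesgue
measure in the hyperplane of the face. -/
lemma IsCell.map_faceParam (h : IsCell T) (hF : F ⊆ T) (hc : F.card = d) (hd : 1 ≤ d)
    {p : Eu d} (hp : p ∈ F) :
    (μHE[d - 1] : Measure (Eu d)).restrict (hull F) =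
      (volume.restrict (faceParam F p ⁻¹' hull F)).map (faceParam F p) := by
  have hm : Measurable (faceParam F p) := (isometry_faceParam F p).continuous.measurable
  rw [← h.volume_eq_euclideanHausdorffMeasure hF hc hd,
    ← Measure.restrict_map hm (isClosed_hull F).measurableSet,
    (isometry_faceParam F p).map_euclideanHausdorffMeasure,
    Measure.restrict_restrict (isClosed_hull F).measurableSet,
    Set.inter_eq_left.2 (hull_subset_range_faceParam hp)]

/-- The volume of the unit ball of dimension `n`. -/
def unitBallVolume (n : ℕ) : ℝ := √Real.pi ^ n / Real.Gamma (n / 2 + 1)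

lemma unitBallVolume_nonneg (n : ℕ) : 0 ≤ unitBallVolume n :=
  div_nonneg (by positivity) (Real.Gamma_nonneg_of_nonneg (by positivity))

/-- Seen from one of its vertices, the face lies in a `(d - 1)`-dimensional ball whose radius is the
diameter of the cell. -/
lemma IsCell.measure_face_le (h : IsCell T) (hF : F ⊆ T) (hc : F.card = d) (hd : 2 ≤ d)
    {r : ℝ} (hr : 0 ≤ r) (hdiam : Metric.diam (hull T) ≤ r) :
    (μHE[d - 1] : Measure (Eu d)) (hull F) ≤
      ENNReal.ofReal (r ^ (d - 1) * unitBallVolume (d - 1)) := by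
  obtain ⟨p, hp⟩ : F.Nonempty := Finset.card_pos.1 (by omega)
  have hrk := h.finrank_vectorSpan_face hF hc (by omega)
  have : Nontrivial (vectorSpan ℝ (F : Set (Eu d))) :=
    Module.nontrivial_of_finrank_pos (R := ℝ) (by rw [hrk]; omega)
  have hm : Measurable (faceParam F p) := (isometry_faceParam F p).continuous.measurable
  have h1 : (μHE[d - 1] : Measure (Eu d)) (hull F) = volume (faceParam F p ⁻¹' hull F) := by
    rw [← Measure.restrict_apply_univ (s := hull F), h.map_faceParam hF hc (by omega) hp,
      Measure.map_apply hm MeasurableSet.univ]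
    simp
  have h2 : faceParam F p ⁻¹' hull F ⊆ Metric.closedBall 0 r := by
    intro y hy
    rw [mem_closedBall_zero_iff]
    have hd : dist (faceParam F p y) p ≤ Metric.diam (hull T) :=
      Metric.dist_le_diam_of_mem (isCompact_hull T).isBounded (hull_mono hF hy)
        (subset_convexHull ℝ _ (by exact_mod_cast hF hp))
    have : dist (faceParam F p y) p = ‖y‖ := by
      rw [faceParam, dist_eq_norm, add_sub_cancel_left]; rfl
    linarith
  rw [h1]
  refine (measure_mono h2).trans_eq ?_
  rw [InnerProductSpace.volume_closedBall, hrk, ← ENNReal.ofReal_pow hr,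
    ← ENNReal.ofReal_mul (by positivity), unitBallVolume]

lemma IsCell.measure_face_lt_top (h : IsCell T) (hF : F ⊆ T) (hc : F.card = d) (hd : 2 ≤ d) :
    (μHE[d - 1] : Measure (Eu d)) (hull F) < ⊤ :=
  (h.measure_face_le hF hc hd Metric.diam_nonneg le_rfl).trans_lt ENNReal.ofReal_lt_top

/-- Continuous functions are integrable over faces. -/
lemma IsCell.integrableOn_face {E : Type*} [NormedAddCommGroup E] [SecondCountableTopology E]
    (h : IsCell T) (hF : F ⊆ T) (hc : F.card = d) (hd : 2 ≤ d) {f : Eu d → E}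
    (hf : ContinuousOn f (hull F)) :
    IntegrableOn f (hull F) (μHE[d - 1] : Measure (Eu d)) := by
  borelize E
  obtain ⟨C, hC⟩ := (isCompact_hull F).exists_bound_of_continuousOn hf
  refine IntegrableOn.of_bound (h.measure_face_lt_top hF hc hd)
    (hf.aestronglyMeasurable (isClosed_hull F).measurableSet) C ?_
  exact (ae_restrict_iff' (isClosed_hull F).measurableSet).2 (Filter.Eventually.of_forall hC)

/-- The surface measure charges every relatively open part of a face. -/
lemma IsCell.eq_zero_of_integral_face_eq_zero (h : IsCell T) (hF : F ⊆ T) (hc : F.card = d)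
    (hd : 2 ≤ d) {f : Eu d → ℝ} (hf : ContinuousOn f (hull F)) (h0 : ∀ x ∈ hull F, 0 ≤ f x)
    (h_integrable : ∫ x in hull F, f x ∂μHE[d - 1] = 0) : ∀ x ∈ hull F, f x = 0 := by
  have hFn : F.Nonempty := Finset.card_pos.1 (by omega)
  obtain ⟨p, hp⟩ := hFn
  obtain ⟨v, hv⟩ := h.exists_isFace hF hc
  have hm : Measurable (faceParam F p) := (isometry_faceParam F p).continuous.measurable
  have hcont := (isometry_faceParam F p).continuous
  have hms := (isClosed_hull F).measurableSet
  have h1 : f =ᵐ[(μHE[d - 1] : Measure (Eu d)).restrict (hull F)] 0 :=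
    (setIntegral_eq_zero_iff_of_nonneg_ae ((ae_restrict_iff' hms).2
      (Filter.Eventually.of_forall h0)) (h.integrableOn_face hF hc hd hf)).1 h_integrable
  rw [h.map_faceParam hF hc (by omega) hp] at h1
  have h2 := ae_of_ae_map hm.aemeasurable h1
  set U : Set (vectorSpan ℝ (F : Set (Eu d))) := faceParam F p ⁻¹' relInt F with hU
  -- Inside the hyperplane of `F` the opposite coordinate is identically zero, so the relative
  -- interior is cut out by strict inequalities alone and is open there.
  have hUo : IsOpen U := by
    have : U = ⋂ u ∈ F, {y | 0 < h.bc u (faceParam F p y)} := by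
      ext y
      have h3 : h.bc v (faceParam F p y) = 0 := by
        rw [affineMap_add_sub (h.bc v) _ p, h.bc_ne (hF hp) (by rintro rfl; exact hv.notMem hp),
          faceParam, add_sub_cancel_left, hv.linear_bc_of_mem_vectorSpan h y.2, add_zero]
      simp [hU, hv.mem_relInt_iff h, h3]
    rw [this]
    exact isOpen_biInter_finset fun u _ =>
      isOpen_lt continuous_const ((h.continuous_bc u).comp hcont)
  have h4 : Set.EqOn (fun y => f (faceParam F p y)) (fun _ => 0) U := by
    refine Measure.eqOn_open_of_ae_eq (μ := volume) ?_ hUo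
      (hf.comp hcont.continuousOn fun y hy => relInt_subset_hull F hy) continuousOn_const
    exact ae_restrict_of_ae_restrict_of_subset
      (Set.preimage_mono (relInt_subset_hull F)) h2
  have h5 : Set.EqOn f (fun _ => 0) (relInt F) := by
    intro x hx
    obtain ⟨y, rfl⟩ := hull_subset_range_faceParam hp (relInt_subset_hull F hx)
    exact h4 hx
  exact h5.of_subset_closure hf continuousOn_const (relInt_subset_hull F)
    (hull_subset_closure_relInt ⟨p, hp⟩)

end FaceMeasure

/-! ### Traces on a half-space, without surface integrals -/

lemma inner_gradient_eq_fderiv {d : ℕ} (φ : Eu d → ℝ) (x y : Eu d) :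
    inner ℝ y (gradient φ x) = fderiv ℝ φ x y := by
  rw [real_inner_comm, gradient, InnerProductSpace.toDual_symm_apply]

/-- The divergence of `φ w`, in expanded form. -/
def divMul {d : ℕ} (φ : Eu d → ℝ) (w : Eu d → Eu d) (x : Eu d) : ℝ :=
  φ x * divergence w x + fderiv ℝ φ x (w x)

lemma divMul_eq_zero_of_notMem_tsupport {d : ℕ} {φ : Eu d → ℝ} (w : Eu d → Eu d) {x : Eu d}
    (hx : x ∉ tsupport φ) : divMul φ w x = 0 := by
  rw [divMul, image_eq_zero_of_notMem_tsupport hx, fderiv_of_notMem_tsupport (𝕜 := ℝ) hx]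
  simp

lemma divergence_eq {d : ℕ} {w : Eu d → Eu d} (hw : Differentiable ℝ w) (x : Eu d) :
    divergence w x = ∑ i, fderiv ℝ (fun y => w y i) x (EuclideanSpace.single i 1) := by
  refine Finset.sum_congr rfl fun i _ => ?_
  have : (fun y => w y i) = (EuclideanSpace.proj (𝕜 := ℝ) i) ∘ w := rfl
  rw [this, ((EuclideanSpace.proj (𝕜 := ℝ) i).hasFDerivAt.comp x (hw x).hasFDerivAt).fderiv]
  simp

lemma continuous_divergence {d : ℕ} {w : Eu d → Eu d} (hw : ContDiff ℝ ∞ w) :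
    Continuous (divergence w) := by
  have := hw.continuous_fderiv (by simp)
  unfold divergence
  fun_prop

lemma divergence_sub {d : ℕ} {w w' : Eu d → Eu d} (hw : Differentiable ℝ w)
    (hw' : Differentiable ℝ w') (x : Eu d) :
    divergence (w - w') x = divergence w x - divergence w' x := by
  simp [divergence, fderiv_sub (hw x) (hw' x)]

lemma divMul_sub {d : ℕ} (φ : Eu d → ℝ) {w w' : Eu d → Eu d} (hw : Differentiable ℝ w)
    (hw' : Differentiable ℝ w') (x : Eu d) :
    divMul φ (w - w') x = divMul φ w x - divMul φ w' x := by
  rw [divMul, divMul, divMul, divergence_sub hw hw']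
  simp
  ring

lemma continuous_divMul {d : ℕ} {φ : Eu d → ℝ} (hφ : ContDiff ℝ ∞ φ) {w : Eu d → Eu d}
    (hw : ContDiff ℝ ∞ w) : Continuous (divMul φ w) := by
  have h1 := hφ.continuous_fderiv (by simp)
  have h2 := continuous_divergence hw
  have h3 := hw.continuous
  have h4 := hφ.continuous
  unfold divMul
  fun_prop

lemma hasCompactSupport_divMul {d : ℕ} {φ : Eu d → ℝ} (hs : HasCompactSupport φ)
    (w : Eu d → Eu d) : HasCompactSupport (divMul φ w) :=
  HasCompactSupport.intro hs fun _ hx => divMul_eq_zero_of_notMem_tsupport w hx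

lemma integrable_divMul {d : ℕ} {φ : Eu d → ℝ} (hφ : ContDiff ℝ ∞ φ) (hs : HasCompactSupport φ)
    {w : Eu d → Eu d} (hw : ContDiff ℝ ∞ w) : Integrable (divMul φ w) :=
  (continuous_divMul hφ hw).integrable_of_hasCompactSupport (hasCompactSupport_divMul hs w)

/-- Integration by parts in each coordinate; the compact support of `φ` leaves no boundary term. -/
lemma integral_divMul {d : ℕ} {φ : Eu d → ℝ} (hφ : ContDiff ℝ ∞ φ) (hs : HasCompactSupport φ)
    {w : Eu d → Eu d} (hw : ContDiff ℝ ∞ w) : ∫ x, divMul φ w x = 0 := by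
  have hwd : Differentiable ℝ w := hw.differentiable (by simp)
  have hφd : Differentiable ℝ φ := hφ.differentiable (by simp)
  have hwi : ∀ i, ContDiff ℝ ∞ fun y => w y i := fun i => contDiff_euclidean.1 hw i
  have hφ' := hφ.continuous_fderiv (by simp)
  have hfs : HasCompactSupport (fderiv ℝ φ) := hs.fderiv (𝕜 := ℝ)
  have i1 : ∀ i, Integrable fun x =>
      φ x * fderiv ℝ (fun y => w y i) x (EuclideanSpace.single i 1) := fun i => by
    have := (hwi i).continuous_fderiv (by simp)
    have := hφ.continuous
    exact Continuous.integrable_of_hasCompactSupport (by fun_prop) hs.mul_right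
  have hs2 : ∀ i : Fin d, HasCompactSupport fun x => fderiv ℝ φ x (EuclideanSpace.single i 1) :=
    fun i => hfs.comp_left
      (g := fun L : Eu d →L[ℝ] ℝ => L (EuclideanSpace.single i 1)) (by simp)
  have i2 : ∀ i, Integrable fun x =>
      fderiv ℝ φ x (EuclideanSpace.single i 1) * w x i := fun i => by
    have := (hwi i).continuous
    exact Continuous.integrable_of_hasCompactSupport (by fun_prop) (hs2 i).mul_right
  have i3 : ∀ i, Integrable fun x => φ x * w x i := fun i => by
    have := (hwi i).continuous
    have := hφ.continuous
    exact Continuous.integrable_of_hasCompactSupport (by fun_prop) hs.mul_right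
  have hexp : ∀ x, divMul φ w x = ∑ i, (φ x * fderiv ℝ (fun y => w y i) x
      (EuclideanSpace.single i 1) + fderiv ℝ φ x (EuclideanSpace.single i 1) * w x i) := by
    intro x
    rw [divMul, divergence_eq hwd, Finset.sum_add_distrib, Finset.mul_sum]
    congr 1
    have : w x = ∑ i, (w x i) • EuclideanSpace.single i (1 : ℝ) := by
      have := (EuclideanSpace.basisFun (Fin d) ℝ).sum_repr (w x)
      simpa using this.symm
    conv_lhs => rw [this, map_sum]
    exact Finset.sum_congr rfl fun i _ => by rw [map_smul, smul_eq_mul, mul_comm]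
  simp_rw [hexp]
  have i4 : ∀ i, Integrable fun x => φ x * fderiv ℝ (fun y => w y i) x
      (EuclideanSpace.single i 1) + fderiv ℝ φ x (EuclideanSpace.single i 1) * w x i :=
    fun i => (i1 i).add (i2 i)
  rw [integral_finsetSum _ fun i _ => i4 i]
  refine Finset.sum_eq_zero fun i _ => ?_
  rw [integral_add (i1 i) (i2 i),
    integral_mul_fderiv_eq_neg_fderiv_mul_of_integrable (i2 i) (i1 i) (i3 i)
      (fun x _ => hφd x) (fun x _ => (hwi i).differentiable (by simp) x)]
  ring

/-- A constant field whose divergence vanishes weakly across a half-space boundary is tangential. -/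
lemma inner_eq_zero_of_halfSpace_const {d : ℕ} {n v : Eu d}
    (H : ∀ φ : Eu d → ℝ, ContDiff ℝ ∞ φ → HasCompactSupport φ →
      tsupport φ ⊆ Metric.ball 0 1 → ∫ x in {x : Eu d | inner ℝ x n ≤ 0}, fderiv ℝ φ x v = 0) :
    inner ℝ v n = 0 := by
  wlog hpos : 0 < inner ℝ v n generalizing v
  · rcases (not_lt.1 hpos).lt_or_eq with h | h
    · have := this (v := -v) (fun φ h1 h2 h3 => by simp [integral_neg, H φ h1 h2 h3])
        (by simpa using h)
      simpa using this
    · exact h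
  exfalso
  -- The bump is supported in the ball of radius `1 / 2`. Shifts of length below `1 / 4` keep the
  -- support within radius `3 / 4`, so every such translate is an admissible test function for `H`.
  let f : ContDiffBump (0 : Eu d) := ⟨1 / 4, 1 / 2, by norm_num, by norm_num⟩
  set S : Set (Eu d) := {x : Eu d | inner ℝ x n ≤ 0} with hS
  have hSm : MeasurableSet S := (isClosed_le (by fun_prop) continuous_const).measurableSet
  have hf : ContDiff ℝ ∞ f := f.contDiff
  have hf' := hf.continuous_fderiv (by simp)
  have hfc := hf.continuous
  obtain ⟨C, hC⟩ := (f.hasCompactSupport.fderiv (𝕜 := ℝ)).exists_bound_of_continuous hf'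
  have hv : 0 < ‖v‖ := norm_pos_iff.2 (by rintro rfl; simp at hpos)
  set s₀ : ℝ := 1 / (4 * ‖v‖) with hs₀
  have hs₀p : 0 < s₀ := by positivity
  have hball : ∀ s ∈ Metric.ball (0 : ℝ) s₀, ‖s • v‖ < 1 / 4 := by
    intro s hs
    rw [norm_smul]
    have : ‖s‖ < s₀ := by simpa using hs
    calc ‖s‖ * ‖v‖ < s₀ * ‖v‖ := by gcongr
      _ = 1 / 4 := by rw [hs₀]; field_simp
  have hsupp : ∀ s ∈ Metric.ball (0 : ℝ) s₀, ∀ x, x ∉ Metric.closedBall (0 : Eu d) (3 / 4) →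
      x + s • v ∉ tsupport f := by
    intro s hs x hx hx'
    rw [f.tsupport_eq] at hx'
    have h1 : ‖x + s • v‖ ≤ 1 / 2 := by simpa [f] using hx'
    have h2 := hball s hs
    have h3 : ‖x‖ ≤ ‖x + s • v‖ + ‖s • v‖ := by
      simpa using norm_sub_le (x + s • v) (s • v)
    exact hx (by rw [mem_closedBall_zero_iff]; linarith)
  -- The mass of the translated bump in the half-space. Its derivative in `s` is the integral in `H`
  -- for a translate of `f`, hence zero, so this mass is constant.
  let G : ℝ → ℝ := fun s => ∫ x in S, f (x + s • v)
  have hder : ∀ s ∈ Metric.ball (0 : ℝ) s₀, HasDerivAt G 0 s := by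
    intro s hs
    have h1 : ∀ t ∈ Metric.ball (0 : ℝ) s₀, HasCompactSupport fun x => f (x + t • v) :=
      fun t ht => HasCompactSupport.intro (isCompact_closedBall (0 : Eu d) (3 / 4))
        fun x hx => image_eq_zero_of_notMem_tsupport (hsupp t ht x hx)
    have hbound : Integrable ((Metric.closedBall (0 : Eu d) (3 / 4)).indicator
        fun _ => C * ‖v‖) (volume.restrict S) := by
      have h2 : IntegrableOn (fun _ : Eu d => C * ‖v‖) (Metric.closedBall (0 : Eu d) (3 / 4)) :=
        continuousOn_const.integrableOn_compact (isCompact_closedBall _ _)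
      exact ((integrable_indicator_iff measurableSet_closedBall).2 h2).integrableOn
    have key := hasDerivAt_integral_of_dominated_loc_of_deriv_le (μ := volume.restrict S)
      (s := Metric.ball (0 : ℝ) s₀) (x₀ := s)
      (F := fun t x => f (x + t • v)) (F' := fun t x => fderiv ℝ f (x + t • v) v)
      (bound := (Metric.closedBall (0 : Eu d) (3 / 4)).indicator fun _ => C * ‖v‖)
      (Metric.isOpen_ball.mem_nhds hs)
      (Filter.Eventually.of_forall fun t => by
        have : Continuous fun x => f (x + t • v) := by fun_prop
        exact this.aestronglyMeasurable)
      (by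
        have : Continuous fun x => f (x + s • v) := by fun_prop
        exact (this.integrable_of_hasCompactSupport (h1 s hs)).integrableOn)
      (by
        have : Continuous fun x => fderiv ℝ f (x + s • v) v := by fun_prop
        exact this.aestronglyMeasurable)
      (Filter.Eventually.of_forall fun x t ht => by
        by_cases hx : x ∈ Metric.closedBall (0 : Eu d) (3 / 4)
        · rw [Set.indicator_of_mem hx]
          exact ((fderiv ℝ f (x + t • v)).le_opNorm v).trans (by gcongr; exact hC _)
        · rw [Set.indicator_of_notMem hx, fderiv_of_notMem_tsupport (𝕜 := ℝ) (hsupp t ht x hx)]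
          simp)
      hbound
      (Filter.Eventually.of_forall fun x t _ => by
        have h2 : HasDerivAt (fun t : ℝ => x + t • v) v t := by
          simpa using ((hasDerivAt_id t).smul_const v).const_add x
        exact ((hf.differentiable (by simp)) _).hasFDerivAt.comp_hasDerivAt t h2)
    have h3 : ∫ x in S, fderiv ℝ f (x + s • v) v = 0 := by
      have h4 := H (fun x => f (x + s • v)) (by fun_prop) (h1 s hs) (by
        refine (closure_minimal (fun x hx => ?_) Metric.isClosed_closedBall).trans
          (Metric.closedBall_subset_ball (by norm_num : (3 / 4 : ℝ) < 1))
        by_contra hx'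
        exact hx (image_eq_zero_of_notMem_tsupport (hsupp s hs x hx')))
      simpa only [fderiv_comp_add_right] using h4
    have h5 := key.2
    rwa [h3] at h5
  have hconst : G (s₀ / 2) = G 0 := by
    refine (convex_ball (0 : ℝ) s₀).is_const_of_fderivWithin_eq_zero (𝕜 := ℝ) (f := G)
      (fun s hs => (hder s hs).differentiableAt.differentiableWithinAt) (fun s hs => ?_)
      ?_ (by simpa using hs₀p)
    · rw [fderivWithin_of_isOpen Metric.isOpen_ball hs]
      have := (hder s hs).hasFDerivAt.fderiv
      rw [this]; ext; simp
    · simp [abs_of_pos hs₀p]; linarith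
  set a := s₀ / 2 * inner ℝ v n with ha
  have hap : 0 < a := by positivity
  have h_integrable : Integrable f := hfc.integrable_of_hasCompactSupport f.hasCompactSupport
  -- Translating the half-space instead of the bump enlarges it by the slab `0 < ⟪y, n⟫ ≤ a`, which
  -- must then carry no mass of `f`.
  have hG : G (s₀ / 2) = ∫ y in {y : Eu d | inner ℝ y n ≤ a}, f y := by
    have hm : MeasurableSet {y : Eu d | inner ℝ y n ≤ a} :=
      (isClosed_le (by fun_prop) continuous_const).measurableSet
    change ∫ x in S, f (x + (s₀ / 2) • v) = _
    rw [← integral_indicator hSm, ← integral_indicator hm,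
      ← integral_add_right_eq_self (({y : Eu d | inner ℝ y n ≤ a}).indicator f) ((s₀ / 2) • v)]
    congr 1
    ext x
    have : x ∈ S ↔ x + (s₀ / 2) • v ∈ {y : Eu d | inner ℝ y n ≤ a} := by
      simp [hS, inner_add_left, inner_smul_left, ha]
    by_cases hx : x ∈ S
    · rw [Set.indicator_of_mem hx, Set.indicator_of_mem (this.1 hx)]
    · rw [Set.indicator_of_notMem hx, Set.indicator_of_notMem (fun h => hx (this.2 h))]
  have hG0 : G 0 = ∫ y in S, f y := by simp [G]
  have hsplit : ∫ y in {y : Eu d | inner ℝ y n ≤ a}, f y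
      = (∫ y in S, f y) + ∫ y in {y : Eu d | inner ℝ y n ≤ a} \ S, f y := by
    have hm : MeasurableSet ({y : Eu d | inner ℝ y n ≤ a} \ S) :=
      ((isClosed_le (by fun_prop) continuous_const).measurableSet).diff hSm
    rw [← setIntegral_union Set.disjoint_sdiff_right hm h_integrable.integrableOn h_integrable.integrableOn]
    congr 2
    rw [Set.union_sdiff_cancel]
    intro y hy
    exact le_trans (by exact hy) hap.le
  have hzero : ∫ y in {y : Eu d | inner ℝ y n ≤ a} \ S, f y = 0 := by
    rw [hG, hG0, hsplit] at hconst
    linarith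
  -- An open part of the slab on which the bump equals one. It contains `t • v` for small `t > 0`,
  -- so it has positive measure, a contradiction.
  set W : Set (Eu d) := {y | 0 < inner ℝ y n} ∩ {y | inner ℝ y n < a} ∩ Metric.ball 0 (1 / 4)
  have hWo : IsOpen W := ((isOpen_lt continuous_const (by fun_prop)).inter
    (isOpen_lt (by fun_prop) continuous_const)).inter Metric.isOpen_ball
  have hWn : W.Nonempty := by
    have h1 : Filter.Tendsto (fun t : ℝ => t • v) (nhdsWithin 0 (Set.Ioi 0)) (nhds 0) := by
      have : Continuous fun t : ℝ => t • v := by fun_prop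
      simpa using (this.tendsto 0).mono_left nhdsWithin_le_nhds
    have h2 : ∀ᶠ y in nhds (0 : Eu d), inner ℝ y n < a ∧ y ∈ Metric.ball (0 : Eu d) (1 / 4) := by
      refine Filter.Eventually.and ?_ (Metric.ball_mem_nhds _ (by norm_num))
      have : Continuous fun y : Eu d => inner ℝ y n := by fun_prop
      exact this.continuousAt.eventually_lt_const (by simpa using hap)
    obtain ⟨t, ht, ht'⟩ := ((h1.eventually h2).and self_mem_nhdsWithin).exists
    refine ⟨t • v, ⟨?_, ht.1⟩, ht.2⟩
    simp only [Set.mem_ofPred_eq, inner_smul_left]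
    exact mul_pos ht' hpos
  have hWsub : W ⊆ {y : Eu d | inner ℝ y n ≤ a} \ S := by
    rintro y ⟨⟨h1, h2⟩, -⟩
    simp only [hS, Set.mem_sdiff, Set.mem_ofPred_eq, not_le] at h1 h2 ⊢
    exact ⟨h2.le, h1⟩
  have h1 : ∫ y in W, f y = 0 := le_antisymm
    (hzero ▸ setIntegral_mono_set h_integrable.integrableOn (Filter.Eventually.of_forall fun y => f.nonneg)
      hWsub.eventuallyLE) (integral_nonneg fun y => f.nonneg)
  have h2 : ∫ y in W, f y = ∫ _y in W, (1 : ℝ) := by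
    refine setIntegral_congr_fun hWo.measurableSet fun y hy => ?_
    exact f.one_of_mem_closedBall (Metric.ball_subset_closedBall hy.2)
  rw [h2] at h1
  have h3 : 0 < volume W := hWo.measure_pos volume hWn
  have h4 : volume W < ⊤ := (measure_mono Set.inter_subset_right).trans_lt measure_ball_lt_top
  simp only [integral_const, MeasurableSet.univ, measureReal_restrict_apply, Set.univ_inter,
    smul_eq_mul, mul_one] at h1
  exact (ENNReal.toReal_pos h3.ne' h4.ne).ne' h1

/-- A smooth field whose divergence vanishes weakly across a half-space boundary is tangential
there. -/
lemma inner_eq_zero_of_halfSpace {d : ℕ} {n x₀ : Eu d} {r : ℝ} (hr : 0 < r) {w : Eu d → Eu d}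
    (hw : ContDiff ℝ ∞ w)
    (H : ∀ φ : Eu d → ℝ, ContDiff ℝ ∞ φ → HasCompactSupport φ →
      tsupport φ ⊆ Metric.ball x₀ r →
        ∫ x in {x : Eu d | inner ℝ (x - x₀) n ≤ 0}, divMul φ w x = 0) :
    inner ℝ (w x₀) n = 0 := by
  refine inner_eq_zero_of_halfSpace_const fun φ hφ hs hsupp => ?_
  have hφ' := hφ.continuous_fderiv (by simp)
  have hφc := hφ.continuous
  have hwc := hw.continuous
  have hdw := continuous_divergence hw
  set S : Set (Eu d) := {x : Eu d | inner ℝ x n ≤ 0} with hS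
  have hSc : IsClosed S := isClosed_le (by fun_prop) continuous_const
  set K := S ∩ tsupport φ with hK
  have hKc : IsCompact K := hs.inter_left hSc
  have hφd : Differentiable ℝ φ := hφ.differentiable (by simp)
  -- Blow-up at `x₀`: this is `ε` times the integrand for the test function `φ ((x - x₀) / ε)`,
  -- written in `y = (x - x₀) / ε`. The divergence term keeps a factor `ε`; at `ε = 0` only the
  -- derivative of `φ` along the constant vector `w x₀` is left.
  let F : ℝ → Eu d → ℝ := fun ε y =>
    ε * (φ y * divergence w (x₀ + ε • y)) + fderiv ℝ φ y (w (x₀ + ε • y))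
  let J : ℝ → ℝ := fun ε => ∫ y in S, F ε y
  have hJK : ∀ ε, J ε = ∫ y in K, F ε y := fun ε => by
    refine setIntegral_eq_of_subset_of_forall_sdiff_eq_zero hSc.measurableSet
      Set.inter_subset_left fun y hy => ?_
    have hy' : y ∉ tsupport φ := fun h => hy.2 ⟨hy.1, h⟩
    simp only [F]
    rw [image_eq_zero_of_notMem_tsupport hy', fderiv_of_notMem_tsupport (𝕜 := ℝ) hy']
    simp
  -- Restricting to the compact set `K` makes the parameter integral continuous, so its vanishing
  -- for small `ε > 0` carries over to `ε = 0`.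
  have hJc : Continuous J := by
    have : J = fun ε => ∫ y in K, F ε y := funext hJK
    rw [this]
    refine continuous_parametric_integral_of_continuous ?_ hKc
    simp only [F, Function.uncurry_def]
    fun_prop
  have hJ0 : ∀ ε ∈ Set.Ioo 0 r, J ε = 0 := by
    intro ε hε
    have hε0 : ε ≠ 0 := hε.1.ne'
    set ψ : Eu d → ℝ := fun x => φ (ε⁻¹ • (x - x₀)) with hψ
    have hψd : ContDiff ℝ ∞ ψ := by fun_prop
    have hψs : tsupport ψ ⊆ (fun y => x₀ + ε • y) '' tsupport φ := by
      have hcl : IsClosed ((fun y : Eu d => x₀ + ε • y) '' tsupport φ) :=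
        (IsCompact.image hs (by fun_prop)).isClosed
      refine closure_minimal (fun x hx => ?_) hcl
      refine ⟨ε⁻¹ • (x - x₀), subset_tsupport φ hx, ?_⟩
      simp [smul_smul, hε0]
    have hψc : HasCompactSupport ψ :=
      (IsCompact.image hs (by fun_prop : Continuous fun y : Eu d => x₀ + ε • y)).of_isClosed_subset
        (isClosed_tsupport _) hψs
    have hψb : tsupport ψ ⊆ Metric.ball x₀ r := by
      refine hψs.trans ?_
      rintro _ ⟨y, hy, rfl⟩
      have h1 : ‖y‖ < 1 := by simpa using hsupp hy
      simp only [Metric.mem_ball, dist_self_add_left, norm_smul, Real.norm_of_nonneg hε.1.le]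
      nlinarith [hε.1, hε.2, norm_nonneg y]
    have h1 := H ψ hψd hψc hψb
    set S' : Set (Eu d) := {x : Eu d | inner ℝ (x - x₀) n ≤ 0} with hS'
    have hSm' : MeasurableSet S' := (isClosed_le (by fun_prop) continuous_const).measurableSet
    have hval : ∀ y, ε * divMul ψ w (x₀ + ε • y) = F ε y := by
      intro y
      have h2 : HasFDerivAt ψ ((fderiv ℝ φ y).comp (ε⁻¹ • ContinuousLinearMap.id ℝ (Eu d)))
          (x₀ + ε • y) := by
        have h3 : HasFDerivAt (fun x : Eu d => ε⁻¹ • (x - x₀))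
            (ε⁻¹ • ContinuousLinearMap.id ℝ (Eu d)) (x₀ + ε • y) :=
          ((hasFDerivAt_id _).sub_const x₀).const_smul ε⁻¹
        have h4 : ε⁻¹ • ((x₀ + ε • y) - x₀) = y := by simp [smul_smul, hε0]
        have h5 : HasFDerivAt φ (fderiv ℝ φ y) (ε⁻¹ • ((x₀ + ε • y) - x₀)) := by
          rw [h4]; exact (hφd y).hasFDerivAt
        exact HasFDerivAt.comp (g := φ) (x₀ + ε • y) h5 h3
      have h6 : ψ (x₀ + ε • y) = φ y := by simp [hψ, smul_smul, hε0]
      rw [divMul, h2.fderiv, h6]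
      simp only [F, mul_add, ContinuousLinearMap.comp_apply, smul_apply,
        ContinuousLinearMap.id_apply, map_smul, smul_eq_mul]
      rw [mul_inv_cancel_left₀ hε0]
    have h7 : J ε = ε * ∫ y, (S'.indicator (divMul ψ w)) (x₀ + ε • y) := by
      change ∫ y in S, F ε y = _
      rw [← integral_const_mul, ← integral_indicator hSc.measurableSet]
      congr 1
      ext y
      have : y ∈ S ↔ x₀ + ε • y ∈ S' := by
        simp only [hS, hS', Set.mem_ofPred_eq, add_sub_cancel_left, inner_smul_left]
        simp [mul_nonpos_iff, hε.1.le, hε.1.not_ge]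
      by_cases hy : y ∈ S
      · rw [Set.indicator_of_mem hy, Set.indicator_of_mem (this.1 hy), hval]
      · rw [Set.indicator_of_notMem hy, Set.indicator_of_notMem (fun h => hy (this.2 h)), mul_zero]
    rw [h7, Measure.integral_comp_smul volume (fun z => S'.indicator (divMul ψ w) (x₀ + z)) ε,
      integral_add_left_eq_self, integral_indicator hSm', h1]
    simp
  have h8 : J 0 = 0 := by
    have h9 : Filter.Tendsto J (nhdsWithin 0 (Set.Ioo 0 r)) (nhds (J 0)) :=
      (hJc.tendsto 0).mono_left nhdsWithin_le_nhds
    have h10 : Filter.Tendsto J (nhdsWithin 0 (Set.Ioo 0 r)) (nhds 0) :=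
      tendsto_const_nhds.congr' (eventually_nhdsWithin_of_forall fun ε hε => (hJ0 ε hε).symm)
    have : (nhdsWithin (0 : ℝ) (Set.Ioo 0 r)).NeBot := by
      rw [nhdsWithin_Ioo_eq_nhdsGT hr]; infer_instance
    exact tendsto_nhds_unique h9 h10
  simpa [J, F] using h8

/-- At most `d` points span an affine subspace of dimension at most `d - 1`. Such subspaces are null
sets, which provides the generic direction in `not_forall_exists_neighbour`. -/
lemma affineSpan_ne_top_of_card_le {d : ℕ} {G : Finset (Eu d)} (hG : G.Nonempty)
    (hc : G.card ≤ d) : affineSpan ℝ (G : Set (Eu d)) ≠ ⊤ := by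
  classical
  intro h
  have h1 : G.card = (G.card - 1) + 1 := by have := hG.card_pos; omega
  have h2 := finrank_vectorSpan_image_finset_le ℝ (id : Eu d → Eu d) G h1
  rw [Finset.image_id, ← direction_affineSpan, h, AffineSubspace.direction_top, finrank_top,
    finrank_euclideanSpace_fin] at h2
  have := hG.card_pos
  omega

namespace Mesh

variable {d : ℕ} {Ω : Set (Eu d)} (M : Mesh d Ω)

/-! ### Geometry of a mesh -/

lemma mem_facesOf {T : M.cells} {F : M.faces} :
    F ∈ M.facesOf T ↔ (F : Finset (Eu d)) ⊆ (T : Finset (Eu d)) := by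
  simp [facesOf]

lemma card_face (F : M.faces) : (F : Finset (Eu d)).card = d := by
  classical
  obtain ⟨F, hF⟩ := F
  simp only [faces, Finset.mem_biUnion, Finset.mem_powersetCard] at hF
  obtain ⟨T, -, -, h⟩ := hF
  exact h

lemma face_nonempty (hd : 1 ≤ d) (F : M.faces) : (F : Finset (Eu d)).Nonempty :=
  Finset.card_pos.1 (by rw [M.card_face]; omega)

lemma exists_isFace {T : M.cells} {F : M.faces} (hF : F ∈ M.facesOf T) :
    ∃ v, IsFace (T : Finset (Eu d)) (F : Finset (Eu d)) v :=
  (M.isCell T).exists_isFace (M.mem_facesOf.1 hF) (M.card_face F)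

lemma exists_cell (F : M.faces) : ∃ T : M.cells, F ∈ M.facesOf T := by
  classical
  have hF := F.2
  simp only [faces, Finset.mem_biUnion, Finset.mem_powersetCard] at hF
  obtain ⟨T, hT, h, -⟩ := hF
  exact ⟨⟨T, hT⟩, M.mem_facesOf.2 h⟩

/-- The face of the cell `T` opposite to its vertex `v`. -/
lemma exists_face_erase [DecidableEq (Eu d)] (T : M.cells) {v : Eu d}
    (hv : v ∈ (T : Finset (Eu d))) :
    ∃ F : M.faces, F ∈ M.facesOf T ∧ (F : Finset (Eu d)) = (T : Finset (Eu d)).erase v := by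
  have h : (T : Finset (Eu d)).erase v ∈ M.faces := by
    simp only [faces, Finset.mem_biUnion, Finset.mem_powersetCard]
    refine ⟨T, T.2, Finset.erase_subset _ _, ?_⟩
    rw [Finset.card_erase_of_mem hv, (M.isCell T).card_eq]
    omega
  exact ⟨⟨_, h⟩, M.mem_facesOf.2 (Finset.erase_subset _ _), rfl⟩

lemma mem_hull_inter [DecidableEq (Eu d)] {S T : M.cells} {x : Eu d}
    (hS : x ∈ hull (S : Finset (Eu d))) (hT : x ∈ hull (T : Finset (Eu d))) :
    x ∈ hull ((S : Finset (Eu d)) ∩ (T : Finset (Eu d))) := by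
  have := M.conforming S S.2 T T.2 ⟨hS, hT⟩
  rw [hull, Finset.coe_inter]
  exact this

/-- By conformity a common point lies in the hull of the common vertices. These form a proper subset
of the vertices of `T`, and interior points of `T` avoid such hulls. -/
lemma disjoint_hull_interior {S T : M.cells} (hne : S ≠ T) :
    Disjoint (hull (S : Finset (Eu d))) (interior (hull (T : Finset (Eu d)))) := by
  classical
  rw [Set.disjoint_left]
  intro x hS hT
  have h1 := M.mem_hull_inter hS (interior_subset hT)
  refine (M.isCell T).notMem_hull_of_mem_interior Finset.inter_subset_right (fun h => hne ?_) hT h1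
  have h2 : (T : Finset (Eu d)) ⊆ S := Finset.inter_eq_right.1 h
  exact (Subtype.ext (Finset.eq_of_subset_of_card_le h2
    (by rw [(M.isCell S).card_eq, (M.isCell T).card_eq]))).symm

/-- A relative interior point of `F` has positive coordinates at all vertices of `F`. It can lie in
the hull of the common vertices of `S` and `T` only if all of these vertices are common. -/
lemma face_subset_of_mem_hull {S T : M.cells} {F : M.faces} (hF : F ∈ M.facesOf T) {x : Eu d}
    (hx : x ∈ relInt (F : Finset (Eu d))) (hS : x ∈ hull (S : Finset (Eu d))) :
    F ∈ M.facesOf S := by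
  classical
  have hFT := M.mem_facesOf.1 hF
  have h1 := M.mem_hull_inter hS (hull_mono hFT (relInt_subset_hull _ hx))
  rw [(M.isCell T).mem_hull_subset_iff Finset.inter_subset_right] at h1
  rw [(M.isCell T).mem_relInt_iff hFT] at hx
  refine M.mem_facesOf.2 fun u hu => ?_
  by_contra hu'
  exact (hx.1 u hu).ne' (h1.2 u (hFT hu) fun h => hu' (Finset.mem_inter.1 h).1)

lemma eventually_notMem_hull {T : M.cells} {F : M.faces} (hF : F ∈ M.facesOf T) {x₀ : Eu d}
    (hx₀ : x₀ ∈ relInt (F : Finset (Eu d))) :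
    ∀ᶠ x in nhds x₀, ∀ S : M.cells, F ∉ M.facesOf S → x ∉ hull (S : Finset (Eu d)) := by
  rw [Filter.eventually_all]
  intro S
  by_cases hS : F ∈ M.facesOf S
  · exact Filter.Eventually.of_forall fun _ h => absurd hS h
  · have : x₀ ∈ (hull (S : Finset (Eu d)))ᶜ := fun h => hS (M.face_subset_of_mem_hull hF hx₀ h)
    filter_upwards [(isClosed_hull _).isOpen_compl.mem_nhds this] with x hx _
    exact hx

/-- Two cells that share a face lie on opposite sides of it. -/
lemma outwardNormal_eq_neg (hd : 1 ≤ d) {S T : M.cells} (hne : S ≠ T) {F : M.faces}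
    (hS : F ∈ M.facesOf S) (hT : F ∈ M.facesOf T) :
    outwardNormal (S : Finset (Eu d)) F = -outwardNormal (T : Finset (Eu d)) F := by
  have hFn := M.face_nonempty hd F
  obtain ⟨v, hv⟩ := M.exists_isFace hT
  obtain ⟨v', hv'⟩ := M.exists_isFace hS
  obtain ⟨h1, h2, -⟩ := hv'.outwardNormal_spec (M.isCell S) hFn
  -- If the normals were equal, a small step from `x₀` against `n` would enter the interiors of both
  -- cells.
  refine (hv.eq_or_eq_neg_outwardNormal (M.isCell T) hFn h1 h2).resolve_left fun h => ?_
  obtain ⟨x₀, hx₀⟩ := relInt_nonempty hFn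
  set n := outwardNormal (T : Finset (Eu d)) F with hn
  have hlim : Filter.Tendsto (fun t : ℝ => x₀ - t • n) (nhdsWithin 0 (Set.Ioi 0)) (nhds x₀) := by
    have : Continuous fun t : ℝ => x₀ - t • n := by fun_prop
    simpa using (this.tendsto 0).mono_left nhdsWithin_le_nhds
  obtain ⟨t, ⟨ht1, ht2⟩, ht⟩ :=
    ((hlim.eventually ((hv.eventually_mem_hull_iff (M.isCell T) hFn hx₀).and
      (hv'.eventually_mem_hull_iff (M.isCell S) hFn hx₀))).and self_mem_nhdsWithin).exists
  have hneg : inner ℝ (x₀ - t • n - x₀) n < 0 := by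
    have hn1 : ‖n‖ = 1 := h ▸ h2
    rw [sub_sub_cancel_left, inner_neg_left, inner_smul_left, real_inner_self_eq_norm_sq, hn1]
    simpa using ht
  rw [h] at ht2
  exact Set.disjoint_left.1 (M.disjoint_hull_interior hne) (ht2.1.2 hneg.le) (ht1.2.2 hneg)

/-- A face belongs to at most two cells. -/
lemma eq_of_ne_of_ne (hd : 1 ≤ d) {S S' T : M.cells} {F : M.faces} (hT : F ∈ M.facesOf T)
    (hS : F ∈ M.facesOf S) (hS' : F ∈ M.facesOf S') (hne : S ≠ T) (hne' : S' ≠ T) : S = S' := by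
  by_contra h
  have h1 := M.outwardNormal_eq_neg hd hne hS hT
  have h2 := M.outwardNormal_eq_neg hd hne' hS' hT
  have h3 := M.outwardNormal_eq_neg hd h hS hS'
  obtain ⟨v, hv⟩ := M.exists_isFace hT
  have h4 := (hv.outwardNormal_spec (M.isCell T) (M.face_nonempty hd F)).2.1
  -- Three cells would have pairwise opposite normals, which forces a unit normal to equal its own
  -- negative.
  rw [h1, h2, neg_neg, neg_eq_iff_add_eq_zero, ← two_smul ℝ] at h3
  rw [(smul_eq_zero.1 h3).resolve_left two_ne_zero, norm_zero] at h4
  exact zero_ne_one h4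

include M in
lemma isOpen_domain : IsOpen Ω := by
  rw [M.domain_eq]
  exact isOpen_interior

lemma interior_hull_subset (T : M.cells) : interior (hull (T : Finset (Eu d))) ⊆ Ω := by
  conv_rhs => rw [M.domain_eq]
  exact interior_mono (Set.subset_biUnion_of_mem (u := fun T : Finset (Eu d) =>
    convexHull ℝ (T : Set (Eu d))) (by exact T.2))

lemma domain_subset : Ω ⊆ ⋃ T : M.cells, hull (T : Finset (Eu d)) := by
  conv_lhs => rw [M.domain_eq]
  refine interior_subset.trans fun x hx => ?_
  simp only [Set.mem_iUnion] at hx ⊢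
  obtain ⟨T, hT, h⟩ := hx
  exact ⟨⟨T, hT⟩, h⟩

lemma hull_subset_closure (T : M.cells) : hull (T : Finset (Eu d)) ⊆ closure Ω :=
  (M.isCell T).hull_subset_closure_interior.trans (closure_mono (M.interior_hull_subset T))

include M in
lemma volume_domain_lt_top : volume Ω < ⊤ :=
  (measure_mono M.domain_subset).trans_lt
    (isCompact_iUnion fun T : M.cells => isCompact_hull (T : Finset (Eu d))).measure_lt_top

lemma hull_ae_le_domain (T : M.cells) : hull (T : Finset (Eu d)) ≤ᵐ[volume] Ω :=
  (hull_ae_eq_interior _).le.trans (M.interior_hull_subset T).eventuallyLE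

lemma domain_ae_eq : Ω =ᵐ[volume] ⋃ T : M.cells, interior (hull (T : Finset (Eu d))) := by
  refine Filter.EventuallyLE.antisymm ?_
    (Set.iUnion_subset fun T => M.interior_hull_subset T).eventuallyLE
  refine M.domain_subset.eventuallyLE.trans ?_
  exact (Filter.EventuallyEq.countable_iUnion fun T => hull_ae_eq_interior _).le

/-- Integrals over the domain split into integrals over the cells. -/
lemma setIntegral_domain {f : Eu d → ℝ} (hf : IntegrableOn f Ω) :
    ∫ x in Ω, f x = ∑ T : M.cells, ∫ x in hull (T : Finset (Eu d)), f x := by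
  rw [setIntegral_congr_set M.domain_ae_eq, integral_iUnion_fintype
    (fun T => isOpen_interior.measurableSet) (fun S T hne => ?_)
    fun T => hf.mono_set (M.interior_hull_subset T)]
  · exact Finset.sum_congr rfl fun T _ => (setIntegral_congr_set (hull_ae_eq_interior _)).symm
  · exact (M.disjoint_hull_interior hne).mono_left interior_subset

/-- A face that belongs to only one cell lies on the boundary. -/
lemma hull_face_subset_frontier (hd : 1 ≤ d) {T : M.cells} {F : M.faces} (hF : F ∈ M.facesOf T)
    (hone : ∀ S : M.cells, F ∈ M.facesOf S → S = T) :
    hull (F : Finset (Eu d)) ⊆ frontier Ω := by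
  have hFn := M.face_nonempty hd F
  refine (hull_subset_closure_relInt hFn).trans (closure_minimal (fun x hx => ?_) isClosed_frontier)
  rw [M.isOpen_domain.frontier_eq]
  refine ⟨M.hull_subset_closure T (hull_mono (M.mem_facesOf.1 hF) (relInt_subset_hull _ hx)),
    fun hxΩ => ?_⟩
  obtain ⟨v, hv⟩ := M.exists_isFace hF
  set n := outwardNormal (T : Finset (Eu d)) F with hn
  have hn1 : ‖n‖ = 1 := (hv.outwardNormal_spec (M.isCell T) hFn).2.1
  have hlim : Filter.Tendsto (fun t : ℝ => x + t • n) (nhdsWithin 0 (Set.Ioi 0)) (nhds x) := by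
    have : Continuous fun t : ℝ => x + t • n := by fun_prop
    simpa using (this.tendsto 0).mono_left nhdsWithin_le_nhds
  -- If `x` were in `Ω`, so would be `x + t • n` for small `t > 0`. This point would lie in some
  -- cell, but near `x` only `T` is available and the point is on its outer side.
  obtain ⟨t, ⟨⟨ht1, ht2⟩, ht3⟩, ht⟩ :=
    ((hlim.eventually (((hv.eventually_mem_hull_iff (M.isCell T) hFn hx).and
      (M.eventually_notMem_hull hF hx)).and (M.isOpen_domain.mem_nhds hxΩ))).and
        self_mem_nhdsWithin).exists
  obtain ⟨S, hS⟩ := Set.mem_iUnion.1 (M.domain_subset ht3)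
  have hFS : F ∈ M.facesOf S := by
    by_contra h
    exact ht2 S h hS
  rw [hone S hFS] at hS
  have := ht1.1.1 hS
  rw [add_sub_cancel_left, inner_smul_left, real_inner_self_eq_norm_sq, hn1] at this
  have ht' : (0 : ℝ) < t := ht
  simp at this
  linarith

/-- A nonempty family of cells cannot be closed under passing to neighbours across all faces: a
generic ray leaves the union of the cells through the relative interior of a face. -/
lemma not_forall_exists_neighbour (hd : 1 ≤ d) {C : Set M.cells} (hC : C.Nonempty) :
    ¬ ∀ T ∈ C, ∀ F ∈ M.facesOf T, ∃ S ∈ C, S ≠ T ∧ F ∈ M.facesOf S := by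
  classical
  intro H
  obtain ⟨T₀, hT₀⟩ := hC
  obtain ⟨x₀, hx₀⟩ := (M.isCell T₀).interior_nonempty
  -- Removing two vertices of a cell and adding `x₀` leaves at most `d` points, so the target `y` of
  -- the ray can be chosen off all their affine spans. The ray from `x₀` towards `y` then misses the
  -- skeleton of codimension two at positive times.
  have hgen : ∀ᵐ y : Eu d, ∀ T ∈ M.cells, ∀ a ∈ T, ∀ b ∈ T, a ≠ b →
      y ∉ affineSpan ℝ ((insert x₀ ((T.erase a).erase b) : Finset (Eu d)) : Set (Eu d)) := by
    simp only [Filter.eventually_all_finset, Filter.eventually_imp_distrib_left]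
    intro T hT a ha b hb hab
    refine measure_eq_zero_iff_ae_notMem.1 (Measure.addHaar_affineSubspace volume _
      (affineSpan_ne_top_of_card_le (Finset.insert_nonempty _ _)
        ((Finset.card_insert_le _ _).trans ?_)))
    rw [Finset.card_erase_of_mem (Finset.mem_erase.2 ⟨hab.symm, hb⟩),
      Finset.card_erase_of_mem ha, M.card_cell T hT]
    omega
  obtain ⟨y, hy⟩ := hgen.exists
  have hyx : y ≠ x₀ := by
    rintro rfl
    obtain ⟨a, ha, b, hb, hab⟩ := Finset.one_lt_card.1
      (show 1 < (T₀ : Finset (Eu d)).card by rw [(M.isCell T₀).card_eq]; omega)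
    exact hy T₀ T₀.2 a ha b hb hab (subset_affineSpan ℝ _ (by simp))
  set U : Set (Eu d) := ⋃ T ∈ C, hull (T : Finset (Eu d)) with hU
  have hUc : IsCompact U := C.toFinite.isCompact_biUnion fun T _ => isCompact_hull _
  let γ : ℝ → Eu d := fun t => x₀ + t • (y - x₀)
  have hγ : Continuous γ := by fun_prop
  set A : Set ℝ := Set.Ici 0 ∩ γ ⁻¹' U with hA
  have hAc : IsClosed A := isClosed_Ici.inter (hUc.isClosed.preimage hγ)
  have hAb : Bornology.IsBounded A := by
    obtain ⟨R, hR⟩ := hUc.isBounded.subset_closedBall x₀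
    refine (Metric.isBounded_Icc (0 : ℝ) (R / ‖y - x₀‖)).subset fun t ht => ⟨ht.1, ?_⟩
    have h1 := hR ht.2
    have hpos : 0 < ‖y - x₀‖ := norm_pos_iff.2 (sub_ne_zero.2 hyx)
    rw [le_div_iff₀ hpos]
    simpa [γ, norm_smul, abs_of_nonneg (show (0 : ℝ) ≤ t from ht.1)] using h1
  have hx₀U : x₀ ∈ U := Set.mem_biUnion hT₀ (interior_subset hx₀)
  have hAn : A.Nonempty := ⟨0, Set.self_mem_Ici, by simpa [γ] using hx₀U⟩
  -- The last time at which the ray meets the union of the cells in `C`; the union cannot be a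
  -- neighbourhood of that point.
  obtain ⟨t, htA, htmax⟩ := (Metric.isCompact_of_isClosed_isBounded hAc hAb).exists_isGreatest hAn
  have ht0 : 0 ≤ t := htA.1
  have hno : U ∉ nhds (γ t) := by
    intro hnhds
    have h1 : ∀ᶠ s in nhdsWithin t (Set.Ioi t), γ s ∈ U :=
      (hγ.continuousAt.tendsto.mono_left nhdsWithin_le_nhds).eventually hnhds
    obtain ⟨s, hs, hs'⟩ := (h1.and self_mem_nhdsWithin).exists
    have hs'' : t < s := hs'
    exact absurd (htmax ⟨ht0.trans hs''.le, hs⟩) (not_le.2 hs'')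
  have hnot_int : ∀ T ∈ C, γ t ∉ interior (hull (T : Finset (Eu d))) := fun T hT h =>
    hno (Filter.mem_of_superset (mem_interior_iff_mem_nhds.1 h)
      (Set.subset_biUnion_of_mem (u := fun T : M.cells => hull (T : Finset (Eu d))) hT))
  have htne : t ≠ 0 := by
    rintro rfl
    exact hnot_int T₀ hT₀ (by simpa [γ] using hx₀)
  obtain ⟨T, hT, hzT⟩ := Set.mem_iUnion₂.1 htA.2
  have hcell := M.isCell T
  have hz := hcell.mem_hull_iff.1 hzT
  obtain ⟨a, ha, ha0⟩ : ∃ a ∈ (T : Finset (Eu d)), hcell.bc a (γ t) = 0 := by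
    by_contra! hcon
    exact hnot_int T hT (hcell.mem_interior_iff.2 fun v hv => (hz v hv).lt_of_ne (hcon v hv).symm)
  have hpos : ∀ b ∈ (T : Finset (Eu d)), b ≠ a → 0 < hcell.bc b (γ t) := by
    intro b hb hba
    -- A second vanishing coordinate would put `γ t` on the simplex without `a` and `b`, and then
    -- the line through `x₀` and `γ t` would carry `y` into an excluded affine span.
    refine (hz b hb).lt_of_ne fun hb0 => ?_
    have hmem : γ t ∈ hull (((T : Finset (Eu d)).erase a).erase b) := by
      rw [hcell.mem_hull_subset_iff ((Finset.erase_subset _ _).trans (Finset.erase_subset _ _))]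
      refine ⟨fun v hv => hz v (Finset.mem_of_mem_erase (Finset.mem_of_mem_erase hv)),
        fun v hv hv' => ?_⟩
      by_cases hvb : v = b
      · rw [hvb, ← hb0]
      · by_cases hva : v = a
        · rw [hva, ha0]
        · exact absurd (Finset.mem_erase.2 ⟨hvb, Finset.mem_erase.2 ⟨hva, hv⟩⟩) hv'
    refine hy T T.2 a ha b hb hba.symm ?_
    set G : Finset (Eu d) := insert x₀ (((T : Finset (Eu d)).erase a).erase b)
    have h1 : γ t ∈ affineSpan ℝ (G : Set (Eu d)) :=
      convexHull_subset_affineSpan _ (hull_mono (Finset.subset_insert _ _) hmem)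
    have h2 : x₀ ∈ affineSpan ℝ (G : Set (Eu d)) := subset_affineSpan ℝ _ (by simp [G])
    have h3 := AffineMap.lineMap_mem t⁻¹ h2 h1
    have h4 : AffineMap.lineMap x₀ (γ t) t⁻¹ = y := by
      simp [AffineMap.lineMap_apply, γ, smul_smul, htne]
    rwa [h4] at h3
  obtain ⟨F, hFT, hF⟩ := M.exists_face_erase T ha
  obtain ⟨S, hS, hST, hFS⟩ := H T hT F hFT
  have hFn := M.face_nonempty hd F
  have hrel : γ t ∈ relInt (F : Finset (Eu d)) := by
    rw [hcell.mem_relInt_iff (M.mem_facesOf.1 hFT), hF]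
    refine ⟨fun v hv => hpos v (Finset.mem_of_mem_erase hv) (Finset.ne_of_mem_erase hv),
      fun v hv hv' => ?_⟩
    by_cases hva : v = a
    · rw [hva, ha0]
    · exact absurd (Finset.mem_erase.2 ⟨hva, hv⟩) hv'
  obtain ⟨v, hv⟩ := M.exists_isFace hFT
  obtain ⟨v', hv'⟩ := M.exists_isFace hFS
  -- Near `γ t` the cells `T` and `S` fill the two opposite half-spaces, so their union is a
  -- neighbourhood after all.
  apply hno
  filter_upwards [hv.eventually_mem_hull_iff hcell hFn hrel,
    hv'.eventually_mem_hull_iff (M.isCell S) hFn hrel] with x h1 h2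
  rw [M.outwardNormal_eq_neg hd hST hFS hFT, inner_neg_right, neg_nonpos] at h2
  rcases le_total (inner ℝ (x - γ t) (outwardNormal (T : Finset (Eu d)) F)) 0 with h | h
  · exact Set.mem_biUnion hT (h1.1.2 h)
  · exact Set.mem_biUnion hS (h2.1.2 h)

/-! ### Normal continuity of discrete velocities -/

lemma glue_inner (u : M.cells → Eu d → Eu d) (φ : Eu d → ℝ) (x : Eu d) :
    inner ℝ (M.glue u x) (gradient φ x) = ∑ T : M.cells,
      (hull (T : Finset (Eu d))).indicator (fun y => fderiv ℝ φ y (u T y)) x := by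
  rw [glue, sum_inner]
  refine Finset.sum_congr rfl fun T _ => ?_
  by_cases hx : x ∈ hull (T : Finset (Eu d))
  · rw [Set.indicator_of_mem hx, Set.indicator_of_mem hx, inner_gradient_eq_fderiv]
  · rw [Set.indicator_of_notMem hx, Set.indicator_of_notMem hx, inner_zero_left]

/-- `glue` is a sum of indicators, so linearity splits the integral without any disjointness; each
cell lies in `Ω` up to a null set. -/
lemma integral_glue {k : ℕ} {u : M.cells → Eu d → Eu d} (hu : ∀ T, u T ∈ vecPoly d k)
    {φ : Eu d → ℝ} (hφ : ContDiff ℝ ∞ φ) :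
    ∫ x in Ω, inner ℝ (M.glue u x) (gradient φ x) =
      ∑ T : M.cells, ∫ x in hull (T : Finset (Eu d)), fderiv ℝ φ x (u T x) := by
  have hφ' := hφ.continuous_fderiv (by simp)
  have hc : ∀ T, Continuous fun x => fderiv ℝ φ x (u T x) := fun T => by
    have := continuous_of_mem_vecPoly (hu T)
    fun_prop
  have hm : ∀ T : M.cells, MeasurableSet (hull (T : Finset (Eu d))) := fun T =>
    (isClosed_hull _).measurableSet
  simp_rw [M.glue_inner]
  rw [integral_finsetSum _ fun T _ => (((integrable_indicator_iff (hm T)).2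
    ((hc T).continuousOn.integrableOn_compact (isCompact_hull _))).integrableOn)]
  refine Finset.sum_congr rfl fun T _ => ?_
  rw [setIntegral_indicator (hm T)]
  refine setIntegral_congr_set ?_
  filter_upwards [M.hull_ae_le_domain T] with x hx
  exact propext ⟨fun h => h.2, fun h => ⟨hx h, h⟩⟩

/-- The weak divergence of a discrete velocity is its piecewise divergence. -/
lemma sum_integral_divMul {k : ℕ} {u : M.cells → Eu d → Eu d} (hu : u ∈ M.Vh k)
    {φ : Eu d → ℝ} (hφ : ContDiff ℝ ∞ φ) (hs : HasCompactSupport φ) :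
    ∑ T : M.cells, ∫ x in hull (T : Finset (Eu d)), divMul φ (u T) x = 0 := by
  obtain ⟨hp, -, q, hq, H⟩ := hu
  have hsm : ∀ T, ContDiff ℝ ∞ (u T) := fun T => contDiff_of_mem_vecPoly (hp T)
  have : IsFiniteMeasure (volume.restrict Ω) := ⟨by simpa using M.volume_domain_lt_top⟩
  have hqi : IntegrableOn q Ω := hq.integrable (by norm_num)
  have hqφ : ∀ ψ : Eu d → ℝ, ContDiff ℝ ∞ ψ → HasCompactSupport ψ →
      IntegrableOn (fun x => q x * ψ x) Ω := fun ψ h1 h2 =>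
    hq.integrable_mul ((h1.continuous.memLp_of_hasCompactSupport (p := 2) (μ := volume) h2).restrict Ω)
  -- The weak divergence is identified by test functions supported inside one cell, for which the
  -- other cells drop out and `integral_divMul` applies.
  have hae : ∀ T : M.cells, ∀ᵐ x ∂volume, x ∈ interior (hull (T : Finset (Eu d))) →
      q x - divergence (u T) x = 0 := by
    intro T
    have hcd := continuous_divergence (hsm T)
    refine isOpen_interior.ae_eq_zero_of_integral_contDiff_smul_eq_zero ?_ fun ψ h1 h2 h3 => ?_
    · exact ((hqi.mono_set (M.interior_hull_subset T)).locallyIntegrableOn).sub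
        (hcd.locallyIntegrable.locallyIntegrableOn _)
    · have e1 : ∀ x, x ∉ interior (hull (T : Finset (Eu d))) → ψ x = 0 := fun x hx =>
        image_eq_zero_of_notMem_tsupport fun h => hx (h3 h)
      have e1' : ∀ x, x ∉ interior (hull (T : Finset (Eu d))) → fderiv ℝ ψ x = 0 := fun x hx =>
        fderiv_of_notMem_tsupport (𝕜 := ℝ) fun h => hx (h3 h)
      have e2 : ∫ x in Ω, q x * ψ x = ∫ x, q x * ψ x :=
        setIntegral_eq_integral_of_forall_compl_eq_zero fun x hx => by
          rw [e1 x fun h => hx (M.interior_hull_subset T h), mul_zero]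
      have e3 := H ψ h1 h2
      rw [M.integral_glue hp h1, Finset.sum_eq_single_of_mem T (Finset.mem_univ T), e2] at e3
      · have e4 : ∫ x in hull (T : Finset (Eu d)), fderiv ℝ ψ x (u T x)
            = ∫ x, fderiv ℝ ψ x (u T x) :=
          setIntegral_eq_integral_of_forall_compl_eq_zero fun x hx => by
            rw [e1' x fun h => hx (interior_subset h)]; rfl
        have hψ' := h1.continuous_fderiv (by simp)
        have hψc := h1.continuous
        have huc := (hsm T).continuous
        have i1 : Integrable fun x => ψ x * divergence (u T) x :=
          Continuous.integrable_of_hasCompactSupport (by fun_prop) h2.mul_right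
        have i2 : Integrable fun x => fderiv ℝ ψ x (u T x) := by
          refine Continuous.integrable_of_hasCompactSupport (by fun_prop)
            (HasCompactSupport.intro h2 fun x hx => ?_)
          rw [fderiv_of_notMem_tsupport (𝕜 := ℝ) hx]; rfl
        have i3 : Integrable fun x => q x * ψ x := by
          have := (integrable_indicator_iff M.isOpen_domain.measurableSet).2 (hqφ ψ h1 h2)
          refine this.congr (Filter.Eventually.of_forall fun x => ?_)
          by_cases hx : x ∈ Ω
          · exact Set.indicator_of_mem hx _
          · simp only [Set.indicator_of_notMem hx]
            rw [e1 x fun h => hx (M.interior_hull_subset T h), mul_zero]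
        have e5 := integral_divMul h1 h2 (hsm T)
        simp only [divMul] at e5
        rw [integral_add i1 i2] at e5
        rw [e4] at e3
        have e6 : ∀ x, ψ x • (q x - divergence (u T) x) =
            q x * ψ x - ψ x * divergence (u T) x := fun x => by
          rw [smul_eq_mul]; ring
        simp_rw [e6]
        rw [integral_sub i3 i1]
        linarith
      · intro S _ hST
        refine setIntegral_eq_zero_of_forall_eq_zero fun x hx => ?_
        rw [e1' x fun h => Set.disjoint_left.1 (M.disjoint_hull_interior hST) hx h]; rfl
  have e1 := H φ hφ hs
  rw [M.integral_glue hp hφ, M.setIntegral_domain (hqφ φ hφ hs), ← Finset.sum_neg_distrib,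
    ← sub_eq_zero, ← Finset.sum_sub_distrib] at e1
  rw [← e1]
  refine Finset.sum_congr rfl fun T _ => ?_
  have hφ' := hφ.continuous_fderiv (by simp)
  have hφc := hφ.continuous
  have huc := (hsm T).continuous
  have hcd := continuous_divergence (hsm T)
  have i1 : IntegrableOn (fun x => φ x * divergence (u T) x) (hull (T : Finset (Eu d))) :=
    ContinuousOn.integrableOn_compact (isCompact_hull _) (by fun_prop)
  have i2 : IntegrableOn (fun x => fderiv ℝ φ x (u T x)) (hull (T : Finset (Eu d))) :=
    ContinuousOn.integrableOn_compact (isCompact_hull _) (by fun_prop)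
  simp only [divMul]
  rw [integral_add i1 i2, sub_neg_eq_add, add_comm]
  congr 1
  rw [setIntegral_congr_set (hull_ae_eq_interior _), setIntegral_congr_set (hull_ae_eq_interior _)]
  refine setIntegral_congr_ae isOpen_interior.measurableSet ?_
  filter_upwards [hae T] with x hx hxT
  rw [sub_eq_zero.1 (hx hxT), mul_comm]

/-- Test functions supported near `x₀` see only the cells that share `F`, each of which is a
half-space there. The identity of `sum_integral_divMul` then has the form required by
`inner_eq_zero_of_halfSpace`. -/
lemma inner_outwardNormal_relInt {k : ℕ} (hd : 1 ≤ d) {u : M.cells → Eu d → Eu d}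
    (hu : u ∈ M.Vh k) {T : M.cells} {F : M.faces} (hT : F ∈ M.facesOf T) {x₀ : Eu d}
    (hx₀ : x₀ ∈ relInt (F : Finset (Eu d))) :
    (∀ S : M.cells, S ≠ T → F ∈ M.facesOf S →
      inner ℝ (u T x₀ - u S x₀) (outwardNormal (T : Finset (Eu d)) F) = 0) ∧
    ((∀ S : M.cells, F ∈ M.facesOf S → S = T) →
      inner ℝ (u T x₀) (outwardNormal (T : Finset (Eu d)) F) = 0) := by
  have hFn := M.face_nonempty hd F
  have hsm : ∀ T, ContDiff ℝ ∞ (u T) := fun T => contDiff_of_mem_vecPoly (hu.1 T)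
  set n := outwardNormal (T : Finset (Eu d)) F with hn
  set H : Set (Eu d) := {x | inner ℝ (x - x₀) n ≤ 0} with hH
  have hHm : MeasurableSet H := (isClosed_le (by fun_prop) continuous_const).measurableSet
  obtain ⟨v, hv⟩ := M.exists_isFace hT
  have hmain : ∀ φ : Eu d → ℝ, ∀ r, tsupport φ ⊆ Metric.ball x₀ r →
      (∀ x ∈ Metric.ball x₀ r, x ∈ hull (T : Finset (Eu d)) ↔ inner ℝ (x - x₀) n ≤ 0) →
      ∫ x in hull (T : Finset (Eu d)), divMul φ (u T) x = ∫ x in H, divMul φ (u T) x := by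
    intro φ r h1 h2
    rw [← integral_indicator (isClosed_hull _).measurableSet, ← integral_indicator hHm]
    congr 1
    ext x
    by_cases hx : x ∈ tsupport φ
    · by_cases hxT : x ∈ hull (T : Finset (Eu d))
      · rw [Set.indicator_of_mem hxT, Set.indicator_of_mem (show x ∈ H from (h2 x (h1 hx)).1 hxT)]
      · rw [Set.indicator_of_notMem hxT,
          Set.indicator_of_notMem (show x ∉ H from fun h => hxT ((h2 x (h1 hx)).2 h))]
    · rw [Set.indicator_apply_eq_zero.2 fun _ => divMul_eq_zero_of_notMem_tsupport _ hx,
        Set.indicator_apply_eq_zero.2 fun _ => divMul_eq_zero_of_notMem_tsupport _ hx]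
  constructor
  · intro S hST hS
    obtain ⟨v', hv'⟩ := M.exists_isFace hS
    obtain ⟨r, hr, hball⟩ := Metric.eventually_nhds_iff_ball.1
      (((hv.eventually_mem_hull_iff (M.isCell T) hFn hx₀).and
        (hv'.eventually_mem_hull_iff (M.isCell S) hFn hx₀)).and (M.eventually_notMem_hull hT hx₀))
    refine inner_eq_zero_of_halfSpace (w := u T - u S) hr ((hsm T).sub (hsm S))
      fun φ hφ hs hsupp => ?_
    have h1 := M.sum_integral_divMul hu hφ hs
    rw [Finset.sum_eq_add_of_mem T S (Finset.mem_univ _) (Finset.mem_univ _) hST.symm,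
      hmain φ r hsupp fun x hx => (hball x hx).1.1.1] at h1
    · have h2 : ∫ x in hull (S : Finset (Eu d)), divMul φ (u S) x
          = ∫ x in Hᶜ, divMul φ (u S) x := by
        rw [setIntegral_congr_set (hull_ae_eq_interior _),
          ← integral_indicator isOpen_interior.measurableSet, ← integral_indicator hHm.compl]
        congr 1
        ext x
        by_cases hx : x ∈ tsupport φ
        · have h3 := (hball x (hsupp hx)).1.2.2
          rw [M.outwardNormal_eq_neg hd hST hS hT, inner_neg_right, neg_lt_zero] at h3
          have h4 : x ∈ Hᶜ ↔ 0 < inner ℝ (x - x₀) n := by simp [hH]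
          by_cases hxS : x ∈ interior (hull (S : Finset (Eu d)))
          · rw [Set.indicator_of_mem hxS, Set.indicator_of_mem (h4.2 (h3.1 hxS))]
          · rw [Set.indicator_of_notMem hxS,
              Set.indicator_of_notMem fun h => hxS (h3.2 (h4.1 h))]
        · rw [Set.indicator_apply_eq_zero.2 fun _ => divMul_eq_zero_of_notMem_tsupport _ hx,
            Set.indicator_apply_eq_zero.2 fun _ => divMul_eq_zero_of_notMem_tsupport _ hx]
      -- The integral of `div(φ u_S)` over the whole space is zero, so the contribution from the far
      -- side is minus the one over `H`. This leaves the field `u T - u S` on a single half-space.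
      have h5 := integral_add_compl hHm (integrable_divMul hφ hs (hsm S))
      rw [integral_divMul hφ hs (hsm S)] at h5
      simp_rw [divMul_sub φ ((hsm T).differentiable (by simp)) ((hsm S).differentiable (by simp))]
      rw [integral_sub (integrable_divMul hφ hs (hsm T)).integrableOn
        (integrable_divMul hφ hs (hsm S)).integrableOn]
      linarith
    · intro S' _ hne
      refine setIntegral_eq_zero_of_forall_eq_zero fun x hx =>
        divMul_eq_zero_of_notMem_tsupport _ fun hx' => ?_
      exact (hball x (hsupp hx')).2 S' (fun h => hne.2
        (M.eq_of_ne_of_ne hd hT h hS hne.1 hST)) hx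
  · intro hone
    obtain ⟨r, hr, hball⟩ := Metric.eventually_nhds_iff_ball.1
      ((hv.eventually_mem_hull_iff (M.isCell T) hFn hx₀).and (M.eventually_notMem_hull hT hx₀))
    refine inner_eq_zero_of_halfSpace hr (hsm T) fun φ hφ hs hsupp => ?_
    have h1 := M.sum_integral_divMul hu hφ hs
    rwa [Finset.sum_eq_single_of_mem T (Finset.mem_univ T),
      hmain φ r hsupp fun x hx => (hball x hx).1.1] at h1
    intro S _ hne
    refine setIntegral_eq_zero_of_forall_eq_zero fun x hx =>
      divMul_eq_zero_of_notMem_tsupport _ fun hx' => ?_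
    exact (hball x (hsupp hx')).2 S (fun h => hne (hone S h)) hx

/-- The normal component of a discrete velocity is continuous across faces. -/
lemma inner_outwardNormal_eq_neg {k : ℕ} (hd : 1 ≤ d) {u : M.cells → Eu d → Eu d}
    (hu : u ∈ M.Vh k) {S T : M.cells} {F : M.faces} (hne : S ≠ T) (hS : F ∈ M.facesOf S)
    (hT : F ∈ M.facesOf T) {x : Eu d} (hx : x ∈ hull (F : Finset (Eu d))) :
    inner ℝ (u S x) (outwardNormal (S : Finset (Eu d)) F) =
      -inner ℝ (u T x) (outwardNormal (T : Finset (Eu d)) F) := by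
  have h1 := continuous_of_mem_vecPoly (hu.1 S)
  have h2 := continuous_of_mem_vecPoly (hu.1 T)
  have hEq : Set.EqOn (fun x => inner ℝ (u S x) (outwardNormal (S : Finset (Eu d)) F))
      (fun x => -inner ℝ (u T x) (outwardNormal (T : Finset (Eu d)) F))
      (relInt (F : Finset (Eu d))) := by
    intro y hy
    have h3 := (M.inner_outwardNormal_relInt hd hu hT hy).1 S hne hS
    rw [inner_sub_left, sub_eq_zero] at h3
    simp only [M.outwardNormal_eq_neg hd hne hS hT, inner_neg_right, h3]
  exact hEq.closure (by fun_prop) (by fun_prop)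
    (hull_subset_closure_relInt (M.face_nonempty hd F) hx)

/-- The normal component of a discrete velocity vanishes on boundary faces. -/
lemma inner_outwardNormal_eq_zero {k : ℕ} (hd : 1 ≤ d) {u : M.cells → Eu d → Eu d}
    (hu : u ∈ M.Vh k) {T : M.cells} {F : M.faces} (hT : F ∈ M.facesOf T)
    (hone : ∀ S : M.cells, F ∈ M.facesOf S → S = T) {x : Eu d}
    (hx : x ∈ hull (F : Finset (Eu d))) :
    inner ℝ (u T x) (outwardNormal (T : Finset (Eu d)) F) = 0 := by
  have h2 := continuous_of_mem_vecPoly (hu.1 T)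
  have hEq : Set.EqOn (fun x => inner ℝ (u T x) (outwardNormal (T : Finset (Eu d)) F))
      (fun _ => 0) (relInt (F : Finset (Eu d))) := fun y hy =>
    (M.inner_outwardNormal_relInt hd hu hT hy).2 hone
  exact hEq.closure (by fun_prop) continuous_const
    (hull_subset_closure_relInt (M.face_nonempty hd F) hx)

end Mesh

/-! ### M-matrices -/

section MMatrix

variable {ι : Type*} [Fintype ι] {A : Matrix ι ι ℝ}

open Matrix

/-- A matrix with non-positive off-diagonal entries and positive column sums is inverse positive. -/
lemma nonneg_of_mulVec_nonneg (hoff : ∀ i j, i ≠ j → A i j ≤ 0) (hcol : ∀ j, 0 < ∑ i, A i j)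
    {x : ι → ℝ} (hx : ∀ i, 0 ≤ (A *ᵥ x) i) (i : ι) : 0 ≤ x i := by
  classical
  by_contra! hi
  -- The rows with negative `x i` are added up. For `j ∈ I` the partial column sum omits only
  -- non-positive entries, so it stays positive and multiplies a negative `x j`; for `j ∉ I` it
  -- contains only off-diagonal entries and multiplies `x j ≥ 0`. The total is negative, against the
  -- assumption.
  set I : Finset ι := Finset.univ.filter fun i => x i < 0 with hI
  have hmem : ∀ j, j ∈ I ↔ x j < 0 := fun j => by simp [hI]
  have h1 : 0 ≤ ∑ i ∈ I, (A *ᵥ x) i := Finset.sum_nonneg fun i _ => hx i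
  have h2 : ∑ i ∈ I, (A *ᵥ x) i = ∑ j, (∑ i ∈ I, A i j) * x j := by
    simp only [mulVec, dotProduct, Finset.sum_mul]
    exact Finset.sum_comm
  have hin : ∀ j ∈ I, 0 < ∑ i ∈ I, A i j := fun j hj => by
    refine (hcol j).trans_le ?_
    rw [← Finset.sum_add_sum_compl I]
    have : ∑ i ∈ Iᶜ, A i j ≤ 0 := Finset.sum_nonpos fun i hi =>
      hoff i j (by rintro rfl; exact (Finset.mem_compl.1 hi) hj)
    linarith
  have h3 : ∑ j, (∑ i ∈ I, A i j) * x j < 0 := by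
    refine Finset.sum_neg' (fun j _ => ?_) ⟨i, Finset.mem_univ i, ?_⟩
    · by_cases hj : j ∈ I
      · exact (mul_neg_of_pos_of_neg (hin j hj) ((hmem j).1 hj)).le
      · refine mul_nonpos_of_nonpos_of_nonneg (Finset.sum_nonpos fun i hi => ?_)
          (not_lt.1 fun h => hj ((hmem j).2 h))
        exact hoff i j (by rintro rfl; exact hj hi)
    · exact mul_neg_of_pos_of_neg (hin i ((hmem i).2 hi)) hi
  linarith

/-- Inverse positivity applied to both `x - y` and `y - x`. -/
lemma mulVec_injective_of_colSum_pos (hoff : ∀ i j, i ≠ j → A i j ≤ 0)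
    (hcol : ∀ j, 0 < ∑ i, A i j) : Function.Injective A.mulVec := by
  intro x y hxy
  have h0 : A *ᵥ (x - y) = 0 := by rw [mulVec_sub]; exact sub_eq_zero.2 hxy
  have h0' : A *ᵥ (y - x) = 0 := by rw [mulVec_sub]; exact sub_eq_zero.2 hxy.symm
  ext i
  have h1 := nonneg_of_mulVec_nonneg hoff hcol (x := x - y) (fun i => by rw [h0]; simp) i
  have h2 := nonneg_of_mulVec_nonneg hoff hcol (x := y - x) (fun i => by rw [h0']; simp) i
  simp only [Pi.sub_apply] at h1 h2
  linarith

/-- Each column of the inverse is mapped to a unit vector, which is non-negative, so the column is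
non-negative too. -/
lemma isMMatrix_of_colSum_pos (hoff : ∀ i j, i ≠ j → A i j ≤ 0)
    (hcol : ∀ j, 0 < ∑ i, A i j) : IsMMatrix A := by
  classical
  have hu : IsUnit A := mulVec_injective_iff_isUnit.1 (mulVec_injective_of_colSum_pos hoff hcol)
  have hdet : IsUnit A.det := (isUnit_iff_isUnit_det A).1 hu
  have h1 : A * A⁻¹ = 1 := mul_nonsing_inv A hdet
  refine ⟨hoff, A⁻¹, ?_, ?_, fun i j => ?_⟩
  · convert h1
  · convert nonsing_inv_mul A hdet
  · refine nonneg_of_mulVec_nonneg hoff hcol (x := fun i => A⁻¹ i j) (fun i => ?_) i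
    have h2 : (A *ᵥ fun i => A⁻¹ i j) i = (A * A⁻¹) i j := rfl
    rw [h2, h1, one_apply]
    split_ifs <;> norm_num

/-- Given `x ≥ 0`, a zero entry `x i` would leave only non-positive terms in row `i`. -/
lemma pos_of_mulVec_pos (hoff : ∀ i j, i ≠ j → A i j ≤ 0) (hcol : ∀ j, 0 < ∑ i, A i j)
    {x : ι → ℝ} (hx : ∀ i, 0 < (A *ᵥ x) i) (i : ι) : 0 < x i := by
  classical
  have h0 := nonneg_of_mulVec_nonneg hoff hcol fun i => (hx i).le
  refine (h0 i).lt_of_ne fun hi => ?_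
  have h1 : (A *ᵥ x) i ≤ 0 := Finset.sum_nonpos fun j _ => by
    by_cases hij : i = j
    · rw [← hij, ← hi, mul_zero]
    · exact mul_nonpos_of_nonpos_of_nonneg (hoff i j hij) (h0 j)
  exact absurd (hx i) (not_lt.2 h1)

end MMatrix

namespace Mesh

variable {d : ℕ} {Ω : Set (Eu d)} (M : Mesh d Ω)

/-! ### The lowest order density update -/

/-- The flux through the face `F` out of the cell `T`. -/
def fluxOut (rule : UpwindRule) (u : M.cells → Eu d → Eu d) (T : M.cells) (F : M.faces) : ℝ :=
  let n := outwardNormal (T : Finset (Eu d)) F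
  match rule with
  | .pointwise => ∫ x in hull (F : Finset (Eu d)), max (inner ℝ (u T x) n) 0 ∂μHE[d - 1]
  | .facewise => max (∫ x in hull (F : Finset (Eu d)), inner ℝ (u T x) n ∂μHE[d - 1]) 0

/-- The (non-positive) flux through the face `F` into the cell `T`. -/
def fluxIn (rule : UpwindRule) (u : M.cells → Eu d → Eu d) (T : M.cells) (F : M.faces) : ℝ :=
  let n := outwardNormal (T : Finset (Eu d)) F
  match rule with
  | .pointwise => ∫ x in hull (F : Finset (Eu d)), min (inner ℝ (u T x) n) 0 ∂μHE[d - 1]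
  | .facewise => min (∫ x in hull (F : Finset (Eu d)), inner ℝ (u T x) n ∂μHE[d - 1]) 0

lemma fluxIn_nonpos (rule : UpwindRule) (u : M.cells → Eu d → Eu d) (T : M.cells)
    (F : M.faces) : M.fluxIn rule u T F ≤ 0 := by
  cases rule
  · exact integral_nonpos fun x => min_le_right _ _
  · exact min_le_right _ _

/-- The normal velocity changes sign with the side of the face, and `max (-a) 0 = -min a 0`. -/
lemma fluxOut_eq_neg_fluxIn {k : ℕ} (hd : 1 ≤ d) (rule : UpwindRule) {u : M.cells → Eu d → Eu d}
    (hu : u ∈ M.Vh k) {S T : M.cells} {F : M.faces} (hne : S ≠ T) (hS : F ∈ M.facesOf S)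
    (hT : F ∈ M.facesOf T) : M.fluxOut rule u S F = -M.fluxIn rule u T F := by
  have hm : MeasurableSet (hull (F : Finset (Eu d))) := (isClosed_hull _).measurableSet
  have key := fun x hx => M.inner_outwardNormal_eq_neg hd hu hne hS hT (x := x) hx
  cases rule
  · simp only [fluxOut, fluxIn]
    rw [← integral_neg]
    refine setIntegral_congr_fun hm fun x hx => ?_
    simp only [key x hx, ← max_neg_neg, neg_zero]
  · simp only [fluxOut, fluxIn]
    rw [setIntegral_congr_fun hm key, integral_neg, ← max_neg_neg, neg_zero]

lemma flux_eq_zero {k : ℕ} (hd : 1 ≤ d) (rule : UpwindRule) {u : M.cells → Eu d → Eu d}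
    (hu : u ∈ M.Vh k) {T : M.cells} {F : M.faces} (hT : F ∈ M.facesOf T)
    (hone : ∀ S : M.cells, F ∈ M.facesOf S → S = T) :
    M.fluxOut rule u T F = 0 ∧ M.fluxIn rule u T F = 0 := by
  have hm : MeasurableSet (hull (F : Finset (Eu d))) := (isClosed_hull _).measurableSet
  have key := fun x hx => M.inner_outwardNormal_eq_zero hd hu hT hone (x := x) hx
  cases rule
  · simp only [fluxOut, fluxIn]
    constructor <;>
    · refine setIntegral_eq_zero_of_forall_eq_zero fun x hx => ?_
      simp [key x hx]
  · simp only [fluxOut, fluxIn]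
    rw [setIntegral_congr_fun hm key]
    simp

/-- The cell across the face `F` of `T`, and `T` itself on boundary faces. -/
def neighbour (T : M.cells) (F : M.faces) : M.cells :=
  open Classical in if h : ∃ S : M.cells, S ≠ T ∧ F ∈ M.facesOf S then h.choose else T

lemma outerValue_eq_neighbour (ρ : M.cells → Eu d → ℝ) (T : M.cells) (F : M.faces) (x : Eu d) :
    M.outerValue ρ T F x = ρ (M.neighbour T F) x := by
  unfold outerValue neighbour
  split_ifs <;> rfl

lemma neighbour_eq (hd : 1 ≤ d) {S T : M.cells} {F : M.faces}
    (hne : S ≠ T) (hS : F ∈ M.facesOf S) (hT : F ∈ M.facesOf T) : M.neighbour T F = S := by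
  have h : ∃ S : M.cells, S ≠ T ∧ F ∈ M.facesOf S := ⟨S, hne, hS⟩
  rw [neighbour, dif_pos h,
    M.eq_of_ne_of_ne hd hT hS h.choose_spec.2 hne h.choose_spec.1]

/-- The upwind flux of a piecewise constant density. -/
lemma integral_upwind {k : ℕ} (hd : 2 ≤ d) (rule : UpwindRule) {u : M.cells → Eu d → Eu d}
    (hu : ∀ T, u T ∈ vecPoly d k) (r : M.cells → ℝ) {T : M.cells} {F : M.faces}
    (hT : F ∈ M.facesOf T) (m : ℝ) :
    ∫ x in hull (F : Finset (Eu d)), inner ℝ (u T x) (outwardNormal (T : Finset (Eu d)) F) *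
      M.upwind rule (fun T _ => r T) u T F x * m ∂μHE[d - 1] =
    m * (r T * M.fluxOut rule u T F + r (M.neighbour T F) * M.fluxIn rule u T F) := by
  set n := outwardNormal (T : Finset (Eu d)) F with hn
  have hc := continuous_of_mem_vecPoly (hu T)
  rw [integral_mul_const, mul_comm m]
  congr 1
  cases rule
  · have h_integrable : ∀ f : Eu d → ℝ, Continuous f →
        IntegrableOn f (hull (F : Finset (Eu d))) (μHE[d - 1] : Measure (Eu d)) := fun f hf =>
      (M.isCell T).integrableOn_face (M.mem_facesOf.1 hT) (M.card_face F) hd hf.continuousOn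
    simp only [fluxOut, fluxIn]
    rw [← integral_const_mul, ← integral_const_mul,
      ← integral_add ((h_integrable _ (by fun_prop)).const_mul _) ((h_integrable _ (by fun_prop)).const_mul _)]
    congr 1
    ext x
    simp only [upwind, upwindSign, outerValue_eq_neighbour, ← hn]
    -- Where there is no flow the mean value is multiplied by zero, so its choice has no effect.
    split_ifs with h1 h2
    · rw [max_eq_left h1.le, min_eq_right h1.le]; ring
    · rw [max_eq_right h2.le, min_eq_left h2.le]; ring
    · rw [le_antisymm (not_lt.1 h1) (not_lt.1 h2)]; simp
  · simp only [fluxOut, fluxIn]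
    simp only [upwind, upwindSign, outerValue_eq_neighbour, ← hn]
    -- Under the facewise rule the upwind value is constant on the face and leaves the integral.
    rw [integral_mul_const]
    set a := ∫ x in hull (F : Finset (Eu d)), inner ℝ (u T x) n ∂μHE[d - 1]
    split_ifs with h1 h2
    · rw [max_eq_left h1.le, min_eq_right h1.le]; ring
    · rw [max_eq_right h2.le, min_eq_left h2.le]; ring
    · rw [le_antisymm (not_lt.1 h1) (not_lt.1 h2)]; simp

/-- The discrete upwind divergence of a piecewise constant density. -/
def upwindDiv (rule : UpwindRule) (u : M.cells → Eu d → Eu d) :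
    (M.cells → ℝ) →ₗ[ℝ] (M.cells → ℝ) where
  toFun r T := ∑ F ∈ M.facesOf T,
    (r T * M.fluxOut rule u T F + r (M.neighbour T F) * M.fluxIn rule u T F)
  map_add' r s := by
    ext T
    simp only [Pi.add_apply, ← Finset.sum_add_distrib]
    exact Finset.sum_congr rfl fun F _ => by ring
  map_smul' c r := by
    ext T
    simp only [Pi.smul_apply, smul_eq_mul, RingHom.id_apply, Finset.mul_sum]
    exact Finset.sum_congr rfl fun F _ => by ring

/-- The volume term vanishes because the test function has zero gradient on each cell; only face
fluxes remain. -/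
lemma ch_const {k : ℕ} (hd : 2 ≤ d) (rule : UpwindRule) {u : M.cells → Eu d → Eu d}
    (hu : ∀ T, u T ∈ vecPoly d k) (r m : M.cells → ℝ) :
    M.ch rule (fun T _ => r T) u (fun T _ => m T) = ∑ T, m T * M.upwindDiv rule u r T := by
  have h1 : ∀ T x, gradient (fun _ : Eu d => m T) x = 0 := fun T x => gradient_const x (m T)
  simp only [ch, h1, inner_zero_right, integral_zero, Finset.sum_const_zero, neg_zero, zero_add]
  refine Finset.sum_congr rfl fun T _ => ?_
  change _ = m T * ∑ F ∈ M.facesOf T, _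
  rw [Finset.mul_sum]
  exact Finset.sum_congr rfl fun F hF => M.integral_upwind hd rule hu r hF (m T)

/-- Conservation: the total upwind flux vanishes. -/
lemma sum_upwindDiv {k : ℕ} (hd : 1 ≤ d) (rule : UpwindRule) {u : M.cells → Eu d → Eu d}
    (hu : u ∈ M.Vh k) (r : M.cells → ℝ) : ∑ T, M.upwindDiv rule u r T = 0 := by
  classical
  change ∑ T : M.cells, ∑ F ∈ M.facesOf T,
    (r T * M.fluxOut rule u T F + r (M.neighbour T F) * M.fluxIn rule u T F) = 0
  -- The fluxes are regrouped by faces: boundary faces carry none, and on an interior face the terms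
  -- of its two cells cancel.
  rw [Finset.sum_comm' (t' := Finset.univ)
    (s' := fun F => Finset.univ.filter fun T => F ∈ M.facesOf T) (by simp)]
  refine Finset.sum_eq_zero fun F _ => ?_
  obtain ⟨T, hT⟩ := M.exists_cell F
  by_cases hone : ∀ S : M.cells, F ∈ M.facesOf S → S = T
  · rw [Finset.sum_eq_single_of_mem T (by simpa using hT)]
    · obtain ⟨h1, h2⟩ := M.flux_eq_zero hd rule hu hT hone
      rw [h1, h2]; ring
    · intro S hS hne
      exact absurd (hone S (by simpa using hS)) hne
  · push Not at hone
    obtain ⟨S, hS, hne⟩ := hone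
    rw [Finset.sum_eq_add_of_mem T S (by simpa using hT) (by simpa using hS) hne.symm]
    · rw [M.neighbour_eq hd hne hS hT, M.neighbour_eq hd hne.symm hT hS,
        M.fluxOut_eq_neg_fluxIn hd rule hu hne hS hT,
        M.fluxOut_eq_neg_fluxIn hd rule hu hne.symm hT hS]
      ring
    · intro S' hS' h
      exact absurd (M.eq_of_ne_of_ne hd hT (by simpa using hS') hS h.1 hne) h.2

/-- The volume of a cell. -/
def cellVolume (T : M.cells) : ℝ := volume.real (hull (T : Finset (Eu d)))

lemma cellVolume_pos (T : M.cells) : 0 < M.cellVolume T := by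
  refine ENNReal.toReal_pos ?_ (isCompact_hull _).measure_lt_top.ne
  exact (Measure.measure_pos_of_nonempty_interior volume (M.isCell T).interior_nonempty).ne'

lemma ip_const (r m : M.cells → ℝ) :
    M.ip (fun T _ => r T) (fun T _ => m T) = ∑ T, m T * (M.cellVolume T * r T) := by
  refine Finset.sum_congr rfl fun T _ => ?_
  simp only [integral_const, MeasurableSet.univ, measureReal_restrict_apply, Set.univ_inter,
    smul_eq_mul, cellVolume]
  ring

open Matrix in
lemma densityMatrix_mulVec {k : ℕ} (hd : 2 ≤ d) (rule : UpwindRule) (τ : ℝ)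
    {u : M.cells → Eu d → Eu d} (hu : ∀ T, u T ∈ vecPoly d k) (r : M.cells → ℝ) (T : M.cells) :
    (M.densityMatrix rule τ u *ᵥ r) T =
      τ⁻¹ * (M.cellVolume T * r T) + M.upwindDiv rule u r T := by
  classical
  have h1 : ∀ S, M.densityMatrix rule τ u T S =
      τ⁻¹ * (M.cellVolume T * (if S = T then 1 else 0)) +
        M.upwindDiv rule u (fun T' => if S = T' then 1 else 0) T := by
    intro S
    have e1 : M.chi S = fun T' _ => (fun T' : M.cells => if S = T' then (1 : ℝ) else 0) T' := by
      funext T' x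
      simp [chi, eq_comm]
    have e2 : M.chi T = fun T' _ => (fun T' : M.cells => if T' = T then (1 : ℝ) else 0) T' := by
      funext T' x
      simp [chi]
    simp only [densityMatrix, Matrix.of_apply]
    rw [e1, e2, M.ip_const, M.ch_const hd rule hu]
    by_cases hST : S = T
    · subst hST; simp
    · simp [hST]
  simp only [mulVec, dotProduct, h1, add_mul, Finset.sum_add_distrib]
  congr 1
  · rw [Finset.sum_eq_single_of_mem T (Finset.mem_univ T)]
    · simp; ring
    · intro S _ hne
      simp [hne]
  · conv_rhs => rw [LinearMap.pi_apply_eq_sum_univ (M.upwindDiv rule u) r]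
    simp [mul_comm]

/-- Mass and outflow act on the diagonal; what `S` contributes to the balance of `T` is inflow
across the faces of `T` whose neighbour is `S`. -/
lemma densityMatrix_offDiag {k : ℕ} (hd : 2 ≤ d) (rule : UpwindRule) (τ : ℝ)
    {u : M.cells → Eu d → Eu d} (hu : ∀ T, u T ∈ vecPoly d k) (T S : M.cells) (hne : T ≠ S) :
    M.densityMatrix rule τ u T S ≤ 0 := by
  classical
  have h1 := M.densityMatrix_mulVec hd rule τ hu (Pi.single S 1) T
  rw [Matrix.mulVec_single_one] at h1
  simp only [Matrix.col_apply] at h1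
  rw [h1, Pi.single_eq_of_ne hne, mul_zero, mul_zero, zero_add]
  refine Finset.sum_nonpos fun F _ => ?_
  rw [Pi.single_eq_of_ne hne, zero_mul, zero_add]
  refine mul_nonpos_of_nonneg_of_nonpos ?_ (M.fluxIn_nonpos rule u T F)
  rw [Pi.single_apply]
  split_ifs <;> norm_num

/-- Summing a column amounts to testing with the constant one, for which the fluxes cancel by
`sum_upwindDiv`. -/
lemma densityMatrix_colSum {k : ℕ} (hd : 2 ≤ d) (rule : UpwindRule) (τ : ℝ)
    {u : M.cells → Eu d → Eu d} (hu : u ∈ M.Vh k) (S : M.cells) :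
    ∑ T, M.densityMatrix rule τ u T S = τ⁻¹ * M.cellVolume S := by
  classical
  have h1 : ∀ T, M.densityMatrix rule τ u T S = τ⁻¹ * (M.cellVolume T * (Pi.single S 1 : M.cells → ℝ) T) +
      M.upwindDiv rule u (Pi.single S 1) T := fun T => by
    have h1 := M.densityMatrix_mulVec hd rule τ hu.1 (Pi.single S 1) T
    rw [Matrix.mulVec_single_one] at h1
    exact h1
  simp_rw [h1, Finset.sum_add_distrib, M.sum_upwindDiv (by omega) rule hu, add_zero,
    ← Finset.mul_sum, Pi.single_apply]
  simp

open Matrix in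
/-- The density update is the linear system of the density matrix. -/
lemma isDensityUpdate_iff (hd : 2 ≤ d) (rule : UpwindRule) (τ : ℝ)
    {u : M.cells → Eu d → Eu d} (hu : ∀ T, u T ∈ vecPoly d 1) (r r' : M.cells → ℝ) :
    M.IsDensityUpdate 1 rule τ u (fun T _ => r T) (fun T _ => r' T) ↔
      ∀ T, (M.densityMatrix rule τ u *ᵥ r') T = τ⁻¹ * (M.cellVolume T * r T) := by
  classical
  have hQ : ∀ m : M.cells → ℝ, (fun T (_ : Eu d) => m T) ∈ M.Qh 1 := fun m T =>
    const_mem_polySpace (m T)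
  have key : ∀ m : M.cells → ℝ, (τ⁻¹ * M.ip (fun T _ => r' T) (fun T _ => m T) +
      M.ch rule (fun T _ => r' T) u (fun T _ => m T) = τ⁻¹ * M.ip (fun T _ => r T) (fun T _ => m T))
      ↔ ∑ T, m T * (M.densityMatrix rule τ u *ᵥ r') T =
        ∑ T, m T * (τ⁻¹ * (M.cellVolume T * r T)) := by
    intro m
    rw [M.ip_const, M.ip_const, M.ch_const hd rule hu, Finset.mul_sum, Finset.mul_sum,
      ← Finset.sum_add_distrib]
    simp_rw [M.densityMatrix_mulVec hd rule τ hu]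
    rw [Finset.sum_congr rfl fun T _ => show τ⁻¹ * (m T * (M.cellVolume T * r' T)) +
      m T * M.upwindDiv rule u r' T = m T * (τ⁻¹ * (M.cellVolume T * r' T) +
        M.upwindDiv rule u r' T) by ring,
      Finset.sum_congr rfl fun T _ => show τ⁻¹ * (m T * (M.cellVolume T * r T)) =
        m T * (τ⁻¹ * (M.cellVolume T * r T)) by ring]
  constructor
  · rintro ⟨-, h⟩ T
    have := (key (Pi.single T 1)).1 (h _ (hQ _))
    simpa [Pi.single_apply] using this
  · intro h
    refine ⟨hQ r', fun μ hμ => ?_⟩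
    choose m hm using fun T => eq_const_of_mem_polySpace_zero (hμ T)
    obtain rfl : μ = fun T _ => m T := funext hm
    exact (key m).2 (Finset.sum_congr rfl fun T _ => by rw [h T])

lemma exists_eq_const_of_mem_Qh {ρ : M.cells → Eu d → ℝ} (hρ : ρ ∈ M.Qh 1) :
    ∃ r : M.cells → ℝ, ρ = fun T _ => r T := by
  choose r hr using fun T => eq_const_of_mem_polySpace_zero (hρ T)
  exact ⟨r, funext hr⟩

/-- Solvability, positivity and mass conservation of the lowest order density update. -/
theorem densityUpdate (hd : 2 ≤ d) (rule : UpwindRule) {τ : ℝ} (hτ : 0 < τ)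
    {u : M.cells → Eu d → Eu d} (hu : u ∈ M.Vh 1) :
    IsMMatrix (M.densityMatrix rule τ u) ∧
      ∀ ρ ∈ M.Qh 1, (∃! ρ' : M.cells → Eu d → ℝ, M.IsDensityUpdate 1 rule τ u ρ ρ') ∧
        ∀ ρ' : M.cells → Eu d → ℝ, M.IsDensityUpdate 1 rule τ u ρ ρ' →
          (M.IsPositive ρ → M.IsPositive ρ') ∧ M.mass ρ' = M.mass ρ := by
  classical
  have hoff := M.densityMatrix_offDiag hd rule τ hu.1
  have hcol : ∀ S, 0 < ∑ T, M.densityMatrix rule τ u T S := fun S => by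
    rw [M.densityMatrix_colSum hd rule τ hu]
    exact mul_pos (inv_pos.2 hτ) (M.cellVolume_pos S)
  have hinj := mulVec_injective_of_colSum_pos hoff hcol
  refine ⟨isMMatrix_of_colSum_pos hoff hcol, fun ρ hρ => ?_⟩
  obtain ⟨r, rfl⟩ := M.exists_eq_const_of_mem_Qh hρ
  constructor
  · have hsurj : Function.Surjective (M.densityMatrix rule τ u).mulVec :=
      Matrix.mulVec_surjective_iff_isUnit.2 (Matrix.mulVec_injective_iff_isUnit.1 hinj)
    obtain ⟨r', hr'⟩ := hsurj fun T => τ⁻¹ * (M.cellVolume T * r T)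
    refine ⟨fun T _ => r' T, (M.isDensityUpdate_iff hd rule τ hu.1 r r').2
      fun T => congrFun hr' T, fun ρ' hρ' => ?_⟩
    obtain ⟨s, rfl⟩ := M.exists_eq_const_of_mem_Qh hρ'.1
    have hs := (M.isDensityUpdate_iff hd rule τ hu.1 r s).1 hρ'
    have : s = r' := hinj ((funext hs).trans hr'.symm)
    rw [this]
  · intro ρ' hρ'
    obtain ⟨s, rfl⟩ := M.exists_eq_const_of_mem_Qh hρ'.1
    have hs := (M.isDensityUpdate_iff hd rule τ hu.1 r s).1 hρ'
    constructor
    · intro hpos T x _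
      refine pos_of_mulVec_pos hoff hcol (x := s) (fun T => ?_) T
      obtain ⟨y, hy⟩ := (M.isCell T).interior_nonempty
      rw [hs]
      exact mul_pos (inv_pos.2 hτ) (mul_pos (M.cellVolume_pos T) (hpos T y (interior_subset hy)))
    -- Mass conservation: all cell balances are added, and the flux part drops out.
    · have h1 : ∑ T, (τ⁻¹ * (M.cellVolume T * s T) + M.upwindDiv rule u s T) =
          ∑ T, τ⁻¹ * (M.cellVolume T * r T) :=
        Finset.sum_congr rfl fun T _ => by rw [← M.densityMatrix_mulVec hd rule τ hu.1, hs]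
      rw [Finset.sum_add_distrib, M.sum_upwindDiv (by omega) rule hu, add_zero, ← Finset.mul_sum,
        ← Finset.mul_sum] at h1
      have h2 := mul_left_cancel₀ (inv_ne_zero hτ.ne') h1
      have h3 : ∀ r : M.cells → ℝ, M.mass (fun T _ => r T) = ∑ T, M.cellVolume T * r T :=
        fun r => by
          have := M.ip_const r fun _ => 1
          simpa [mass] using this
      rw [h3, h3, h2]

end Mesh

/-! ### The velocity update -/

lemma tang_add {d : ℕ} (n v w : Eu d) : tang n (v + w) = tang n v + tang n w := by
  simp only [tang, inner_add_left, add_smul]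
  abel

lemma tang_smul {d : ℕ} (n : Eu d) (c : ℝ) (v : Eu d) : tang n (c • v) = c • tang n v := by
  simp only [tang, inner_smul_left, smul_sub, smul_smul]
  rfl

lemma tang_neg {d : ℕ} (n v : Eu d) : tang (-n) v = tang n v := by
  simp [tang]

lemma continuous_tang {d : ℕ} (n : Eu d) : Continuous (tang n) := by
  unfold tang
  fun_prop

lemma gradProd_comm {d : ℕ} (u v : Eu d → Eu d) (x : Eu d) : gradProd u v x = gradProd v u x :=
  Finset.sum_congr rfl fun _ _ => real_inner_comm _ _

lemma gradProd_add_left {d : ℕ} {u u' : Eu d → Eu d} (hu : Differentiable ℝ u)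
    (hu' : Differentiable ℝ u') (v : Eu d → Eu d) (x : Eu d) :
    gradProd (u + u') v x = gradProd u v x + gradProd u' v x := by
  simp [gradProd, fderiv_add (hu x) (hu' x), inner_add_left, Finset.sum_add_distrib]

lemma gradProd_smul_left {d : ℕ} {u : Eu d → Eu d} (hu : Differentiable ℝ u) (c : ℝ)
    (v : Eu d → Eu d) (x : Eu d) : gradProd (c • u) v x = c * gradProd u v x := by
  simp [gradProd, fderiv_const_smul (hu x), inner_smul_left, Finset.mul_sum]

/-- A directional derivative is bounded by the Frobenius norm of the Jacobian. -/
lemma norm_fderiv_apply_sq_le {d : ℕ} (u : Eu d → Eu d) (x : Eu d) {n : Eu d} (hn : ‖n‖ = 1) :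
    ‖fderiv ℝ u x n‖ ^ 2 ≤ gradProd u u x := by
  have h1 : n = ∑ i, (n i) • EuclideanSpace.single i (1 : ℝ) := by
    have := (EuclideanSpace.basisFun (Fin d) ℝ).sum_repr n
    simpa using this.symm
  have h2 : ‖fderiv ℝ u x n‖ ≤ ∑ i, ‖n i‖ * ‖fderiv ℝ u x (EuclideanSpace.single i 1)‖ := by
    conv_lhs => rw [h1, map_sum]
    refine (norm_sum_le _ _).trans (Finset.sum_le_sum fun i _ => ?_)
    rw [map_smul, norm_smul]
  calc ‖fderiv ℝ u x n‖ ^ 2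
      ≤ (∑ i, ‖n i‖ * ‖fderiv ℝ u x (EuclideanSpace.single i 1)‖) ^ 2 :=
        pow_le_pow_left₀ (norm_nonneg _) h2 2
    _ ≤ (∑ i, ‖n i‖ ^ 2) * ∑ i, ‖fderiv ℝ u x (EuclideanSpace.single i 1)‖ ^ 2 :=
        Finset.sum_mul_sq_le_sq_mul_sq _ _ _
    _ = gradProd u u x := by
        rw [← EuclideanSpace.norm_sq_eq, hn, one_pow, one_mul]
        exact Finset.sum_congr rfl fun i _ => (real_inner_self_eq_norm_sq _).symm

lemma integrableOn_inner {d : ℕ} {K : Set (Eu d)} (hK : IsCompact K) {f v : Eu d → Eu d}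
    (hf : IntegrableOn f K) (hv : Continuous v) :
    IntegrableOn (fun x => inner ℝ (f x) (v x)) K := by
  obtain ⟨C, hC⟩ := hK.exists_bound_of_continuousOn hv.continuousOn
  refine Integrable.mono' (hf.norm.mul_const C)
    (hf.aestronglyMeasurable.inner hv.aestronglyMeasurable) ?_
  refine (ae_restrict_iff' hK.measurableSet).2 (Filter.Eventually.of_forall fun x hx => ?_)
  exact (norm_inner_le_norm _ _).trans (by gcongr; exact hC x hx)

namespace Mesh

variable {d : ℕ} {Ω : Set (Eu d)} (M : Mesh d Ω)

/-! #### Discrete spaces -/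

lemma glue_add (u v : M.cells → Eu d → Eu d) : M.glue (u + v) = M.glue u + M.glue v := by
  funext x
  simp only [glue, Pi.add_apply, ← Finset.sum_add_distrib]
  exact Finset.sum_congr rfl fun T _ => by rw [Set.indicator_add']; rfl

lemma glue_smul (c : ℝ) (u : M.cells → Eu d → Eu d) : M.glue (c • u) = c • M.glue u := by
  funext x
  simp only [glue, Pi.smul_apply, Finset.smul_sum]
  exact Finset.sum_congr rfl fun T _ => congrFun (Set.indicator_const_smul _ c (u T)) x

lemma integrableOn_hull {f : Eu d → ℝ} (hf : Continuous f) (T : M.cells) :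
    IntegrableOn f (hull (T : Finset (Eu d))) :=
  hf.continuousOn.integrableOn_compact (isCompact_hull _)

/-- `V_h` as a submodule. -/
def VhSubmodule (k : ℕ) : Submodule ℝ (M.cells → Eu d → Eu d) where
  carrier := M.Vh k
  zero_mem' := by
    refine ⟨fun T => (vecPolySubmodule d k).zero_mem, ?_⟩
    have h : M.glue 0 = 0 := by simpa using M.glue_smul 0 0
    rw [h]
    exact ⟨MemLp.zero, 0, MemLp.zero, fun φ _ _ => by simp⟩
  add_mem' := by
    rintro u v ⟨hu, hu2, q, hq, hqφ⟩ ⟨hv, hv2, p, hp, hpφ⟩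
    have huv : ∀ T, (u + v) T ∈ vecPoly d k := fun T =>
      (vecPolySubmodule d k).add_mem (hu T) (hv T)
    refine ⟨huv, ?_, q + p, hq.add hp, fun φ hφ hs => ?_⟩
    · rw [glue_add]; exact hu2.add hv2
    · have hφ' := hφ.continuous_fderiv (by simp)
      have hL : MemLp φ 2 (volume.restrict Ω) :=
        (hφ.continuous.memLp_of_hasCompactSupport (p := 2) (μ := volume) hs).restrict Ω
      have h1 := hqφ φ hφ hs
      have h2 := hpφ φ hφ hs
      rw [M.integral_glue hu hφ] at h1
      rw [M.integral_glue hv hφ] at h2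
      rw [M.integral_glue huv hφ]
      simp only [Pi.add_apply, map_add, add_mul]
      have i1 : Integrable (fun x => q x * φ x) (volume.restrict Ω) := hq.integrable_mul hL
      have i2 : Integrable (fun x => p x * φ x) (volume.restrict Ω) := hp.integrable_mul hL
      rw [integral_add i1 i2, neg_add, ← h1, ← h2,
        ← Finset.sum_add_distrib]
      refine Finset.sum_congr rfl fun T _ => ?_
      have hcu := continuous_of_mem_vecPoly (hu T)
      have hcv := continuous_of_mem_vecPoly (hv T)
      exact integral_add (M.integrableOn_hull (by fun_prop) T)
        (M.integrableOn_hull (by fun_prop) T)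
  smul_mem' := by
    rintro c u ⟨hu, hu2, q, hq, hqφ⟩
    refine ⟨fun T => (vecPolySubmodule d k).smul_mem c (hu T), ?_, c • q, hq.const_smul c,
      fun φ hφ hs => ?_⟩
    · rw [glue_smul]; exact hu2.const_smul c
    · simp only [glue_smul, Pi.smul_apply, inner_smul_left, smul_eq_mul, mul_assoc]
      rw [integral_const_mul, integral_const_mul, hqφ φ hφ hs]
      simp

instance finiteDimensional_VhSubmodule (k : ℕ) : FiniteDimensional ℝ (M.VhSubmodule k) := by
  let L : M.VhSubmodule k →ₗ[ℝ] (M.cells → vecPolySubmodule d k) :=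
    { toFun := fun u T => ⟨u.1 T, u.2.1 T⟩
      map_add' := fun u v => rfl
      map_smul' := fun c v => rfl }
  refine FiniteDimensional.of_injective L fun u v h => ?_
  ext1
  funext T
  exact congrArg Subtype.val (congrFun h T)

/-- The space of facet unknowns as a submodule. -/
def VhatSubmodule (k : ℕ) : Submodule ℝ (M.faces → Eu d → Eu d) where
  carrier := M.Vhat k
  zero_mem' := ⟨fun F => ⟨0, (vecPolySubmodule d k).zero_mem, by simp⟩,
    fun T F _ x _ => by simp, fun F _ => rfl⟩
  add_mem' := by
    rintro u v ⟨hu1, hu2, hu3⟩ ⟨hv1, hv2, hv3⟩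
    refine ⟨fun F => ?_, fun T F hF x hx => ?_, fun F hF => ?_⟩
    · obtain ⟨p, hp, h1⟩ := hu1 F
      obtain ⟨q, hq, h2⟩ := hv1 F
      exact ⟨p + q, (vecPolySubmodule d k).add_mem hp hq, by
        rw [Pi.add_apply, h1, h2, Set.indicator_add']⟩
    · rw [Pi.add_apply, Pi.add_apply, inner_add_left, hu2 T F hF x hx, hv2 T F hF x hx, add_zero]
    · rw [Pi.add_apply, hu3 F hF, hv3 F hF, add_zero]
  smul_mem' := by
    rintro c u ⟨hu1, hu2, hu3⟩
    refine ⟨fun F => ?_, fun T F hF x hx => ?_, fun F hF => ?_⟩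
    · obtain ⟨p, hp, h1⟩ := hu1 F
      exact ⟨c • p, (vecPolySubmodule d k).smul_mem c hp, by
        rw [Pi.smul_apply, h1]; exact (Set.indicator_const_smul _ c p).symm⟩
    · rw [Pi.smul_apply, Pi.smul_apply, inner_smul_left, hu2 T F hF x hx, mul_zero]
    · rw [Pi.smul_apply, hu3 F hF, smul_zero]

/-- A polynomial on a face has many polynomial extensions to `ℝ^d`, so the space is exhibited inside
the image of the ambient polynomials rather than embedded into them. -/
instance finiteDimensional_VhatSubmodule (k : ℕ) : FiniteDimensional ℝ (M.VhatSubmodule k) := by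
  let L : (M.faces → vecPolySubmodule d k) →ₗ[ℝ] (M.faces → Eu d → Eu d) :=
    { toFun := fun p F => (hull (F : Finset (Eu d))).indicator (p F)
      map_add' := fun p q => by
        funext F
        exact Set.indicator_add' _ _ _
      map_smul' := fun c p => by
        funext F
        exact Set.indicator_const_smul _ c _ }
  have hle : M.VhatSubmodule k ≤ LinearMap.range L := by
    intro v hv
    choose p hp h using hv.1
    exact ⟨fun F => ⟨p F, hp F⟩, funext fun F => (h F).symm⟩
  exact Submodule.finiteDimensional_of_le hle

lemma continuousOn_of_mem_Vhat {k : ℕ} {uh : M.faces → Eu d → Eu d} (h : uh ∈ M.Vhat k)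
    (F : M.faces) : ContinuousOn (uh F) (hull (F : Finset (Eu d))) := by
  obtain ⟨p, hp, h1⟩ := h.1 F
  refine (continuous_of_mem_vecPoly hp).continuousOn.congr fun x hx => ?_
  rw [h1, Set.indicator_of_mem hx]

/-! #### The bilinear form -/

/-- The tangential jump between the facet unknown and the cell unknown. -/
def jump (u : M.cells → Eu d → Eu d) (uh : M.faces → Eu d → Eu d) (T : M.cells) (F : M.faces)
    (x : Eu d) : Eu d :=
  tang (outwardNormal (T : Finset (Eu d)) F) (uh F x - u T x)

lemma jump_add (u v : M.cells → Eu d → Eu d) (uh vh : M.faces → Eu d → Eu d) (T : M.cells)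
    (F : M.faces) (x : Eu d) :
    M.jump (u + v) (uh + vh) T F x = M.jump u uh T F x + M.jump v vh T F x := by
  rw [jump, jump, jump, ← tang_add]
  congr 1
  simp only [Pi.add_apply]
  abel

lemma jump_smul (c : ℝ) (u : M.cells → Eu d → Eu d) (uh : M.faces → Eu d → Eu d) (T : M.cells)
    (F : M.faces) (x : Eu d) : M.jump (c • u) (c • uh) T F x = c • M.jump u uh T F x := by
  rw [jump, jump, ← tang_smul]
  congr 1
  simp only [Pi.smul_apply, smul_sub]

lemma continuousOn_jump {k : ℕ} {u : M.cells → Eu d → Eu d} {uh : M.faces → Eu d → Eu d}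
    (hu : ∀ T, u T ∈ vecPoly d k) (huh : uh ∈ M.Vhat k) (T : M.cells) (F : M.faces) :
    ContinuousOn (M.jump u uh T F) (hull (F : Finset (Eu d))) :=
  (continuous_tang _).comp_continuousOn ((M.continuousOn_of_mem_Vhat huh F).sub
    (continuous_of_mem_vecPoly (hu T)).continuousOn)

/-- The contribution of the face `F` of `T` to the form `a_h`. -/
def faceForm (k : ℕ) (α : ℝ) (u : M.cells → Eu d → Eu d) (uh : M.faces → Eu d → Eu d)
    (v : M.cells → Eu d → Eu d) (vh : M.faces → Eu d → Eu d) (T : M.cells) (F : M.faces) : ℝ :=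
  (∫ x in hull (F : Finset (Eu d)), inner ℝ (fderiv ℝ (u T) x
      (outwardNormal (T : Finset (Eu d)) F)) (M.jump v vh T F x) ∂μHE[d - 1]) +
    (∫ x in hull (F : Finset (Eu d)), inner ℝ (fderiv ℝ (v T) x
      (outwardNormal (T : Finset (Eu d)) F)) (M.jump u uh T F x) ∂μHE[d - 1]) +
    α * (k : ℝ) ^ 2 / M.meshSize * ∫ x in hull (F : Finset (Eu d)),
      inner ℝ (M.jump u uh T F x) (M.jump v vh T F x) ∂μHE[d - 1]

lemma ah_eq (k : ℕ) (α : ℝ) (u : M.cells → Eu d → Eu d) (uh : M.faces → Eu d → Eu d)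
    (v : M.cells → Eu d → Eu d) (vh : M.faces → Eu d → Eu d) :
    M.ah k α u uh v vh = ∑ T : M.cells,
      ((∫ x in hull (T : Finset (Eu d)), gradProd (u T) (v T) x) +
        ∑ F ∈ M.facesOf T, M.faceForm k α u uh v vh T F) := rfl

/-- The two consistency terms trade places. Through symmetry, bilinearity follows from linearity in
the first argument. -/
lemma ah_comm (k : ℕ) (α : ℝ) (u : M.cells → Eu d → Eu d) (uh : M.faces → Eu d → Eu d)
    (v : M.cells → Eu d → Eu d) (vh : M.faces → Eu d → Eu d) :
    M.ah k α u uh v vh = M.ah k α v vh u uh := by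
  rw [ah_eq, ah_eq]
  refine Finset.sum_congr rfl fun T _ => ?_
  simp_rw [gradProd_comm (u T) (v T)]
  congr 1
  refine Finset.sum_congr rfl fun F _ => ?_
  rw [faceForm, faceForm]
  simp_rw [real_inner_comm (M.jump u uh T F _) (M.jump v vh T F _)]
  ring

lemma integrableOn_face_inner (hd : 2 ≤ d) {T : M.cells} {F : M.faces} (hF : F ∈ M.facesOf T)
    {f g : Eu d → Eu d} (hf : ContinuousOn f (hull (F : Finset (Eu d))))
    (hg : ContinuousOn g (hull (F : Finset (Eu d)))) :
    IntegrableOn (fun x => inner ℝ (f x) (g x)) (hull (F : Finset (Eu d)))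
      (μHE[d - 1] : Measure (Eu d)) :=
  (M.isCell T).integrableOn_face (M.mem_facesOf.1 hF) (M.card_face F) hd (hf.inner hg)

lemma continuous_fderiv_apply {k : ℕ} {u : Eu d → Eu d} (hu : u ∈ vecPoly d k) (n : Eu d) :
    Continuous fun x => fderiv ℝ u x n := by
  have := continuous_fderiv_of_mem_vecPoly hu
  fun_prop

lemma ah_add_left (hd : 2 ≤ d) {k : ℕ} (α : ℝ) {u u' v : M.cells → Eu d → Eu d}
    {uh uh' vh : M.faces → Eu d → Eu d} (hu : ∀ T, u T ∈ vecPoly d k)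
    (hu' : ∀ T, u' T ∈ vecPoly d k) (hv : ∀ T, v T ∈ vecPoly d k) (huh : uh ∈ M.Vhat k)
    (huh' : uh' ∈ M.Vhat k) (hvh : vh ∈ M.Vhat k) :
    M.ah k α (u + u') (uh + uh') v vh = M.ah k α u uh v vh + M.ah k α u' uh' v vh := by
  simp only [ah_eq]
  rw [← Finset.sum_add_distrib]
  refine Finset.sum_congr rfl fun T _ => ?_
  have hdu := differentiable_of_mem_vecPoly (hu T)
  have hdu' := differentiable_of_mem_vecPoly (hu' T)
  have e1 : ∫ x in hull (T : Finset (Eu d)), gradProd ((u + u') T) (v T) x =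
      (∫ x in hull (T : Finset (Eu d)), gradProd (u T) (v T) x) +
        ∫ x in hull (T : Finset (Eu d)), gradProd (u' T) (v T) x := by
    rw [← integral_add (M.integrableOn_hull (continuous_gradProd (hu T) (hv T)) T)
      (M.integrableOn_hull (continuous_gradProd (hu' T) (hv T)) T)]
    simp_rw [Pi.add_apply u u', gradProd_add_left hdu hdu']
  have e2 : ∑ F ∈ M.facesOf T, M.faceForm k α (u + u') (uh + uh') v vh T F =
      ∑ F ∈ M.facesOf T, M.faceForm k α u uh v vh T F +
        ∑ F ∈ M.facesOf T, M.faceForm k α u' uh' v vh T F := by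
    rw [← Finset.sum_add_distrib]
    refine Finset.sum_congr rfl fun F hF => ?_
    have c1 := (continuous_fderiv_apply (hu T)
      (outwardNormal (T : Finset (Eu d)) F)).continuousOn (s := hull (F : Finset (Eu d)))
    have c2 := (continuous_fderiv_apply (hu' T)
      (outwardNormal (T : Finset (Eu d)) F)).continuousOn (s := hull (F : Finset (Eu d)))
    have c3 := (continuous_fderiv_apply (hv T)
      (outwardNormal (T : Finset (Eu d)) F)).continuousOn (s := hull (F : Finset (Eu d)))
    have j1 := M.continuousOn_jump hu huh T F
    have j2 := M.continuousOn_jump hu' huh' T F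
    have j3 := M.continuousOn_jump hv hvh T F
    have i := fun {f g : Eu d → Eu d} (hf : ContinuousOn f (hull (F : Finset (Eu d)))) hg =>
      M.integrableOn_face_inner hd hF (f := f) (g := g) hf hg
    simp only [faceForm, M.jump_add, Pi.add_apply u u', fderiv_add (hdu _) (hdu' _),
      add_apply, inner_add_left, inner_add_right]
    rw [integral_add (i c1 j3) (i c2 j3), integral_add (i c3 j1) (i c3 j2),
      integral_add (i j1 j3) (i j2 j3)]
    ring
  rw [e1, e2]
  ring

lemma ah_smul_left {k : ℕ} (α c : ℝ) {u : M.cells → Eu d → Eu d} (v : M.cells → Eu d → Eu d)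
    (uh vh : M.faces → Eu d → Eu d) (hu : ∀ T, u T ∈ vecPoly d k) :
    M.ah k α (c • u) (c • uh) v vh = c * M.ah k α u uh v vh := by
  simp only [ah_eq]
  rw [Finset.mul_sum]
  refine Finset.sum_congr rfl fun T _ => ?_
  have hdu := differentiable_of_mem_vecPoly (hu T)
  rw [mul_add, Finset.mul_sum]
  congr 1
  · rw [← integral_const_mul]
    simp_rw [Pi.smul_apply c u, gradProd_smul_left hdu]
  · refine Finset.sum_congr rfl fun F hF => ?_
    simp only [faceForm, M.jump_smul, Pi.smul_apply c u, fderiv_const_smul (hdu _),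
      smul_apply, real_inner_smul_left, real_inner_smul_right]
    rw [integral_const_mul, integral_const_mul, integral_const_mul]
    ring

/-- The form `a_h` as a bilinear form on the discrete space. -/
def ahBilin (hd : 2 ≤ d) (k : ℕ) (α : ℝ) :
    (M.VhSubmodule k × M.VhatSubmodule k) →ₗ[ℝ] (M.VhSubmodule k × M.VhatSubmodule k) →ₗ[ℝ] ℝ :=
  LinearMap.mk₂ ℝ (fun w z => M.ah k α w.1 w.2 z.1 z.2)
    (fun w w' z => M.ah_add_left hd α w.1.2.1 w'.1.2.1 z.1.2.1 w.2.2 w'.2.2 z.2.2)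
    (fun c w z => M.ah_smul_left α c z.1.1 w.2.1 z.2.1 w.1.2.1)
    (fun w z z' => by
      rw [M.ah_comm k α w.1, M.ah_comm k α w.1, M.ah_comm k α w.1]
      exact M.ah_add_left hd α z.1.2.1 z'.1.2.1 w.1.2.1 z.2.2 z'.2.2 w.2.2)
    (fun c w z => by
      rw [M.ah_comm k α w.1, M.ah_comm k α w.1]
      exact M.ah_smul_left α c w.1.1 z.2.1 w.2.1 z.1.2.1)

/-! #### The right-hand side -/

lemma integrableOn_of_memLp {p : ENNReal} (hp : 1 ≤ p) {f : Eu d → Eu d}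
    (hf : MemLp f p (volume.restrict Ω)) (T : M.cells) :
    IntegrableOn f (hull (T : Finset (Eu d))) := by
  have h1 : IsFiniteMeasure (volume.restrict Ω) := ⟨by simpa using M.volume_domain_lt_top⟩
  have h2 : Integrable f (volume.restrict Ω) := hf.integrable hp
  exact h2.mono_measure (Measure.restrict_mono_ae (M.hull_ae_le_domain T))

/-- The right-hand side of the velocity update, as a linear functional. -/
def velocityRhs {k : ℕ} (cM : ℝ) {f g : Eu d → Eu d} (hf : MemLp f 2 (volume.restrict Ω))
    (hg : MemLp g ⊤ (volume.restrict Ω)) {ρ : M.cells → Eu d → ℝ} (hρ : ρ ∈ M.Qh k) :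
    M.VhSubmodule k →ₗ[ℝ] ℝ where
  toFun v := M.Fform f v + M.Gform g ρ v - M.bform (fun T x => cM * ρ T x) v
  map_add' u v := by
    have hfT := M.integrableOn_of_memLp (by norm_num) hf
    have hgT := M.integrableOn_of_memLp le_top hg
    have hρc : ∀ T, Continuous (ρ T) := fun T => (contDiff_of_mem_polySpace (hρ T)).continuous
    have hu := fun T => continuous_of_mem_vecPoly (u.2.1 T)
    have hv := fun T => continuous_of_mem_vecPoly (v.2.1 T)
    have hdu := fun T => continuous_divergence (contDiff_of_mem_vecPoly (u.2.1 T))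
    have hdv := fun T => continuous_divergence (contDiff_of_mem_vecPoly (v.2.1 T))
    have e1 : M.Fform f (u + v : M.VhSubmodule k) = M.Fform f u + M.Fform f v := by
      simp only [Fform]
      rw [← Finset.sum_add_distrib]
      refine Finset.sum_congr rfl fun T _ => ?_
      rw [← integral_add (integrableOn_inner (isCompact_hull _) (hfT T) (hu T))
        (integrableOn_inner (isCompact_hull _) (hfT T) (hv T))]
      simp [inner_add_right]
    have e2 : M.Gform g ρ (u + v : M.VhSubmodule k) = M.Gform g ρ u + M.Gform g ρ v := by
      simp only [Gform]
      rw [← Finset.sum_add_distrib]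
      refine Finset.sum_congr rfl fun T _ => ?_
      have i1 := integrableOn_inner (v := fun x => ρ T x • u.1 T x)
        (isCompact_hull (T : Finset (Eu d))) (hgT T) ((hρc T).smul (hu T))
      have i2 := integrableOn_inner (v := fun x => ρ T x • v.1 T x)
        (isCompact_hull (T : Finset (Eu d))) (hgT T) ((hρc T).smul (hv T))
      rw [← integral_add i1 i2]
      simp [inner_add_right, smul_add]
    have e3 : M.bform (fun T x => cM * ρ T x) (u + v : M.VhSubmodule k) =
        M.bform (fun T x => cM * ρ T x) u + M.bform (fun T x => cM * ρ T x) v := by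
      simp only [bform]
      rw [← neg_add, ← Finset.sum_add_distrib]
      congr 1
      refine Finset.sum_congr rfl fun T _ => ?_
      have i1 := M.integrableOn_hull (f := fun x => cM * ρ T x * divergence (u.1 T) x)
        ((continuous_const.mul (hρc T)).mul (hdu T)) T
      have i2 := M.integrableOn_hull (f := fun x => cM * ρ T x * divergence (v.1 T) x)
        ((continuous_const.mul (hρc T)).mul (hdv T)) T
      rw [← integral_add i1 i2]
      congr 1
      ext x
      have h1 := differentiable_of_mem_vecPoly (u.2.1 T) x
      have h2 := differentiable_of_mem_vecPoly (v.2.1 T) x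
      have : divergence ((u + v : M.VhSubmodule k).1 T) x =
          divergence (u.1 T) x + divergence (v.1 T) x := by
        simp [divergence, fderiv_add h1 h2, Finset.sum_add_distrib]
      rw [this, mul_add]
    rw [e1, e2, e3]
    ring
  map_smul' c v := by
    have e1 : M.Fform f (c • v : M.VhSubmodule k) = c * M.Fform f v := by
      simp only [Fform, Finset.mul_sum, ← integral_const_mul]
      simp [real_inner_smul_right]
    have e2 : M.Gform g ρ (c • v : M.VhSubmodule k) = c * M.Gform g ρ v := by
      simp only [Gform, Finset.mul_sum, ← integral_const_mul]
      refine Finset.sum_congr rfl fun T _ => ?_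
      congr 1
      ext x
      rw [← real_inner_smul_right, smul_comm]
      rfl
    have e3 : M.bform (fun T x => cM * ρ T x) (c • v : M.VhSubmodule k) =
        c * M.bform (fun T x => cM * ρ T x) v := by
      simp only [bform, mul_neg, Finset.mul_sum, ← integral_const_mul]
      congr 1
      refine Finset.sum_congr rfl fun T _ => ?_
      congr 1
      ext x
      have h1 := differentiable_of_mem_vecPoly (v.2.1 T) x
      have : divergence ((c • v : M.VhSubmodule k).1 T) x = c * divergence (v.1 T) x := by
        simp [divergence, fderiv_const_smul h1, Finset.mul_sum]
      rw [this]
      ring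
    rw [e1, e2, e3, RingHom.id_apply, smul_eq_mul]
    ring

end Mesh

namespace Mesh

variable {d : ℕ} {Ω : Set (Eu d)} (M : Mesh d Ω)

/-! #### Coercivity -/

lemma diam_le_meshSize (T : M.cells) :
    Metric.diam (hull (T : Finset (Eu d))) ≤ M.meshSize :=
  le_ciSup (f := fun T : M.cells => Metric.diam (hull (T : Finset (Eu d))))
    (Set.finite_range _).bddAbove T

lemma meshSize_pos (hd : 1 ≤ d) (T : M.cells) : 0 < M.meshSize := by
  obtain ⟨a, ha, b, hb, hab⟩ := Finset.one_lt_card.1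
    (show 1 < (T : Finset (Eu d)).card by rw [(M.isCell T).card_eq]; omega)
  have h1 : dist a b ≤ Metric.diam (hull (T : Finset (Eu d))) :=
    Metric.dist_le_diam_of_mem (isCompact_hull _).isBounded
      (subset_convexHull ℝ _ (by exact_mod_cast ha)) (subset_convexHull ℝ _ (by exact_mod_cast hb))
  exact (dist_pos.2 hab).trans_le (h1.trans (M.diam_le_meshSize T))

lemma card_facesOf_le (T : M.cells) : (M.facesOf T).card ≤ d + 1 := by
  classical
  have h1 : (M.facesOf T).card ≤ ((T : Finset (Eu d)).powersetCard d).card := by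
    refine Finset.card_le_card_of_injOn (fun F => (F : Finset (Eu d))) (fun F hF => ?_)
      (Subtype.val_injective.injOn)
    exact Finset.mem_coe.2 (Finset.mem_powersetCard.2 ⟨M.mem_facesOf.1 hF, M.card_face F⟩)
  rwa [Finset.card_powersetCard, (M.isCell T).card_eq, Nat.choose_succ_self_right] at h1

lemma norm_outwardNormal (hd : 1 ≤ d) {T : M.cells} {F : M.faces} (hF : F ∈ M.facesOf T) :
    ‖outwardNormal (T : Finset (Eu d)) F‖ = 1 := by
  obtain ⟨v, hv⟩ := M.exists_isFace hF
  exact (hv.outwardNormal_spec (M.isCell T) (M.face_nonempty hd F)).2.1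

/-- Discrete trace inequality for the normal derivative. -/
lemma exists_trace_le (hd : 2 ≤ d) (k : ℕ) {σ : ℝ} (hσ : 0 < σ) :
    ∃ C : ℝ, 0 < C ∧ ∀ (Ω : Set (Eu d)) (M : Mesh d Ω), M.IsQuasiUniform σ →
      ∀ (T : M.cells) (F : M.faces), F ∈ M.facesOf T → ∀ u ∈ vecPoly d k,
        ∫ x in hull (F : Finset (Eu d)),
          ‖fderiv ℝ u x (outwardNormal (T : Finset (Eu d)) F)‖ ^ 2 ∂μHE[d - 1] ≤
        C / M.meshSize * ∫ x in hull (T : Finset (Eu d)), gradProd u u x := by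
  obtain ⟨C, hC0, hC⟩ := exists_gradProd_le d k hσ
  -- The summand `1` only makes the constant strictly positive.
  refine ⟨C * unitBallVolume (d - 1) + 1,
    add_pos_of_nonneg_of_pos (mul_nonneg hC0 (unitBallVolume_nonneg _)) one_pos,
    fun Ω M hM T F hF u hu => ?_⟩
  set h := M.meshSize with hh
  have hpos : 0 < h := M.meshSize_pos (by omega) T
  set I := ∫ x in hull (T : Finset (Eu d)), gradProd u u x with hI
  have hI0 : 0 ≤ I := integral_nonneg fun x => gradProd_self_nonneg u x
  obtain ⟨c, hc⟩ := hM T T.2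
  have hcT : c ∈ hull (T : Finset (Eu d)) :=
    hc (Metric.mem_closedBall_self (div_nonneg hpos.le hσ.le))
  have hFT := M.mem_facesOf.1 hF
  have hpt : ∀ x ∈ hull (F : Finset (Eu d)),
      ‖‖fderiv ℝ u x (outwardNormal (T : Finset (Eu d)) F)‖ ^ 2‖ ≤ C / h ^ d * I := by
    intro x hx
    rw [Real.norm_of_nonneg (by positivity)]
    refine (norm_fderiv_apply_sq_le u x (M.norm_outwardNormal (by omega) hF)).trans ?_
    -- The centre `c` lies in the cell, whose diameter is at most `h`.
    have hxb : x ∈ Metric.closedBall c h :=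
      (Metric.dist_le_diam_of_mem (isCompact_hull _).isBounded (hull_mono hFT hx) hcT).trans
        (M.diam_le_meshSize T)
    refine (hC u hu c h hpos x hxb).trans ?_
    refine mul_le_mul_of_nonneg_left ?_ (div_nonneg hC0 (by positivity))
    exact setIntegral_mono_set (M.integrableOn_hull (continuous_gradProd hu hu) T)
      (Filter.Eventually.of_forall fun x => gradProd_self_nonneg u x) hc.eventuallyLE
  have hlt := (M.isCell T).measure_face_lt_top hFT (M.card_face F) hd
  have h1 := norm_setIntegral_le_of_norm_le_const hlt hpt
  have h2 : (μHE[d - 1] : Measure (Eu d)).real (hull (F : Finset (Eu d))) ≤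
      h ^ (d - 1) * unitBallVolume (d - 1) :=
    ENNReal.toReal_le_of_le_ofReal
      (mul_nonneg (by positivity) (unitBallVolume_nonneg _))
      ((M.isCell T).measure_face_le hFT (M.card_face F) hd hpos.le (M.diam_le_meshSize T))
  -- The pointwise bound scales like `h ^ (-d)` and the area of the face like `h ^ (d - 1)`, which
  -- leaves the factor `1 / h`.
  have hd' : h ^ d = h ^ (d - 1) * h := by rw [← pow_succ]; congr 1; omega
  calc _ ≤ C / h ^ d * I * (μHE[d - 1] : Measure (Eu d)).real (hull (F : Finset (Eu d))) :=
        (Real.le_norm_self _).trans h1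
    _ ≤ C / h ^ d * I * (h ^ (d - 1) * unitBallVolume (d - 1)) :=
        mul_le_mul_of_nonneg_left h2 (mul_nonneg (div_nonneg hC0 (by positivity)) hI0)
    _ = (C * unitBallVolume (d - 1)) / h * I := by rw [hd']; field_simp
    _ ≤ (C * unitBallVolume (d - 1) + 1) / h * I := by gcongr; linarith

/-- The contribution of one cell to `a_h` is coercive for a large penalty parameter. -/
lemma cellForm_ge (hd : 2 ≤ d) {k : ℕ} (hk : 1 ≤ k) {C α : ℝ} (hC : 0 < C)
    (hα : 2 * C * (d + 1) + 1 ≤ α) {u : M.cells → Eu d → Eu d} {uh : M.faces → Eu d → Eu d}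
    (hu : ∀ T, u T ∈ vecPoly d k) (huh : uh ∈ M.Vhat k) (T : M.cells)
    (hT : ∀ F ∈ M.facesOf T, ∫ x in hull (F : Finset (Eu d)),
      ‖fderiv ℝ (u T) x (outwardNormal (T : Finset (Eu d)) F)‖ ^ 2 ∂μHE[d - 1] ≤
        C / M.meshSize * ∫ x in hull (T : Finset (Eu d)), gradProd (u T) (u T) x) :
    (1 / 2) * (∫ x in hull (T : Finset (Eu d)), gradProd (u T) (u T) x) +
      ∑ F ∈ M.facesOf T, M.meshSize⁻¹ *
        ∫ x in hull (F : Finset (Eu d)), ‖M.jump u uh T F x‖ ^ 2 ∂μHE[d - 1] ≤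
    (∫ x in hull (T : Finset (Eu d)), gradProd (u T) (u T) x) +
      ∑ F ∈ M.facesOf T, M.faceForm k α u uh u uh T F := by
  set h := M.meshSize with hh
  have hpos : 0 < h := M.meshSize_pos (by omega) T
  set I := ∫ x in hull (T : Finset (Eu d)), gradProd (u T) (u T) x with hI
  have hI0 : 0 ≤ I := integral_nonneg fun x => gradProd_self_nonneg _ x
  -- The weight in Young's inequality, chosen so that each of the at most `d + 1` faces uses up the
  -- fraction `1 / (2 (d + 1))` of the gradient term, together at most half of it. Then `s⁻¹ + h⁻¹ =
  -- (2 C (d + 1) + 1) / h`, which is the source of the threshold for `α`.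
  set s : ℝ := h / (2 * C * (d + 1)) with hs
  have hspos : 0 < s := by positivity
  have hface : ∀ F ∈ M.facesOf T, h⁻¹ *
      (∫ x in hull (F : Finset (Eu d)), ‖M.jump u uh T F x‖ ^ 2 ∂μHE[d - 1]) -
        I / (2 * (d + 1)) ≤ M.faceForm k α u uh u uh T F := by
    intro F hF
    set n := outwardNormal (T : Finset (Eu d)) F with hn
    set J := ∫ x in hull (F : Finset (Eu d)), ‖M.jump u uh T F x‖ ^ 2 ∂μHE[d - 1] with hJ
    have hJ0 : 0 ≤ J := integral_nonneg fun x => by positivity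
    have c1 := (continuous_fderiv_apply (hu T) n).continuousOn (s := hull (F : Finset (Eu d)))
    have c2 := M.continuousOn_jump hu huh T F
    have int := fun {f : Eu d → ℝ} (hf : ContinuousOn f (hull (F : Finset (Eu d)))) =>
      (M.isCell T).integrableOn_face (M.mem_facesOf.1 hF) (M.card_face F) hd hf
    have i1 := int (f := fun x => -(s * ‖fderiv ℝ (u T) x n‖ ^ 2))
      (continuousOn_const.mul (c1.norm.pow 2)).neg
    have i2 := int (f := fun x => s⁻¹ * ‖M.jump u uh T F x‖ ^ 2)
      (continuousOn_const.mul (c2.norm.pow 2))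
    have hyoung : -(s * ∫ x in hull (F : Finset (Eu d)), ‖fderiv ℝ (u T) x n‖ ^ 2 ∂μHE[d - 1]) -
        s⁻¹ * J ≤ 2 * ∫ x in hull (F : Finset (Eu d)),
          inner ℝ (fderiv ℝ (u T) x n) (M.jump u uh T F x) ∂μHE[d - 1] := by
      rw [← integral_const_mul, ← integral_const_mul, ← integral_const_mul, ← integral_neg,
        ← integral_sub i1 i2]
      refine integral_mono (i1.sub i2)
        ((M.integrableOn_face_inner hd hF c1 c2).const_mul 2) fun x => ?_
      set a := fderiv ℝ (u T) x n
      set b := M.jump u uh T F x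
      change -(s * ‖a‖ ^ 2) - s⁻¹ * ‖b‖ ^ 2 ≤ 2 * inner ℝ a b
      have h1 : -(‖a‖ * ‖b‖) ≤ inner ℝ a b :=
        neg_le_of_abs_le (abs_real_inner_le_norm a b)
      have h2 : 0 ≤ s⁻¹ * (s * ‖a‖ - ‖b‖) ^ 2 := by positivity
      have h3 : s⁻¹ * (s * ‖a‖ - ‖b‖) ^ 2 = s * ‖a‖ ^ 2 - 2 * (‖a‖ * ‖b‖) + s⁻¹ * ‖b‖ ^ 2 := by
        field_simp
        ring
      linarith
    have htr : s * ∫ x in hull (F : Finset (Eu d)), ‖fderiv ℝ (u T) x n‖ ^ 2 ∂μHE[d - 1] ≤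
        I / (2 * (d + 1)) := by
      refine (mul_le_mul_of_nonneg_left (hT F hF) hspos.le).trans_eq ?_
      rw [hs]
      field_simp
    have hpen : (s⁻¹ + h⁻¹) * J ≤ α * (k : ℝ) ^ 2 / h * J := by
      refine mul_le_mul_of_nonneg_right ?_ hJ0
      have hk' : (1 : ℝ) ≤ (k : ℝ) ^ 2 := one_le_pow₀ (by exact_mod_cast hk)
      have hα0 : 0 ≤ α := le_trans (by positivity) hα
      have : s⁻¹ + h⁻¹ = (2 * C * (d + 1) + 1) / h := by rw [hs]; field_simp
      rw [this]
      gcongr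
      nlinarith
    have hJJ : ∫ x in hull (F : Finset (Eu d)),
        inner ℝ (M.jump u uh T F x) (M.jump u uh T F x) ∂μHE[d - 1] = J := by
      simp_rw [real_inner_self_eq_norm_sq]
      rfl
    rw [faceForm, hJJ]
    linarith
  have hsum := Finset.sum_le_sum hface
  rw [Finset.sum_sub_distrib, Finset.sum_const, nsmul_eq_mul] at hsum
  have hcard : ((M.facesOf T).card : ℝ) * (I / (2 * (d + 1))) ≤ 1 / 2 * I := by
    have h1 : ((M.facesOf T).card : ℝ) ≤ d + 1 := by exact_mod_cast M.card_facesOf_le T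
    calc ((M.facesOf T).card : ℝ) * (I / (2 * (d + 1))) ≤ (d + 1) * (I / (2 * (d + 1))) := by
          gcongr
      _ = 1 / 2 * I := by field_simp
  linarith

/-! #### Unique solvability -/

/-- The derivative vanishes in the interior of the cell, so `u` is constant there. Being a
polynomial, it is constant on all of `ℝ^d`. -/
lemma eq_const_of_integral_gradProd_eq_zero {k : ℕ} {u : Eu d → Eu d} (hu : u ∈ vecPoly d k)
    (T : M.cells) (h0 : ∫ x in hull (T : Finset (Eu d)), gradProd u u x = 0) :
    ∃ c : Eu d, u = fun _ => c := by
  have hdu := differentiable_of_mem_vecPoly hu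
  obtain ⟨x₀, hx₀⟩ := (M.isCell T).interior_nonempty
  have hcont := continuous_gradProd hu hu
  have h1 : gradProd u u =ᵐ[volume.restrict (hull (T : Finset (Eu d)))] 0 :=
    (integral_eq_zero_iff_of_nonneg (fun x => gradProd_self_nonneg u x)
      (M.integrableOn_hull hcont T)).1 h0
  have h2 : Set.EqOn (gradProd u u) 0 (interior (hull (T : Finset (Eu d)))) :=
    Measure.eqOn_open_of_ae_eq (ae_restrict_of_ae_restrict_of_subset interior_subset h1)
      isOpen_interior hcont.continuousOn continuousOn_const
  have h3 : ∀ x ∈ interior (hull (T : Finset (Eu d))), fderiv ℝ u x = 0 := by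
    intro x hx
    have h4 : ∀ i, fderiv ℝ u x (EuclideanSpace.single i 1) = 0 := fun i => by
      have := (Finset.sum_eq_zero_iff_of_nonneg fun i _ => real_inner_self_nonneg).1 (h2 hx) i
        (Finset.mem_univ i)
      exact inner_self_eq_zero.1 this
    have h5 : (fderiv ℝ u x).toLinearMap = 0 :=
      (EuclideanSpace.basisFun (Fin d) ℝ).toBasis.ext fun i => by simpa using h4 i
    exact ContinuousLinearMap.coe_injective h5
  refine ⟨u x₀, eq_of_eventuallyEq_of_mem_vecPoly hu (const_mem_vecPoly _) (x := x₀) ?_⟩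
  filter_upwards [isOpen_interior.mem_nhds hx₀] with x hx
  refine (convex_hull (T : Finset (Eu d))).interior.is_const_of_fderivWithin_eq_zero (𝕜 := ℝ)
    hdu.differentiableOn (fun y hy => ?_) hx hx₀
  rw [fderivWithin_of_isOpen isOpen_interior hy, h3 y hy]

/-- Piecewise constant velocities without tangential jumps vanish. -/
lemma eq_zero_of_const_of_jump_eq_zero (hd : 2 ≤ d) {k : ℕ} {u : M.cells → Eu d → Eu d}
    {uh : M.faces → Eu d → Eu d} (hu : u ∈ M.Vh k) (huh : uh ∈ M.Vhat k) {c : M.cells → Eu d}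
    (hc : ∀ T, u T = fun _ => c T)
    (hjump : ∀ T, ∀ F ∈ M.facesOf T, ∀ x ∈ hull (F : Finset (Eu d)), M.jump u uh T F x = 0) :
    u = 0 ∧ uh = 0 := by
  -- The facet unknown is itself tangential, so a vanishing jump makes it equal to the tangential
  -- part of the cell value, seen from either side.
  have htan : ∀ T, ∀ F ∈ M.facesOf T, ∀ x ∈ hull (F : Finset (Eu d)),
      uh F x = tang (outwardNormal (T : Finset (Eu d)) F) (c T) := by
    intro T F hF x hx
    have h1 := hjump T F hF x hx
    have h2 := huh.2.1 T F hF x hx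
    rw [jump, hc T] at h1
    simp only [tang, inner_sub_left, h2, zero_sub, neg_smul, sub_neg_eq_add] at h1 ⊢
    rw [← sub_eq_zero, ← h1]
    abel
  have hc0 : ∀ T, c T = 0 := by
    by_contra! hcon
    obtain ⟨T₁, hT₁⟩ := hcon
    -- The cells sharing one nonzero value have a neighbour with the same value across every face: a
    -- boundary face would force the value to be zero, and across an interior face both the
    -- tangential and the normal parts agree.
    refine M.not_forall_exists_neighbour (by omega) (C := {T | c T = c T₁}) ⟨T₁, rfl⟩
      fun T hT F hF => ?_
    have hT' : c T = c T₁ := hT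
    obtain ⟨x, hx⟩ := relInt_nonempty (M.face_nonempty (by omega) F)
    have hxF := relInt_subset_hull _ hx
    by_cases hone : ∀ S : M.cells, F ∈ M.facesOf S → S = T
    · exfalso
      have h1 := htan T F hF x hxF
      rw [huh.2.2 F (M.hull_face_subset_frontier (by omega) hF hone)] at h1
      have h2 := M.inner_outwardNormal_eq_zero (by omega) hu hF hone hxF
      rw [hc T] at h2
      simp only [tang, h2, zero_smul, sub_zero, Pi.zero_apply] at h1
      exact hT₁ (hT' ▸ h1.symm)
    · push Not at hone
      obtain ⟨S, hS, hne⟩ := hone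
      refine ⟨S, ?_, hne, hS⟩
      have h1 := htan T F hF x hxF
      have h2 := htan S F hS x hxF
      have h3 := M.inner_outwardNormal_eq_neg (by omega) hu hne hS hF hxF
      rw [M.outwardNormal_eq_neg (by omega) hne hS hF] at h2 h3
      rw [tang_neg, h1] at h2
      rw [hc S, hc T, inner_neg_right, neg_inj] at h3
      simp only [tang, h3] at h2
      have h4 : c S = c T := (sub_left_inj.1 h2).symm
      exact h4.trans hT'
  refine ⟨funext fun T => ?_, funext fun F => ?_⟩
  · rw [hc T, hc0 T]; rfl
  · obtain ⟨T, hT⟩ := M.exists_cell F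
    obtain ⟨p, -, hp⟩ := huh.1 F
    funext x
    by_cases hx : x ∈ hull (F : Finset (Eu d))
    · rw [htan T F hT x hx, hc0 T]
      simp [tang]
    · rw [hp, Set.indicator_of_notMem hx]; rfl

/-- The form `a_h` is definite for a large penalty parameter. -/
lemma eq_zero_of_ah_self_eq_zero (hd : 2 ≤ d) {k : ℕ} (hk : 1 ≤ k) {C α : ℝ} (hC : 0 < C)
    (hα : 2 * C * (d + 1) + 1 ≤ α)
    (htr : ∀ (T : M.cells) (F : M.faces), F ∈ M.facesOf T → ∀ u ∈ vecPoly d k,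
      ∫ x in hull (F : Finset (Eu d)),
        ‖fderiv ℝ u x (outwardNormal (T : Finset (Eu d)) F)‖ ^ 2 ∂μHE[d - 1] ≤
      C / M.meshSize * ∫ x in hull (T : Finset (Eu d)), gradProd u u x)
    {u : M.cells → Eu d → Eu d} {uh : M.faces → Eu d → Eu d} (hu : u ∈ M.Vh k)
    (huh : uh ∈ M.Vhat k) (h0 : M.ah k α u uh u uh = 0) : u = 0 ∧ uh = 0 := by
  have hI0 : ∀ T : M.cells, 0 ≤ ∫ x in hull (T : Finset (Eu d)), gradProd (u T) (u T) x :=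
    fun T => integral_nonneg fun x => gradProd_self_nonneg _ x
  have hJ0 : ∀ (T : M.cells) (F : M.faces), 0 ≤ M.meshSize⁻¹ *
      ∫ x in hull (F : Finset (Eu d)), ‖M.jump u uh T F x‖ ^ 2 ∂μHE[d - 1] := fun T F =>
    mul_nonneg (inv_nonneg.2 (M.meshSize_pos (by omega) T).le)
      (integral_nonneg fun x => by positivity)
  have hlow : ∀ T ∈ (Finset.univ : Finset M.cells), 0 ≤
      (1 / 2) * (∫ x in hull (T : Finset (Eu d)), gradProd (u T) (u T) x) +
      ∑ F ∈ M.facesOf T, M.meshSize⁻¹ *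
        ∫ x in hull (F : Finset (Eu d)), ‖M.jump u uh T F x‖ ^ 2 ∂μHE[d - 1] := fun T _ =>
    add_nonneg (mul_nonneg (by norm_num) (hI0 T)) (Finset.sum_nonneg fun F _ => hJ0 T F)
  have hsum : ∑ T : M.cells,
      ((1 / 2) * (∫ x in hull (T : Finset (Eu d)), gradProd (u T) (u T) x) +
      ∑ F ∈ M.facesOf T, M.meshSize⁻¹ *
        ∫ x in hull (F : Finset (Eu d)), ‖M.jump u uh T F x‖ ^ 2 ∂μHE[d - 1]) = 0 := by
    refine le_antisymm ?_ (Finset.sum_nonneg hlow)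
    rw [← h0, ah_eq]
    exact Finset.sum_le_sum fun T _ => M.cellForm_ge hd hk hC hα hu.1 huh T
      fun F hF => htr T F hF (u T) (hu.1 T)
  have hzero := (Finset.sum_eq_zero_iff_of_nonneg hlow).1 hsum
  have hI : ∀ T : M.cells, ∫ x in hull (T : Finset (Eu d)), gradProd (u T) (u T) x = 0 := by
    intro T
    have h1 := hzero T (Finset.mem_univ T)
    have h2 := Finset.sum_nonneg fun F (_ : F ∈ M.facesOf T) => hJ0 T F
    have h3 := hI0 T
    linarith
  choose c hc using fun T => M.eq_const_of_integral_gradProd_eq_zero (hu.1 T) T (hI T)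
  refine M.eq_zero_of_const_of_jump_eq_zero hd hu huh hc fun T F hF x hx => ?_
  have h1 := hzero T (Finset.mem_univ T)
  rw [hI T, mul_zero, zero_add] at h1
  have h2 := (Finset.sum_eq_zero_iff_of_nonneg fun F _ => hJ0 T F).1 h1 F hF
  have h3 := (mul_eq_zero.1 h2).resolve_left (inv_ne_zero (M.meshSize_pos (by omega) T).ne')
  have h4 := (M.isCell T).eq_zero_of_integral_face_eq_zero (M.mem_facesOf.1 hF) (M.card_face F) hd
    ((M.continuousOn_jump hu.1 huh T F).norm.pow 2) (fun x _ => sq_nonneg _) h3 x hx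
  exact norm_eq_zero.1 (pow_eq_zero_iff (two_ne_zero)|>.1 h4)

/-- Unique solvability of the velocity update. -/
theorem existsUnique_velocityUpdate (hd : 2 ≤ d) {k : ℕ} (hk : 1 ≤ k) {C α : ℝ} (hC : 0 < C)
    (hα : 2 * C * (d + 1) + 1 ≤ α)
    (htr : ∀ (T : M.cells) (F : M.faces), F ∈ M.facesOf T → ∀ u ∈ vecPoly d k,
      ∫ x in hull (F : Finset (Eu d)),
        ‖fderiv ℝ u x (outwardNormal (T : Finset (Eu d)) F)‖ ^ 2 ∂μHE[d - 1] ≤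
      C / M.meshSize * ∫ x in hull (T : Finset (Eu d)), gradProd u u x)
    {ν : ℝ} (hν : 0 < ν) (cM : ℝ) {f g : Eu d → Eu d} (hf : MemLp f 2 (volume.restrict Ω))
    (hg : MemLp g ⊤ (volume.restrict Ω)) {ρ : M.cells → Eu d → ℝ} (hρ : ρ ∈ M.Qh k) :
    ∃! w : (M.cells → Eu d → Eu d) × (M.faces → Eu d → Eu d),
      M.IsVelocityUpdate k α ν cM f g ρ w.1 w.2 := by
  set W := M.VhSubmodule k × M.VhatSubmodule k
  let B : W →ₗ[ℝ] Module.Dual ℝ W := ν • M.ahBilin hd k α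
  have hB : ∀ w z : W, B w z = ν * M.ah k α w.1 w.2 z.1 z.2 := fun w z => rfl
  have hinj : Function.Injective B := by
    rw [injective_iff_map_eq_zero]
    intro w hw
    have h1 : ν * M.ah k α w.1 w.2 w.1 w.2 = 0 := by rw [← hB, hw]; rfl
    obtain ⟨h2, h3⟩ := M.eq_zero_of_ah_self_eq_zero hd hk hC hα htr w.1.2 w.2.2
      ((mul_eq_zero.1 h1).resolve_left hν.ne')
    exact Prod.ext (Subtype.ext h2) (Subtype.ext h3)
  -- A finite-dimensional space and its dual have equal dimension, so uniqueness gives existence.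
  have hsurj : Function.Surjective B :=
    (LinearMap.injective_iff_surjective_of_finrank_eq_finrank
      (Subspace.dual_finrank_eq (K := ℝ) (V := W)).symm).1 hinj
  obtain ⟨w, hw⟩ := hsurj (M.velocityRhs cM hf hg hρ ∘ₗ LinearMap.fst ℝ _ _)
  have hw' : ∀ z : W, ν * M.ah k α w.1 w.2 z.1 z.2 =
      M.Fform f z.1 + M.Gform g ρ z.1 - M.bform (fun T x => cM * ρ T x) z.1 := fun z => by
    rw [← hB, hw]; rfl
  refine ⟨(w.1.1, w.2.1), ⟨w.1.2, w.2.2, fun v hv vh hvh => hw' (⟨v, hv⟩, ⟨vh, hvh⟩)⟩, ?_⟩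
  rintro ⟨u, uh⟩ ⟨hu, huh, h⟩
  have h1 : B (⟨u, hu⟩, ⟨uh, huh⟩) = B w := by
    refine LinearMap.ext fun z => ?_
    rw [hB, hB, hw']
    exact h z.1 z.1.2 z.2 z.2.2
  have h2 := hinj h1
  rw [← h2]

end Mesh

end HDG

end

/-! ### The lemma on both sub-systems -/

theorem mainTheorem5 (d : ℕ) (hd : d = 2 ∨ d = 3) :
    -- the velocity update is uniquely solvable for sufficiently large penalty parameter
    (∀ k : ℕ, 1 ≤ k → ∀ σ : ℝ, 0 < σ → ∃ α₀ : ℝ, 0 < α₀ ∧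
      ∀ (Ω : Set (HDG.Eu d)) (M : HDG.Mesh d Ω), M.IsQuasiUniform σ →
      ∀ α : ℝ, α₀ ≤ α → ∀ ν : ℝ, 0 < ν → ∀ cM : ℝ,
      ∀ f : HDG.Eu d → HDG.Eu d, MeasureTheory.MemLp f 2 (MeasureTheory.volume.restrict Ω) →
      ∀ g : HDG.Eu d → HDG.Eu d, MeasureTheory.MemLp g ⊤ (MeasureTheory.volume.restrict Ω) →
      ∀ ρ ∈ M.Qh k,
        ∃! w : (M.cells → HDG.Eu d → HDG.Eu d) × (M.faces → HDG.Eu d → HDG.Eu d),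
          M.IsVelocityUpdate k α ν cM f g ρ w.1 w.2) ∧
    -- lowest order density update
    (∀ (Ω : Set (HDG.Eu d)) (M : HDG.Mesh d Ω) (rule : HDG.UpwindRule) (τ : ℝ), 0 < τ →
      ∀ u ∈ M.Vh 1,
        HDG.IsMMatrix (M.densityMatrix rule τ u) ∧
        ∀ ρ ∈ M.Qh 1,
          (∃! ρ' : M.cells → HDG.Eu d → ℝ, M.IsDensityUpdate 1 rule τ u ρ ρ') ∧
          ∀ ρ' : M.cells → HDG.Eu d → ℝ, M.IsDensityUpdate 1 rule τ u ρ ρ' →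
            (M.IsPositive ρ → M.IsPositive ρ') ∧
            ∀ mass : ℝ, M.mass ρ = mass → M.mass ρ' = mass) := by
  have hd2 : 2 ≤ d := by omega
  refine ⟨fun k hk σ hσ => ?_, fun Ω M rule τ hτ u hu => ?_⟩
  · obtain ⟨C, hC, htr⟩ := HDG.Mesh.exists_trace_le hd2 k hσ
    -- The trace constant `C` is obtained before the mesh is introduced, so the threshold depends
    -- only on `d`, `k` and `σ`.
    exact ⟨2 * C * (d + 1) + 1, by positivity, fun Ω M hM α hα ν hν cM f hf g hg ρ hρ =>
      M.existsUnique_velocityUpdate hd2 hk hC hα (htr Ω M hM) hν cM hf hg hρ⟩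
  · obtain ⟨h1, h2⟩ := M.densityUpdate hd2 rule hτ hu
    refine ⟨h1, fun ρ hρ => ⟨(h2 ρ hρ).1, fun ρ' hρ' => ?_⟩⟩
    obtain ⟨h3, h4⟩ := (h2 ρ hρ).2 ρ' hρ'
    exact ⟨h3, fun m hm => h4.trans hm⟩
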